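/- **Setting.** For $n\ge 1$ let $J=I_n-\frac1n 1_n1_n^\top$ and $\sigma(x)=1/(1+e^{-x})$ (applied entrywise to matrices). Let $X\in\mathbb R^{n\times n}$ be symmetric with zero diagonal, let $M_1\ge M_2\ge 0$, and put $r=M_1/4$ if $X\ne 0$ and $r=M_1/3$ if $X=0$. Let $\mathcal F_g(n,M_1,M_2,X)$ be the set of all $\Theta_\star=\alpha_\star 1_n^\top+1_n\alpha_\star^\top+\beta_\star X+G_\star$ with $G_\star$ positive semidefinite, $JG_\star=G_\star$, $\max_i (G_\star)_{ii}\le r$, $\|\alpha_\star\|_\infty\le r$, $|\beta_\star|\max_{i<j}|X_{ij}|\le r$ and $\max_{i\neq j}(\Theta_\star)_{ij}\le -M_2$ (so that all entries satisfy $|(\Theta_\star)_{ij}|\le M_1$). For an integer $k\ge1$ let $U_kD_kU_k^\top$ be the part of an eigendecomposition of $G_\star$ belonging to its $k$ largest eigenvalues, $Z_\star=U_kD_k^{1/2}\in\mathbb R^{n\times k}$ and $\bar G_k=G_\star-Z_\star Z_\star^\top$; assume that $Z_\star$ has full column rank and let $\kappa$ be its condition number. Write $P=\sigma(\Theta_\star)$.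 An adjacency matrix is a symmetric $0/1$ matrix with zero diagonal; under the model $\Theta_\star$, $A$ is the random adjacency matrix with independent $A_{ij}\sim\mathrm{Bernoulli}(P_{ij})$, $i<j$. Put $$\zeta_n=\max\Big\{2\|A-P\|_{\mathrm{op}},\ \frac{|\langle A-P,\,X/\|X\|_{\mathrm F}\rangle|}{\sqrt k},\ 1\Big\},\qquad \psi_n^2=e^{2M_1}nk\,\max\Big\{e^{-M_2},\frac{\log n}{n}\Big\}$$ (the middle term of $\zeta_n$ is $0$ if $X=0$). **Algorithm.** For $\eta>0$ put $\eta_Z=\eta/\|Z^0\|_{\mathrm{op}}^2$, $\eta_\alpha=\eta/(2n)$, $\eta_\beta=\eta/(2\|X\|_{\mathrm F}^2)$. With $\Theta^t=\alpha^t1_n^\top+1_n(\alpha^t)^\top+\beta^tX+Z^t(Z^t)^\top$ and starting from $(Z^0,\alpha^0,\beta^0)$, the iterates $Z^{t+1}\in\mathbb R^{n\times k}$, $\alpha^{t+1}\in\mathbb R^n$, $\beta^{t+1}\in\mathbb R$ are the Euclidean projections of $$Z^t+2\eta_Z(A-\sigma(\Theta^t))Z^t,\qquad \alpha^t+2\eta_\alpha(A-\sigma(\Theta^t))1_n,\qquad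 \beta^t+\eta_\beta\langle A-\sigma(\Theta^t),X\rangle$$ onto $\{Z: JZ=Z,\ \max_i\|Z_{i*}\|^2\le r\}$, $\{\alpha:\|\alpha\|_\infty\le r\}$ and $\{\beta: |\beta|\max_{i,j}|X_{ij}|\le r\}$; if $X=0$, the update of $\beta$ is skipped. The error metric is $$e_t=\|Z_\star\|_{\mathrm{op}}^2\min_{R\in O(k)}\|Z^t-Z_\star R\|_{\mathrm F}^2+2\|(\alpha^t-\alpha_\star)1_n^\top\|_{\mathrm F}^2+\|(\beta^t-\beta_\star)X\|_{\mathrm F}^2 .$$ **Theorem 4.4.** There are universal positive constants $M_0,c,c_\eta,C_1,\rho,C,c_0,C'$ with $c_\eta\rho<1$ such that the following holds for all $n$, $k\ge 1$, $M_1\ge M_2\ge0$, all $X$ as above with stable rank $\|X\|_{\mathrm F}^2/\|X\|_{\mathrm{op}}^2\ge M_0k$ or $X=0$, all $0<\eta\le c_\eta$ and all $\Theta_\star\in\mathcal F_g(n,M_1,M_2,X)$ (with any parameters $\alpha_\star,\beta_\star,G_\star$ representing it as above and any such $Z_\star$). 1. *Deterministic errors of iterates.* Let $A$ be any adjacency matrix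 with $$\|G_\star\|_{\mathrm{op}}\ge C_1\kappa^2e^{M_1}\zeta_n\max\Big\{\sqrt{\eta ke^{M_1}},\ \sqrt{\eta\|\bar G_k\|_{\mathrm F}^2/\zeta_n^2},\ 1\Big\}.$$ Then, from every initialization with $e_0\le c\,e^{-2M_1}\|Z_\star\|_{\mathrm{op}}^4/\kappa^4$, for all $t\ge0$, $$e_t\le 2\Big(1-\frac{\eta}{e^{M_1}\kappa^2}\rho\Big)^te_0+\frac{C\kappa^2}{\rho}\Big(e^{2M_1}\zeta_n^2k+e^{M_1}\|\bar G_k\|_{\mathrm F}^2\Big).$$ 2. *Probabilistic errors of iterates.* Let $A$ be random with parameter $\Theta_\star$. With probability at least $1-n^{-c_0}$ the following holds: if $$\|G_\star\|_{\mathrm{op}}\ge C_1\kappa^2\sqrt n\,e^{M_1-M_2/2}\max\Big\{\sqrt{\eta ke^{M_1}},\ \sqrt{\eta\|\bar G_k\|_{\mathrm F}^2/\zeta_n^2},\ 1\Big\},$$ then, from every initialization (which may depend on $A$) with $e_0\le c\,e^{-2M_1}\|Z_\star\|_{\mathrm{op}}^4/\kappa^4$, for all $t\ge0$, $$e_t\le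 2\Big(1-\frac{\eta}{e^{M_1}\kappa^2}\rho\Big)^te_0+\frac{C\kappa^2}{\rho}\Big(\psi_n^2+e^{M_1}\|\bar G_k\|_{\mathrm F}^2\Big),$$ and for every integer $T\ge 0$ with $$T>T_0=\log\Big(\frac{M_1^2}{\kappa^2e^{4M_1-M_2}}\frac n{k^2}\Big)\Big/\log\frac{1}{1-\frac{\eta}{e^{M_1}\kappa^2}\rho}$$ each of $\|Z^T(Z^T)^\top-Z_\star Z_\star^\top\|_{\mathrm F}^2$, $\|Z^T(Z^T)^\top-G_\star\|_{\mathrm F}^2$ and $\|\Theta^T-\Theta_\star\|_{\mathrm F}^2$ is at most $C'\kappa^2\big(\psi_n^2+e^{M_1}\|\bar G_k\|_{\mathrm F}^2\big)$. -/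

import Mathlib

open Matrix MeasureTheory ProbabilityTheory

namespace LatentSpace

noncomputable section

variable {n k : ℕ}

/-! ### Matrix norms, singular values, distances -/

open scoped Matrix.Norms.Frobenius in
/-- The Frobenius norm of a real matrix. -/
def frobNorm {m l : ℕ} (A : Matrix (Fin m) (Fin l) ℝ) : ℝ := ‖A‖

open scoped Matrix.Norms.L2Operator in
/-- The operator norm (largest singular value) of a real matrix. -/
def opNorm {m l : ℕ} (A : Matrix (Fin m) (Fin l) ℝ) : ℝ := ‖A‖

/-- The trace inner product `⟨A, B⟩ = Tr(Aᵀ B)`. -/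
def frobInner {m l : ℕ} (A B : Matrix (Fin m) (Fin l) ℝ) : ℝ := (Aᵀ * B).trace

/-- The Euclidean norm of a real vector. -/
def vecNorm {l : ℕ} (v : Fin l → ℝ) : ℝ := ‖WithLp.toLp 2 v‖

/-- The `i`-th largest singular value of a real matrix, counted from `i = 0`. -/
def singVal {m l : ℕ} (A : Matrix (Fin m) (Fin l) ℝ) (i : ℕ) : ℝ :=
  (Matrix.toEuclideanLin A).singularValues i

/-- The condition number of an `n × k` matrix (where `1 ≤ k ≤ n`): the ratio of its largest to its
smallest, that is `k`-th largest, singular value. -/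
def condNum (Z : Matrix (Fin n) (Fin k) ℝ) : ℝ := singVal Z 0 / singVal Z (k - 1)

/-- The stable rank `‖X‖_F² / ‖X‖_op²`. -/
def stableRank (X : Matrix (Fin n) (Fin n) ℝ) : ℝ := frobNorm X ^ 2 / opNorm X ^ 2

/-- `dist(Z₁, Z₂) = min_{R ∈ O(k)} ‖Z₁ - Z₂ R‖_F` (the infimum over the compact group `O(k)`). -/
def procrustesDist (Z₁ Z₂ : Matrix (Fin n) (Fin k) ℝ) : ℝ :=
  ⨅ R : Matrix.orthogonalGroup (Fin k) ℝ, frobNorm (Z₁ - Z₂ * (R : Matrix (Fin k) (Fin k) ℝ))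

/-- The centering matrix `J = I - (1/n) 1 1ᵀ`. -/
def centering (n : ℕ) : Matrix (Fin n) (Fin n) ℝ :=
  1 - (1 / (n : ℝ)) • Matrix.of fun _ _ => (1 : ℝ)

/-- `Z = U_k D_k^{1/2}`, where the columns of `U_k` are orthonormal eigenvectors of `G` belonging to
its `k` largest eigenvalues (with multiplicity), listed in decreasing order in the diagonal matrix
`D_k`.  So `Z Zᵀ = U_k D_k U_kᵀ` is a best rank-`k` approximation of `G` when `G` is positive
semi-definite. -/
def IsTopEigenFactor (G : Matrix (Fin n) (Fin n) ℝ) (Z : Matrix (Fin n) (Fin k) ℝ) : Prop :=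
  ∃ (U : Matrix (Fin n) (Fin k) ℝ) (d : Fin k → ℝ),
    Uᵀ * U = 1 ∧ Antitone d ∧ G * U = U * Matrix.diagonal d ∧
    (∀ v : Fin n → ℝ, Uᵀ *ᵥ v = 0 → ∀ j, v ⬝ᵥ (G *ᵥ v) ≤ d j * (v ⬝ᵥ v)) ∧
    Z = U * Matrix.diagonal fun j => √(d j)

/-! ### The model -/

/-- An admissible covariate matrix: symmetric with zero diagonal. -/
def IsCovariate (X : Matrix (Fin n) (Fin n) ℝ) : Prop := X.IsSymm ∧ ∀ i, X i i = 0

/-- An adjacency matrix of a simple undirected graph on `n` nodes. -/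
def IsAdjacency (A : Matrix (Fin n) (Fin n) ℝ) : Prop :=
  A.IsSymm ∧ (∀ i, A i i = 0) ∧ ∀ i j, A i j = 0 ∨ A i j = 1

/-- `Θ = α 1ᵀ + 1 αᵀ + β X + G`. -/
def theta (X : Matrix (Fin n) (Fin n) ℝ) (α : Fin n → ℝ) (β : ℝ) (G : Matrix (Fin n) (Fin n) ℝ) :
    Matrix (Fin n) (Fin n) ℝ :=
  Matrix.of fun i j => α i + α j + β * X i j + G i j

/-- The entrywise sigmoid `σ(Θ)`. -/
def sigmoidMat (Θ : Matrix (Fin n) (Fin n) ℝ) : Matrix (Fin n) (Fin n) ℝ := Θ.map Real.sigmoid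

open Classical in
/-- The radius of the entrywise constraints: `M₁ / 4` with a covariate (four summands in every
`Θ i j`), `M₁ / 3` without (three summands).  The constraints then force `|Θ i j| ≤ M₁`. -/
def radius (M₁ : ℝ) (X : Matrix (Fin n) (Fin n) ℝ) : ℝ := if X = 0 then M₁ / 3 else M₁ / 4

/-- The parameters `(α, β, G)` satisfy the constraints that define the general class
`F_g(n, M₁, M₂, X)`. -/
structure InClass (M₁ M₂ : ℝ) (X : Matrix (Fin n) (Fin n) ℝ) (α : Fin n → ℝ) (β : ℝ)
    (G : Matrix (Fin n) (Fin n) ℝ) : Prop where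
  posSemidef : G.PosSemidef
  centered : centering n * G = G
  diag_le : ∀ i, G i i ≤ radius M₁ X
  alpha_le : ∀ i, |α i| ≤ radius M₁ X
  beta_le : ∀ i j, i < j → |β| * |X i j| ≤ radius M₁ X
  theta_le : ∀ i j, i ≠ j → theta X α β G i j ≤ -M₂

/-- `A` is a random adjacency matrix whose entries above the diagonal are independent, with
`A i j ∼ Bernoulli(σ(Θ i j))`. -/
structure IsRandomNetwork {Ω : Type*} [MeasurableSpace Ω] (μ : Measure Ω)
    (Θ : Matrix (Fin n) (Fin n) ℝ) (A : Ω → Matrix (Fin n) (Fin n) ℝ) : Prop where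
  adjacency : ∀ ω, IsAdjacency (A ω)
  measurable : ∀ i j, Measurable fun ω => A ω i j
  prob : ∀ i j, i < j → μ {ω | A ω i j = 1} = ENNReal.ofReal (Real.sigmoid (Θ i j))
  indep : iIndepFun (fun (p : {p : Fin n × Fin n // p.1 < p.2}) (ω : Ω) => A ω p.1.1 p.1.2) μ

/-! ### Projected gradient descent -/

/-- The constraint set for `Z`: centered columns, `max_i ‖Z_{i*}‖²` at most the radius. -/
def constraintZ (M₁ : ℝ) (X : Matrix (Fin n) (Fin n) ℝ) (k : ℕ) :
    Set (Matrix (Fin n) (Fin k) ℝ) :=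
  {Z | centering n * Z = Z ∧ ∀ i, vecNorm (Z i) ^ 2 ≤ radius M₁ X}

/-- The constraint set for `α`: `‖α‖_∞` at most the radius. -/
def constraintAlpha (M₁ : ℝ) (X : Matrix (Fin n) (Fin n) ℝ) : Set (Fin n → ℝ) :=
  {α | ∀ i, |α i| ≤ radius M₁ X}

/-- The constraint set for `β`: `|β| max_{i,j} |X i j|` at most the radius. -/
def constraintBeta (M₁ : ℝ) (X : Matrix (Fin n) (Fin n) ℝ) : Set ℝ :=
  {β | ∀ i j, |β| * |X i j| ≤ radius M₁ X}

/-- `y` is the projection of `x` onto `S`, that is a point of `S` nearest to `x` in the norm `N`. -/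
def IsProjection {E : Type*} [Sub E] (N : E → ℝ) (S : Set E) (x y : E) : Prop :=
  y ∈ S ∧ ∀ w ∈ S, N (x - y) ≤ N (x - w)

/-- A triple `(Z, α, β)`, the state of the algorithm. -/
structure Iterate (n k : ℕ) where
  Z : Matrix (Fin n) (Fin k) ℝ
  α : Fin n → ℝ
  β : ℝ

/-- The matrix `Θ` of a state, `Θ = α 1ᵀ + 1 αᵀ + β X + Z Zᵀ`. -/
def Iterate.theta (X : Matrix (Fin n) (Fin n) ℝ) (s : Iterate n k) : Matrix (Fin n) (Fin n) ℝ :=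
  LatentSpace.theta X s.α s.β (s.Z * s.Zᵀ)

/-- The sequence `s` consists of the iterates of projected gradient descent with data `A`, `X` and
step sizes `η / ‖Z⁰‖_op²`, `η / (2n)`, `η / (2 ‖X‖_F²)`, from the initial state `s 0`.  When `X = 0`,
the update of `β` is skipped. -/
structure IsPGD (M₁ η : ℝ) (A X : Matrix (Fin n) (Fin n) ℝ) (s : ℕ → Iterate n k) : Prop where
  stepZ : ∀ t, IsProjection frobNorm (constraintZ M₁ X k)
    ((s t).Z + (2 * (η / opNorm (s 0).Z ^ 2)) • ((A - sigmoidMat ((s t).theta X)) * (s t).Z))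
    (s (t + 1)).Z
  stepAlpha : ∀ t, IsProjection vecNorm (constraintAlpha M₁ X)
    ((s t).α + (2 * (η / (2 * n))) • ((A - sigmoidMat ((s t).theta X)) *ᵥ fun _ => 1))
    (s (t + 1)).α
  stepBeta : X ≠ 0 → ∀ t, IsProjection (fun b : ℝ => |b|) (constraintBeta M₁ X)
    ((s t).β + η / (2 * frobNorm X ^ 2) * frobInner (A - sigmoidMat ((s t).theta X)) X)
    (s (t + 1)).β
  skipBeta : X = 0 → ∀ t, (s (t + 1)).β = (s t).β

/-! ### Error metric and noise level -/

/-- The error metric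
`e = ‖Z⋆‖_op² dist(Z, Z⋆)² + 2 ‖(α - α⋆) 1ᵀ‖_F² + ‖(β - β⋆) X‖_F²` of a state. -/
def err (X : Matrix (Fin n) (Fin n) ℝ) (Zs : Matrix (Fin n) (Fin k) ℝ) (αs : Fin n → ℝ) (βs : ℝ)
    (s : Iterate n k) : ℝ :=
  opNorm Zs ^ 2 * procrustesDist s.Z Zs ^ 2
    + 2 * frobNorm (Matrix.vecMulVec (s.α - αs) (fun _ : Fin n => (1 : ℝ))) ^ 2
    + frobNorm ((s.β - βs) • X) ^ 2

/-- `ζ = max{2 ‖A - P‖_op, |⟨A - P, X / ‖X‖_F⟩| / √k, 1}`, where `P = σ(Θ⋆)`; the middle term is `0`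
when `X = 0`. -/
def zeta (k : ℕ) (A P X : Matrix (Fin n) (Fin n) ℝ) : ℝ :=
  max (max (2 * opNorm (A - P)) (|frobInner (A - P) ((frobNorm X)⁻¹ • X)| / √k)) 1

/-- `ψ² = e^{2 M₁} n k max{e^{-M₂}, log n / n}`. -/
def psiSq (n k : ℕ) (M₁ M₂ : ℝ) : ℝ :=
  Real.exp (2 * M₁) * n * k * max (Real.exp (-M₂)) (Real.log n / n)

/-- The factor `max{√(η k e^{M₁}), √(η ‖Ḡ_k‖_F² / ζ²), 1}` of the signal strength conditions. -/
def signalFactor (k : ℕ) (M₁ η ζ : ℝ) (Gbar : Matrix (Fin n) (Fin n) ℝ) : ℝ :=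
  max (max (√(η * k * Real.exp M₁)) (√(η * frobNorm Gbar ^ 2 / ζ ^ 2))) 1

/-- The contraction factor `1 - η ρ / (e^{M₁} κ²)`. -/
def rate (M₁ η ρ κ : ℝ) : ℝ := 1 - η / (Real.exp M₁ * κ ^ 2) * ρ

/-- The number of iterations
`T₀ = log(M₁² n / (κ² e^{4 M₁ - M₂} k²)) / log(1 / (1 - η ρ / (e^{M₁} κ²)))`. -/
def iterCount (n k : ℕ) (M₁ M₂ η ρ κ : ℝ) : ℝ :=
  Real.log (M₁ ^ 2 / (κ ^ 2 * Real.exp (4 * M₁ - M₂)) * (n / (k : ℝ) ^ 2))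
    / Real.log (1 / rate M₁ η ρ κ)

end

end LatentSpace

open LatentSpace

/-! The analysis follows the loss, not the gradient at the truth. As a function of Θ the negative
log-likelihood h is convex, its second derivatives are at most 1/4, and on the box |Θ_ij| ≤ M₁ they
are at least e^{-M₁}/4. In the coordinates (Z, α, β) the only nonlinear part of Θ is ZZᵀ. Let w be
the truth, cut to rank k and rotated by R into best alignment with Z^t, and put Δ = Z^t - Z⋆R.
Smoothness between consecutive iterates, convexity between Θ^t and w, and the three-point
inequalities of the projections add up in `IsPGD.negLogLik_sub_le` to

h(x_{t+1}) - h(w) ≤ (d(x_t, w) - d(x_{t+1}, w)) / (2η) + ⟨A - σ(Θ^t), ΔΔᵀ⟩ + (step size mismatch),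

where d is the squared distance `stateDist`, and the mismatch comes from using ‖Z⁰‖ in place of
‖Z⋆‖. Conversely, strong convexity at Θ⋆ and duality of the operator norm with low rank matrices
give h(x) - h(w) ≥ e^{-M₁}‖Θ - Θ(w)‖_F²/32 - N for feasible x (`Regime.energy_lower`), with N the
`noiseLevel`. Finally `Regime.lyap_le` bounds the error metric by 4κ²‖Θ - Θ(w)‖_F². It combines near
orthogonality of the components of Θ (`sum_sq_le_thetaErr_sq`, where the stable rank enters) with
the Procrustes bound `frobNorm_sub_sq_le_gram`.

In a small basin around the truth these facts give a contraction up to O(ηN). The noise may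
nevertheless be too large for the basin to be invariant. This is settled by `Regime.dichotomy`: if
the error does not increase, the iterate stays in the basin; if it increases, the inequalities force
h(x_{t+1}) - h(w) ≤ 30N. From then on descent of the loss keeps that bound
(`Regime.excess_succ_le`), and a small loss implies a small error by `Regime.energy_lower`, whether
or not the iterate is in the basin.

The contraction needs the noise to be weak against ‖Z⋆‖²e^{-M₁}/κ². The signal condition of the
probabilistic part guarantees this when e^{-M₂} ≥ log n / n. Otherwise M₁ is so large that an
admissible initial error is already below the noise (`le_exp_mul_log_of_sparse`), and one step
reaches loss at most 30N (`Regime.step_of_lyap_le_noise`).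

It remains to show ‖A - P‖_op ≲ √(np) for p = max(e^{-M₂}, log n / n), by the trace method. Only
closed walks without loops that use no edge exactly once contribute, each at most p^{edges}, and
there is at most one vertex more than there are edges. Instead of being encoded, the walks are
counted by comparison. The weight p^{vertices} is the probability that a random vertex set contains
the walk (`sum_goodWalks_pow_card_le`). The number of such walks inside a set is a lower bound for
the trace moments of a dense random matrix with entries 2, -1, -1 (`goodWalkCount_le`). The norm of
that matrix has subgaussian exponential moments, obtained by averaging its quadratic form over a
ball (`sum_exp_opNorm_le`). The direction X is handled by Hoeffding's inequality. -/

namespace LatentSpace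

/-! ### Frobenius, operator and Euclidean norms -/

section Norms

variable {m l q : ℕ}

lemma frobInner_eq_sum (A B : Matrix (Fin m) (Fin l) ℝ) :
    frobInner A B = ∑ i, ∑ j, A i j * B i j := by
  simp only [frobInner, Matrix.trace, Matrix.diag_apply, Matrix.mul_apply, Matrix.transpose_apply]
  exact Finset.sum_comm

lemma frobNorm_sq (A : Matrix (Fin m) (Fin l) ℝ) :
    frobNorm A ^ 2 = ∑ i, ∑ j, A i j ^ 2 := by
  unfold frobNorm
  rw [Matrix.frobenius_norm_def]
  have h0 : 0 ≤ ∑ i, ∑ j, ‖A i j‖ ^ (2 : ℝ) :=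
    Finset.sum_nonneg fun i _ => Finset.sum_nonneg fun j _ => by positivity
  rw [← Real.sqrt_eq_rpow, Real.sq_sqrt h0]
  refine Finset.sum_congr rfl fun i _ => Finset.sum_congr rfl fun j _ => ?_
  rw [Real.rpow_two, Real.norm_eq_abs, sq_abs]

open scoped Matrix.Norms.Frobenius in
lemma frobNorm_nonneg (A : Matrix (Fin m) (Fin l) ℝ) : 0 ≤ frobNorm A :=
  norm_nonneg (E := Matrix (Fin m) (Fin l) ℝ) A

lemma frobInner_self (A : Matrix (Fin m) (Fin l) ℝ) : frobInner A A = frobNorm A ^ 2 := by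
  rw [frobNorm_sq, frobInner_eq_sum]
  simp only [sq]

lemma frobInner_comm (A B : Matrix (Fin m) (Fin l) ℝ) : frobInner A B = frobInner B A := by
  simp only [frobInner_eq_sum, mul_comm]

lemma frobInner_add_right (A B C : Matrix (Fin m) (Fin l) ℝ) :
    frobInner A (B + C) = frobInner A B + frobInner A C := by
  simp [frobInner, Matrix.mul_add, Matrix.trace_add]

lemma frobInner_sub_right (A B C : Matrix (Fin m) (Fin l) ℝ) :
    frobInner A (B - C) = frobInner A B - frobInner A C := by
  simp [frobInner, Matrix.mul_sub, Matrix.trace_sub]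

lemma frobInner_smul_right (A B : Matrix (Fin m) (Fin l) ℝ) (c : ℝ) :
    frobInner A (c • B) = c * frobInner A B := by
  simp [frobInner, Matrix.mul_smul, Matrix.trace_smul]

lemma frobInner_add_left (A B C : Matrix (Fin m) (Fin l) ℝ) :
    frobInner (A + B) C = frobInner A C + frobInner B C := by
  rw [frobInner_comm, frobInner_add_right, frobInner_comm C, frobInner_comm C]

lemma frobInner_sub_left (A B C : Matrix (Fin m) (Fin l) ℝ) :
    frobInner (A - B) C = frobInner A C - frobInner B C := by
  rw [frobInner_comm, frobInner_sub_right, frobInner_comm C, frobInner_comm C]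

lemma frobInner_smul_left (A B : Matrix (Fin m) (Fin l) ℝ) (c : ℝ) :
    frobInner (c • A) B = c * frobInner A B := by
  rw [frobInner_comm, frobInner_smul_right, frobInner_comm]

lemma frobInner_transpose (A B : Matrix (Fin m) (Fin l) ℝ) :
    frobInner Aᵀ Bᵀ = frobInner A B := by
  simp only [frobInner_eq_sum, Matrix.transpose_apply]
  exact Finset.sum_comm

lemma frobInner_mul_left (A : Matrix (Fin m) (Fin q) ℝ) (B : Matrix (Fin q) (Fin l) ℝ)
    (C : Matrix (Fin m) (Fin l) ℝ) : frobInner (A * B) C = frobInner B (Aᵀ * C) := by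
  simp [frobInner, Matrix.transpose_mul, Matrix.mul_assoc]

lemma frobInner_mul_left' (A : Matrix (Fin m) (Fin q) ℝ) (B : Matrix (Fin q) (Fin l) ℝ)
    (C : Matrix (Fin m) (Fin l) ℝ) : frobInner (A * B) C = frobInner A (C * Bᵀ) := by
  rw [← frobInner_transpose, Matrix.transpose_mul, frobInner_mul_left, ← frobInner_transpose]
  simp

lemma frobNorm_transpose (A : Matrix (Fin m) (Fin l) ℝ) : frobNorm Aᵀ = frobNorm A := by
  rw [← sq_eq_sq₀ (frobNorm_nonneg _) (frobNorm_nonneg _), ← frobInner_self, ← frobInner_self,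
    frobInner_transpose]

open scoped Matrix.Norms.Frobenius in
lemma frobNorm_add_le (A B : Matrix (Fin m) (Fin l) ℝ) :
    frobNorm (A + B) ≤ frobNorm A + frobNorm B :=
  norm_add_le A B

lemma frobNorm_smul (c : ℝ) (A : Matrix (Fin m) (Fin l) ℝ) :
    frobNorm (c • A) = |c| * frobNorm A := by
  rw [← sq_eq_sq₀ (frobNorm_nonneg _) (mul_nonneg (abs_nonneg c) (frobNorm_nonneg _)),
    mul_pow, ← frobInner_self, ← frobInner_self, frobInner_smul_left, frobInner_smul_right, sq_abs]
  ring

lemma frobNorm_neg (A : Matrix (Fin m) (Fin l) ℝ) : frobNorm (-A) = frobNorm A := by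
  rw [← neg_one_smul ℝ A, frobNorm_smul]; simp

lemma frobNorm_sub_le (A B : Matrix (Fin m) (Fin l) ℝ) :
    frobNorm (A - B) ≤ frobNorm A + frobNorm B := by
  rw [sub_eq_add_neg]
  exact (frobNorm_add_le _ _).trans (by rw [frobNorm_neg])

lemma frobNorm_sub_comm (A B : Matrix (Fin m) (Fin l) ℝ) :
    frobNorm (A - B) = frobNorm (B - A) := by
  rw [← frobNorm_neg, neg_sub]

open scoped Matrix.Norms.Frobenius in
lemma frobNorm_eq_zero {A : Matrix (Fin m) (Fin l) ℝ} : frobNorm A = 0 ↔ A = 0 :=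
  norm_eq_zero (a := A)

lemma frobNorm_zero : frobNorm (0 : Matrix (Fin m) (Fin l) ℝ) = 0 :=
  frobNorm_eq_zero.mpr rfl

lemma frobNorm_sub_sq (A B : Matrix (Fin m) (Fin l) ℝ) :
    frobNorm (A - B) ^ 2 = frobNorm A ^ 2 - 2 * frobInner A B + frobNorm B ^ 2 := by
  rw [← frobInner_self, ← frobInner_self, ← frobInner_self, frobInner_sub_left,
    frobInner_sub_right, frobInner_sub_right, frobInner_comm B A]
  ring

lemma frobNorm_add_sq (A B : Matrix (Fin m) (Fin l) ℝ) :
    frobNorm (A + B) ^ 2 = frobNorm A ^ 2 + 2 * frobInner A B + frobNorm B ^ 2 := by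
  rw [← frobInner_self, ← frobInner_self, ← frobInner_self, frobInner_add_left,
    frobInner_add_right, frobInner_add_right, frobInner_comm B A]
  ring

lemma abs_frobInner_le (A B : Matrix (Fin m) (Fin l) ℝ) :
    |frobInner A B| ≤ frobNorm A * frobNorm B := by
  apply abs_le_of_sq_le_sq _ (mul_nonneg (frobNorm_nonneg _) (frobNorm_nonneg _))
  rw [mul_pow, frobNorm_sq, frobNorm_sq, frobInner_eq_sum]
  simp only [← Finset.sum_product']
  exact Finset.sum_mul_sq_le_sq_mul_sq _ _ _

lemma frobNorm_mul_le (A : Matrix (Fin m) (Fin q) ℝ) (B : Matrix (Fin q) (Fin l) ℝ) :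
    frobNorm (A * B) ≤ frobNorm A * frobNorm B := by
  unfold frobNorm; exact Matrix.frobenius_norm_mul A B

lemma vecNorm_sq (v : Fin l → ℝ) : vecNorm v ^ 2 = ∑ i, v i ^ 2 := by
  simp [vecNorm, EuclideanSpace.norm_sq_eq]

lemma vecNorm_sq_eq_dotProduct (v : Fin l → ℝ) : vecNorm v ^ 2 = v ⬝ᵥ v := by
  rw [vecNorm_sq]; simp [dotProduct, sq]

lemma vecNorm_nonneg (v : Fin l → ℝ) : 0 ≤ vecNorm v := norm_nonneg _

lemma vecNorm_eq_zero {v : Fin l → ℝ} : vecNorm v = 0 ↔ v = 0 := by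
  simp [vecNorm]

lemma abs_dotProduct_le (v w : Fin l → ℝ) : |v ⬝ᵥ w| ≤ vecNorm v * vecNorm w := by
  apply abs_le_of_sq_le_sq _ (mul_nonneg (vecNorm_nonneg _) (vecNorm_nonneg _))
  rw [mul_pow, vecNorm_sq, vecNorm_sq]
  exact Finset.sum_mul_sq_le_sq_mul_sq _ _ _

open scoped Matrix.Norms.L2Operator in
lemma opNorm_nonneg (A : Matrix (Fin m) (Fin l) ℝ) : 0 ≤ opNorm A :=
  norm_nonneg (E := Matrix (Fin m) (Fin l) ℝ) A

lemma vecNorm_mulVec_le (A : Matrix (Fin m) (Fin l) ℝ) (v : Fin l → ℝ) :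
    vecNorm (A *ᵥ v) ≤ opNorm A * vecNorm v :=
  Matrix.l2_opNorm_mulVec A (WithLp.toLp 2 v)

lemma opNorm_le_of_mulVec {A : Matrix (Fin m) (Fin l) ℝ} {c : ℝ} (hc : 0 ≤ c)
    (h : ∀ v, vecNorm (A *ᵥ v) ≤ c * vecNorm v) : opNorm A ≤ c := by
  unfold opNorm
  rw [Matrix.l2_opNorm_def]
  refine ContinuousLinearMap.opNorm_le_bound _ hc fun x => ?_
  exact h x.ofLp

lemma opNorm_transpose (A : Matrix (Fin m) (Fin l) ℝ) : opNorm Aᵀ = opNorm A := by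
  unfold opNorm
  rw [← Matrix.conjTranspose_eq_transpose_of_trivial, Matrix.l2_opNorm_conjTranspose]

lemma opNorm_mul_le (A : Matrix (Fin m) (Fin q) ℝ) (B : Matrix (Fin q) (Fin l) ℝ) :
    opNorm (A * B) ≤ opNorm A * opNorm B := by
  unfold opNorm; exact Matrix.l2_opNorm_mul A B

open scoped Matrix.Norms.L2Operator in
lemma opNorm_add_le (A B : Matrix (Fin m) (Fin l) ℝ) :
    opNorm (A + B) ≤ opNorm A + opNorm B :=
  norm_add_le A B

open scoped Matrix.Norms.L2Operator in
lemma opNorm_neg (A : Matrix (Fin m) (Fin l) ℝ) : opNorm (-A) = opNorm A :=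
  norm_neg A

open scoped Matrix.Norms.L2Operator in
lemma opNorm_eq_zero {A : Matrix (Fin m) (Fin l) ℝ} : opNorm A = 0 ↔ A = 0 :=
  norm_eq_zero (a := A)

lemma frobNorm_sq_eq_sum_col (B : Matrix (Fin m) (Fin l) ℝ) :
    frobNorm B ^ 2 = ∑ j, vecNorm (fun i => B i j) ^ 2 := by
  rw [frobNorm_sq, Finset.sum_comm]
  simp only [vecNorm_sq]

lemma frobNorm_mul_le_opNorm_mul (A : Matrix (Fin m) (Fin q) ℝ) (B : Matrix (Fin q) (Fin l) ℝ) :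
    frobNorm (A * B) ≤ opNorm A * frobNorm B := by
  rw [← sq_le_sq₀ (frobNorm_nonneg _) (mul_nonneg (opNorm_nonneg _) (frobNorm_nonneg _)),
    mul_pow, frobNorm_sq_eq_sum_col, frobNorm_sq_eq_sum_col, Finset.mul_sum]
  refine Finset.sum_le_sum fun j _ => ?_
  rw [← mul_pow]
  exact pow_le_pow_left₀ (vecNorm_nonneg _) (vecNorm_mulVec_le A fun i => B i j) 2

lemma frobNorm_mul_le_mul_opNorm (A : Matrix (Fin m) (Fin q) ℝ) (B : Matrix (Fin q) (Fin l) ℝ) :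
    frobNorm (A * B) ≤ frobNorm A * opNorm B := by
  rw [← frobNorm_transpose, Matrix.transpose_mul, ← frobNorm_transpose A, ← opNorm_transpose B,
    mul_comm]
  exact frobNorm_mul_le_opNorm_mul _ _

lemma opNorm_le_frobNorm (A : Matrix (Fin m) (Fin l) ℝ) : opNorm A ≤ frobNorm A := by
  refine opNorm_le_of_mulVec (frobNorm_nonneg _) fun v => ?_
  rw [← sq_le_sq₀ (vecNorm_nonneg _) (mul_nonneg (frobNorm_nonneg _) (vecNorm_nonneg _)),
    mul_pow, frobNorm_sq, vecNorm_sq, vecNorm_sq, Finset.sum_mul]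
  refine Finset.sum_le_sum fun i _ => ?_
  exact Finset.sum_mul_sq_le_sq_mul_sq Finset.univ (A i) v

lemma frobNorm_one_sq : frobNorm (1 : Matrix (Fin l) (Fin l) ℝ) ^ 2 = l := by
  rw [← frobInner_self]; simp [frobInner]

lemma frobNorm_le_sqrt_mul_opNorm (A : Matrix (Fin m) (Fin l) ℝ) :
    frobNorm A ≤ √l * opNorm A := by
  have h := frobNorm_mul_le_opNorm_mul A (1 : Matrix (Fin l) (Fin l) ℝ)
  rw [Matrix.mul_one] at h
  have h1 : frobNorm (1 : Matrix (Fin l) (Fin l) ℝ) = √l := by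
    rw [← frobNorm_one_sq, Real.sqrt_sq (frobNorm_nonneg _)]
  rwa [h1, mul_comm] at h

lemma abs_frobInner_mul_transpose_le (W : Matrix (Fin m) (Fin m) ℝ)
    (B C : Matrix (Fin m) (Fin l) ℝ) :
    |frobInner W (B * Cᵀ)| ≤ opNorm W * frobNorm B * frobNorm C := by
  rw [← frobInner_mul_left']
  calc |frobInner (W * C) B| ≤ frobNorm (W * C) * frobNorm B := abs_frobInner_le _ _
    _ ≤ (opNorm W * frobNorm C) * frobNorm B := by
        gcongr
        · exact frobNorm_nonneg _
        · exact frobNorm_mul_le_opNorm_mul _ _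
    _ = _ := by ring

lemma euclidean_inner_eq_sum (x y : EuclideanSpace ℝ (Fin m)) :
    inner ℝ x y = ∑ i, x i * y i := by
  simp [PiLp.inner_apply, mul_comm]

/-- An orthonormal basis of the column space of a matrix. -/
lemma exists_orthonormal_columns (M : Matrix (Fin m) (Fin q) ℝ) :
    ∃ V : Matrix (Fin m) (Fin M.rank) ℝ, Vᵀ * V = 1 ∧ V * (Vᵀ * M) = M := by
  set S := LinearMap.range (Matrix.toEuclideanLin M) with hS
  have hr : Module.finrank ℝ S = M.rank := by
    rw [hS, Matrix.rank_eq_finrank_range_toLin M (EuclideanSpace.basisFun _ ℝ).toBasis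
      (EuclideanSpace.basisFun _ ℝ).toBasis]
    rfl
  let b : OrthonormalBasis (Fin M.rank) ℝ S :=
    (stdOrthonormalBasis ℝ S).reindex (finCongr hr)
  refine ⟨Matrix.of fun i a => (b a : EuclideanSpace ℝ (Fin m)) i, ?_, ?_⟩
  · ext a c
    have h := orthonormal_iff_ite.mp b.orthonormal a c
    rw [Submodule.coe_inner, euclidean_inner_eq_sum] at h
    rw [Matrix.mul_apply, Matrix.one_apply, ← h]
    rfl
  · ext i j
    let y : S := ⟨Matrix.toEuclideanLin M (EuclideanSpace.single j 1), LinearMap.mem_range_self _ _⟩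
    have hy : ∀ i, (y : EuclideanSpace ℝ (Fin m)) i = M i j := fun i => by
      simp [y, Matrix.toEuclideanLin, Matrix.toLpLin_apply]
    have h := congrArg (fun w : S => (w : EuclideanSpace ℝ (Fin m)) i) (b.sum_repr' y)
    simp only [Submodule.coe_sum, Submodule.coe_smul, WithLp.ofLp_sum, Finset.sum_apply] at h
    rw [hy] at h
    rw [← h, Matrix.mul_apply]
    refine Finset.sum_congr rfl fun a _ => ?_
    rw [Matrix.mul_apply, Submodule.coe_inner, euclidean_inner_eq_sum]
    simp only [PiLp.smul_apply, smul_eq_mul, Matrix.transpose_apply, hy, Matrix.of_apply]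
    rw [mul_comm]

/-- The duality `|⟨W, M⟩| ≤ ‖W‖_op √(rank M) ‖M‖_F`. -/
lemma abs_frobInner_le_opNorm_mul_sqrt_rank (W M : Matrix (Fin m) (Fin q) ℝ) :
    |frobInner W M| ≤ opNorm W * √M.rank * frobNorm M := by
  obtain ⟨V, hVV, hVM⟩ := exists_orthonormal_columns M
  have h1 : frobInner W M = frobInner (Vᵀ * W) (Vᵀ * M) := by
    conv_lhs => rw [← hVM]
    rw [frobInner_comm, frobInner_mul_left, frobInner_comm]
  have h2 : frobNorm (Vᵀ * M) = frobNorm M := by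
    rw [← sq_eq_sq₀ (frobNorm_nonneg _) (frobNorm_nonneg _), ← frobInner_self,
      frobInner_mul_left, Matrix.transpose_transpose, hVM, frobInner_self]
  have h3 : frobNorm V = √M.rank := by
    have : frobNorm V ^ 2 = M.rank := by
      rw [← frobInner_self, frobInner, hVV]; simp
    rw [← this, Real.sqrt_sq (frobNorm_nonneg _)]
  have h4 : frobNorm (Vᵀ * W) ≤ opNorm W * √M.rank := by
    refine (frobNorm_mul_le_mul_opNorm _ _).trans ?_
    rw [frobNorm_transpose, h3, mul_comm]
  rw [h1]
  refine (abs_frobInner_le _ _).trans ?_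
  rw [h2]
  exact mul_le_mul_of_nonneg_right h4 (frobNorm_nonneg _)

/-- The difference of two Gram matrices factors through the 2l columns of `Z` and `-Y`, so its rank
is at most 2l. -/
lemma abs_frobInner_gram_sub_gram_le (W : Matrix (Fin m) (Fin m) ℝ)
    (Z Y : Matrix (Fin m) (Fin l) ℝ) :
    |frobInner W (Z * Zᵀ - Y * Yᵀ)| ≤ opNorm W * √(2 * l) * frobNorm (Z * Zᵀ - Y * Yᵀ) := by
  refine (abs_frobInner_le_opNorm_mul_sqrt_rank _ _).trans ?_
  have hr : (Z * Zᵀ - Y * Yᵀ).rank ≤ 2 * l := by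
    have h : Z * Zᵀ - Y * Yᵀ = Matrix.fromCols Z (-Y) * Matrix.fromRows Zᵀ Yᵀ := by
      rw [Matrix.fromCols_mul_fromRows, Matrix.neg_mul, sub_eq_add_neg]
    rw [h]
    refine (Matrix.rank_mul_le_left _ _).trans ((Matrix.rank_le_card_width _).trans ?_)
    simp [two_mul]
  have : √((Z * Zᵀ - Y * Yᵀ).rank : ℝ) ≤ √(2 * l) := Real.sqrt_le_sqrt (by exact_mod_cast hr)
  gcongr
  · exact frobNorm_nonneg _
  · exact opNorm_nonneg _

end Norms

/-! ### Projections onto convex sets -/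

/-- The variational inequality for the projection onto a convex set, in a norm `N` that comes from
the bilinear form `ip`, in the form of a three point inequality. -/
lemma IsProjection.three_point {E : Type*} [AddCommGroup E] [Module ℝ E] {N : E → ℝ}
    {ip : E → E → ℝ} (hN : ∀ u, 0 ≤ N u)
    (h : ∀ u v (t : ℝ), N (u - t • v) ^ 2 = N u ^ 2 - 2 * t * ip u v + t ^ 2 * N v ^ 2)
    (hadd : ∀ u v w, ip (u + v) w = ip u w + ip v w)
    {S : Set E} (hS : Convex ℝ S) {x g y w : E} (hp : IsProjection N S (x + g) y) (hw : w ∈ S) :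
    2 * ip g (w - y) ≤ N (x - w) ^ 2 - N (x - y) ^ 2 - N (w - y) ^ 2 := by
  have key : ip (x + g - y) (w - y) ≤ 0 := by
    by_contra! hpos
    set b := ip (x + g - y) (w - y)
    set d := N (w - y) ^ 2 with hd
    have hd0 : 0 ≤ d := sq_nonneg _
    -- Moving from `y` by `t` towards `w` changes the squared distance by `-2tb + t²d`. This choice
    -- gives `t d < b`, so the distance would strictly decrease; the `+ 1` covers `d = 0`.
    set t := min 1 (b / (d + 1)) with ht
    have ht0 : 0 < t := lt_min one_pos (by positivity)
    have ht1 : t ≤ 1 := min_le_left _ _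
    have htd : t * (d + 1) ≤ b := by
      have := min_le_right 1 (b / (d + 1))
      rwa [le_div_iff₀ (by positivity)] at this
    have hmem : y + t • (w - y) ∈ S := by
      have := hS hp.1 hw (sub_nonneg.mpr ht1) ht0.le (by ring)
      convert this using 1
      module
    have h1 := hp.2 _ hmem
    have h2 : x + g - (y + t • (w - y)) = (x + g - y) - t • (w - y) := by abel
    rw [h2] at h1
    have h3 := pow_le_pow_left₀ (hN _) h1 2
    rw [h] at h3
    nlinarith
  have h1 : x + g - y = (x - y) + g := by abel
  have h2 : x - w = (x - y) - (1 : ℝ) • (w - y) := by rw [one_smul]; abel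
  rw [h1, hadd] at key
  rw [h2, h]
  linarith

lemma IsProjection.frob_three_point {m l : ℕ} {S : Set (Matrix (Fin m) (Fin l) ℝ)}
    (hS : Convex ℝ S) {x g y w : Matrix (Fin m) (Fin l) ℝ}
    (hp : IsProjection frobNorm S (x + g) y) (hw : w ∈ S) :
    2 * frobInner g (w - y)
      ≤ frobNorm (x - w) ^ 2 - frobNorm (x - y) ^ 2 - frobNorm (w - y) ^ 2 := by
  refine IsProjection.three_point (ip := frobInner) frobNorm_nonneg (fun u v t => ?_)
    frobInner_add_left hS hp hw
  rw [frobNorm_sub_sq, frobInner_smul_right, frobNorm_smul, mul_pow, sq_abs]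
  ring

lemma IsProjection.vec_three_point {l : ℕ} {S : Set (Fin l → ℝ)}
    (hS : Convex ℝ S) {x g y w : Fin l → ℝ}
    (hp : IsProjection vecNorm S (x + g) y) (hw : w ∈ S) :
    2 * (g ⬝ᵥ (w - y)) ≤ vecNorm (x - w) ^ 2 - vecNorm (x - y) ^ 2 - vecNorm (w - y) ^ 2 := by
  refine IsProjection.three_point (ip := fun u v => u ⬝ᵥ v) vecNorm_nonneg (fun u v t => ?_)
    (fun u v w => add_dotProduct u v w) hS hp hw
  simp only [vecNorm_sq_eq_dotProduct, sub_dotProduct, dotProduct_sub, smul_dotProduct,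
    dotProduct_smul, smul_eq_mul, dotProduct_comm v u]
  ring

lemma IsProjection.abs_three_point {S : Set ℝ} (hS : Convex ℝ S) {x g y w : ℝ}
    (hp : IsProjection (fun b : ℝ => |b|) S (x + g) y) (hw : w ∈ S) :
    2 * (g * (w - y)) ≤ (x - w) ^ 2 - (x - y) ^ 2 - (w - y) ^ 2 := by
  have := IsProjection.three_point (ip := fun u v => u * v) abs_nonneg (fun u v t => ?_)
    (fun u v w => add_mul u v w) hS hp hw
  · simpa only [sq_abs] using this
  · simp only [sq_abs, smul_eq_mul]; ring

end LatentSpace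

namespace LatentSpace

/-! ### Orthogonal Procrustes alignment -/

section Procrustes

variable {n k : ℕ}

lemma isCompact_orthogonalGroup :
    IsCompact (Matrix.orthogonalGroup (Fin k) ℝ : Set (Matrix (Fin k) (Fin k) ℝ)) := by
  have hbox : IsCompact (Set.pi Set.univ fun _ : Fin k => Set.pi Set.univ
      fun _ : Fin k => Set.Icc (-1 : ℝ) 1) :=
    isCompact_univ_pi fun _ => isCompact_univ_pi fun _ => isCompact_Icc
  refine hbox.of_isClosed_subset ?_ fun R hR i _ j _ => ?_
  · have h : (Matrix.orthogonalGroup (Fin k) ℝ : Set (Matrix (Fin k) (Fin k) ℝ))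
        = {R | R * Rᵀ = 1} := by
      ext R
      exact Matrix.mem_orthogonalGroup_iff (Fin k) ℝ
    rw [h]
    exact isClosed_eq (by fun_prop) continuous_const
  · exact abs_le.mp (entry_norm_bound_of_unitary hR i j)

/-- Householder reflections serve as test matrices for optimality over the orthogonal group. For `v
= 0` the coefficient `2 / 0` is zero and the matrix is the identity. -/
lemma reflection_mem_orthogonalGroup (v : Fin k → ℝ) :
    (1 - (2 / (v ⬝ᵥ v)) • Matrix.vecMulVec v v) ∈ Matrix.orthogonalGroup (Fin k) ℝ := by
  rw [Matrix.mem_orthogonalGroup_iff]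
  have hT : (1 - (2 / (v ⬝ᵥ v)) • Matrix.vecMulVec v v)ᵀ
      = 1 - (2 / (v ⬝ᵥ v)) • Matrix.vecMulVec v v := by
    simp [Matrix.transpose_vecMulVec]
  have h2 : Matrix.vecMulVec v v * Matrix.vecMulVec v v = (v ⬝ᵥ v) • Matrix.vecMulVec v v := by
    rw [Matrix.vecMulVec_mul_vecMulVec]
    ext i j; simp [Matrix.vecMulVec_apply]; ring
  rw [hT, Matrix.sub_mul, Matrix.one_mul, Matrix.mul_sub, Matrix.mul_one, Matrix.smul_mul,
    Matrix.mul_smul, h2, smul_smul, smul_smul]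
  by_cases hv : v ⬝ᵥ v = 0
  · simp [hv]
  · have : 2 / (v ⬝ᵥ v) * (2 / (v ⬝ᵥ v)) * (v ⬝ᵥ v) = 2 / (v ⬝ᵥ v) + 2 / (v ⬝ᵥ v) := by
      field_simp; ring
    rw [this, add_smul]
    abel

lemma trace_vecMulVec_mul (v w : Fin k → ℝ) (H : Matrix (Fin k) (Fin k) ℝ) :
    (Matrix.vecMulVec v w * H).trace = w ⬝ᵥ (H *ᵥ v) := by
  rw [Matrix.vecMulVec_mul, Matrix.trace_vecMulVec, dotProduct_comm, ← Matrix.dotProduct_mulVec]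

/-- A matrix whose trace cannot be increased by multiplication with orthogonal matrices is symmetric
and positive semidefinite. -/
lemma posSemidef_of_trace_mul_le (H : Matrix (Fin k) (Fin k) ℝ)
    (hH : ∀ Q ∈ Matrix.orthogonalGroup (Fin k) ℝ, (Q * H).trace ≤ H.trace) : H.PosSemidef := by
  have hquad : ∀ v : Fin k → ℝ, 0 ≤ v ⬝ᵥ (H *ᵥ v) := by
    intro v
    have h := hH _ (reflection_mem_orthogonalGroup v)
    rw [Matrix.sub_mul, Matrix.one_mul, Matrix.smul_mul, Matrix.trace_sub, Matrix.trace_smul,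
      trace_vecMulVec_mul, smul_eq_mul] at h
    have hvv : 0 ≤ v ⬝ᵥ v := by rw [← vecNorm_sq_eq_dotProduct]; positivity
    rcases hvv.eq_or_lt with h0 | h0
    · have : v = 0 := by
        rw [← vecNorm_sq_eq_dotProduct] at h0
        exact vecNorm_eq_zero.mp (by nlinarith)
      simp [this]
    · by_contra! hneg
      have : 2 / (v ⬝ᵥ v) * (v ⬝ᵥ (H *ᵥ v)) < 0 := mul_neg_of_pos_of_neg (by positivity) hneg
      linarith
  have hle : ∀ i j, H i j ≤ H j i := by
    intro i j
    by_cases hij : i = j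
    · rw [hij]
    -- A single reflection only sees the symmetric part of `H`. The product of the reflections along
    -- `e_i` and `e_i + t e_j` is a rotation by an angle of order `t`; to first order in `t` its
    -- trace inequality bounds the antisymmetric part, which vanishes as `t → 0`.
    have key : ∀ t : ℝ, 0 < t → H i j - H j i ≤ t * (H i i + H j j) := by
      intro t ht
      let v : Fin k → ℝ := Pi.single i 1
      let w : Fin k → ℝ := Pi.single i 1 + t • Pi.single j 1
      have hvv : v ⬝ᵥ v = 1 := by simp [v]
      have hww : w ⬝ᵥ w = 1 + t ^ 2 := by
        simp [w, hij, Ne.symm hij]; ring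
      have hwv : w ⬝ᵥ v = 1 := by simp [v, w, hij]
      have hvHv : v ⬝ᵥ (H *ᵥ v) = H i i := by simp [v]
      have hvHw : v ⬝ᵥ (H *ᵥ w) = H i i + t * H i j := by
        simp [v, w, Matrix.mulVec_add, Matrix.mulVec_smul]
      have hwHw : w ⬝ᵥ (H *ᵥ w) = H i i + t * (H i j + H j i) + t ^ 2 * H j j := by
        simp [w, Matrix.mulVec_add, Matrix.mulVec_smul]; ring
      have h := hH _ (mul_mem (reflection_mem_orthogonalGroup w) (reflection_mem_orthogonalGroup v))
      have hexp : (1 - (2 / (w ⬝ᵥ w)) • Matrix.vecMulVec w w)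
          * (1 - (2 / (v ⬝ᵥ v)) • Matrix.vecMulVec v v) * H
          = H - (2 / (w ⬝ᵥ w)) • (Matrix.vecMulVec w w * H)
            - (2 / (v ⬝ᵥ v)) • (Matrix.vecMulVec v v * H)
            + (2 / (w ⬝ᵥ w) * (2 / (v ⬝ᵥ v)) * (w ⬝ᵥ v)) • (Matrix.vecMulVec w v * H) := by
        have : Matrix.vecMulVec w w * Matrix.vecMulVec v v = (w ⬝ᵥ v) • Matrix.vecMulVec w v := by
          rw [Matrix.vecMulVec_mul_vecMulVec]
          ext i j; simp [Matrix.vecMulVec_apply]; ring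
        simp only [Matrix.sub_mul, Matrix.mul_sub, Matrix.one_mul, Matrix.mul_one, Matrix.smul_mul,
          Matrix.mul_smul, this, smul_smul]
        module
      rw [hexp] at h
      simp only [Matrix.trace_add, Matrix.trace_sub, Matrix.trace_smul, trace_vecMulVec_mul,
        smul_eq_mul, hvv, hww, hwv, hvHv, hvHw, hwHw] at h
      have hpos : 0 < 1 + t ^ 2 := by positivity
      have h' : (1 + t ^ 2) * (-(2 / (1 + t ^ 2) * (H i i + t * (H i j + H j i) + t ^ 2 * H j j))
          - 2 / 1 * H i i + 2 / (1 + t ^ 2) * (2 / 1) * 1 * (H i i + t * H i j)) ≤ 0 :=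
        mul_nonpos_of_nonneg_of_nonpos hpos.le (by linarith)
      have h'' : (1 + t ^ 2) * (-(2 / (1 + t ^ 2) * (H i i + t * (H i j + H j i) + t ^ 2 * H j j))
          - 2 / 1 * H i i + 2 / (1 + t ^ 2) * (2 / 1) * 1 * (H i i + t * H i j))
          = 2 * t * ((H i j - H j i) - t * (H i i + H j j)) := by
        field_simp; ring
      rw [h''] at h'
      by_contra! hc
      have : 0 < 2 * t * ((H i j - H j i) - t * (H i i + H j j)) :=
        mul_pos (by positivity) (by linarith)
      linarith
    by_contra! hc
    have hd : 0 < H i j - H j i := by linarith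
    have hii : 0 ≤ H i i := by simpa using hquad (Pi.single i 1)
    have hjj : 0 ≤ H j j := by simpa using hquad (Pi.single j 1)
    have := key ((H i j - H j i) / (2 * (H i i + H j j + 1))) (by positivity)
    rw [div_mul_eq_mul_div, le_div_iff₀ (by positivity)] at this
    nlinarith
  refine Matrix.PosSemidef.of_dotProduct_mulVec_nonneg ?_ fun v => by simpa using hquad v
  ext i j
  simpa using le_antisymm (hle j i) (hle i j)

lemma frobNorm_mul_orthogonal (Z : Matrix (Fin n) (Fin k) ℝ) {R : Matrix (Fin k) (Fin k) ℝ}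
    (hR : R ∈ Matrix.orthogonalGroup (Fin k) ℝ) : frobNorm (Z * R) = frobNorm Z := by
  have hR' : R * Rᵀ = 1 := (Matrix.mem_orthogonalGroup_iff (Fin k) ℝ).mp hR
  rw [← sq_eq_sq₀ (frobNorm_nonneg _) (frobNorm_nonneg _), ← frobInner_self,
    frobInner_mul_left', Matrix.mul_assoc, hR', Matrix.mul_one, frobInner_self]

lemma procrustesDist_le (Z Y : Matrix (Fin n) (Fin k) ℝ) {R : Matrix (Fin k) (Fin k) ℝ}
    (hR : R ∈ Matrix.orthogonalGroup (Fin k) ℝ) :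
    procrustesDist Z Y ≤ frobNorm (Z - Y * R) :=
  ciInf_le ⟨0, by rintro _ ⟨v, rfl⟩; exact frobNorm_nonneg _⟩
    (⟨R, hR⟩ : Matrix.orthogonalGroup (Fin k) ℝ)

lemma procrustesDist_nonneg (Z Y : Matrix (Fin n) (Fin k) ℝ) : 0 ≤ procrustesDist Z Y :=
  Real.iInf_nonneg fun _ => frobNorm_nonneg _

/-- The Procrustes distance is attained, at a rotation which makes the cross Gram matrix
positive semidefinite. -/
lemma exists_procrustes_alignment (Z Y : Matrix (Fin n) (Fin k) ℝ) :
    ∃ R ∈ Matrix.orthogonalGroup (Fin k) ℝ,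
      procrustesDist Z Y = frobNorm (Z - Y * R) ∧ ((Y * R)ᵀ * Z).PosSemidef := by
  obtain ⟨R, hR, hmax⟩ := isCompact_orthogonalGroup.exists_isMaxOn
    (f := fun R : Matrix (Fin k) (Fin k) ℝ => ((Y * R)ᵀ * Z).trace) ⟨1, one_mem _⟩
    (by fun_prop)
  refine ⟨R, hR, le_antisymm (procrustesDist_le Z Y hR) ?_, ?_⟩
  · refine le_ciInf fun R' => ?_
    rw [← sq_le_sq₀ (frobNorm_nonneg _) (frobNorm_nonneg _), frobNorm_sub_sq, frobNorm_sub_sq,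
      frobNorm_mul_orthogonal _ hR, frobNorm_mul_orthogonal _ R'.2]
    have := hmax R'.2
    simp only [Set.mem_ofPred_eq] at this
    rw [frobInner_comm, frobInner_comm Z]
    unfold frobInner
    linarith
  -- A test matrix `Q` corresponds to the competitor `R Qᵀ` of the maximizer `R`.
  · refine posSemidef_of_trace_mul_le _ fun Q hQ => ?_
    have hQ' : star Q ∈ Matrix.orthogonalGroup (Fin k) ℝ := Unitary.star_mem hQ
    have := hmax (mul_mem hR hQ')
    simp only [Set.mem_ofPred_eq] at this
    rw [← Matrix.mul_assoc Y, Matrix.transpose_mul, star_eq_conjTranspose,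
      conjTranspose_eq_transpose_of_trivial, Matrix.transpose_transpose, Matrix.mul_assoc] at this
    exact this

/-- If `UᵀZ` is positive semidefinite then `‖Z - U‖_F` is controlled by the Gram matrices. -/
lemma frobNorm_sub_sq_le_gram (Z U : Matrix (Fin n) (Fin k) ℝ) (hH : (Uᵀ * Z).PosSemidef) {σ : ℝ}
    (hσ0 : 0 ≤ σ)
    (hσ : ∀ B : Matrix (Fin k) (Fin n) ℝ, σ * frobNorm B ≤ frobNorm (U * B)) :
    4 / 5 * σ ^ 2 * frobNorm (Z - U) ^ 2 ≤ frobNorm (Z * Zᵀ - U * Uᵀ) ^ 2 := by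
  obtain ⟨D, rfl⟩ : ∃ D, Z = U + D := ⟨Z - U, by abel⟩
  have hb : (Uᵀ * D)ᵀ = Uᵀ * D := by
    have h := hH.1
    rw [Matrix.IsHermitian, conjTranspose_eq_transpose_of_trivial, Matrix.mul_add,
      Matrix.transpose_add] at h
    have h' : (Uᵀ * U)ᵀ = Uᵀ * U := by simp
    rw [h'] at h
    exact add_left_cancel h
  have hb' : Dᵀ * U = Uᵀ * D := by rw [← hb]; simp
  set p := frobNorm (U * Dᵀ) ^ 2 with hp
  set q := frobNorm (Uᵀ * D) ^ 2 with hq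
  set r := frobNorm (Dᵀ * D) ^ 2 with hr
  set s := frobInner (Uᵀ * D) (Dᵀ * D) with hs
  have e1 : (U + D) * (U + D)ᵀ - U * Uᵀ = U * Dᵀ + D * Uᵀ + D * Dᵀ := by
    simp only [Matrix.transpose_add, Matrix.mul_add, Matrix.add_mul]
    abel
  have i1 : frobNorm (D * Uᵀ) ^ 2 = p := by
    rw [hp, ← frobNorm_transpose (D * Uᵀ)]; simp
  have i2 : frobInner (U * Dᵀ) (D * Uᵀ) = q := by
    rw [hq, ← frobInner_self, frobInner_mul_left, ← Matrix.mul_assoc, frobInner_comm,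
      frobInner_mul_left']
    simp [hb']
  have i3 : frobNorm (D * Dᵀ) ^ 2 = r := by
    rw [hr, ← frobInner_self, ← frobInner_self, frobInner_mul_left, frobInner_mul_left',
      Matrix.mul_assoc]
  have i4 : frobInner (U * Dᵀ) (D * Dᵀ) = s := by
    rw [hs, frobInner_mul_left, frobInner_comm, ← Matrix.mul_assoc, frobInner_mul_left',
      Matrix.transpose_transpose]
  have i5 : frobInner (D * Uᵀ) (D * Dᵀ) = s := by
    rw [← frobInner_transpose, ← i4]; simp
  have total : frobNorm ((U + D) * (U + D)ᵀ - U * Uᵀ) ^ 2 = 2 * p + 2 * q + r + 4 * s := by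
    rw [e1, frobNorm_add_sq, frobNorm_add_sq, frobInner_add_left, i1, i2, i3, i4, i5]
    ring
  -- Here 7/5 stands in for √2. The square leaves `2p + q/25 + 6s/5`, and positivity of the cross
  -- Gram matrix gives `s ≥ -p`, so at least `4p/5` remains. With √2 itself the constant would be
  -- 2(√2 - 1).
  have hsq : 0 ≤ r + 14 / 5 * s + 49 / 25 * q := by
    have h := sq_nonneg (frobNorm (Dᵀ * D + (7 / 5 : ℝ) • (Uᵀ * D)))
    rw [frobNorm_add_sq, frobInner_smul_right, frobNorm_smul, mul_pow, sq_abs,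
      frobInner_comm] at h
    linarith
  have hpsd : 0 ≤ s + p := by
    have h := (hH.mul_mul_conjTranspose_same D).trace_nonneg
    rw [conjTranspose_eq_transpose_of_trivial, Matrix.mul_add, Matrix.mul_add, Matrix.add_mul,
      Matrix.trace_add] at h
    have h1 : (D * (Uᵀ * U) * Dᵀ).trace = p := by
      rw [hp, ← frobInner_self, frobInner]
      simp [Matrix.mul_assoc]
    have h2 : (D * (Uᵀ * D) * Dᵀ).trace = s := by
      rw [hs, frobInner, hb, Matrix.mul_assoc, Matrix.trace_mul_comm, ← hb']
      simp [Matrix.mul_assoc]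
    linarith
  have hq0 : 0 ≤ q := sq_nonneg _
  have hlow : σ ^ 2 * frobNorm D ^ 2 ≤ p := by
    rw [hp, ← mul_pow, ← frobNorm_transpose D]
    exact pow_le_pow_left₀ (mul_nonneg hσ0 (frobNorm_nonneg _)) (hσ _) 2
  rw [total, add_sub_cancel_left]
  linarith

end Procrustes

end LatentSpace

namespace LatentSpace

/-! ### The logistic loss -/

section Logistic

/-- The logistic loss `log (1 + eᵗ)`, an antiderivative of the sigmoid function. -/
noncomputable def softplus (t : ℝ) : ℝ := Real.log (1 + Real.exp t)

lemma hasDerivAt_softplus (t : ℝ) : HasDerivAt softplus (Real.sigmoid t) t := by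
  have h : HasDerivAt (fun t => 1 + Real.exp t) (Real.exp t) t := (Real.hasDerivAt_exp t).const_add 1
  have := h.log (by positivity)
  refine this.congr_deriv ?_
  rw [Real.sigmoid_def, Real.exp_neg]
  have := Real.exp_pos t
  field_simp
  ring

/-- After subtracting the tangent at `x` and the parabola, the derivative on `s` has the sign of `t
- x`, so `x` is a minimum. The sign of `μ` is free: `μ < 0`, applied to `-softplus`, gives
smoothness, `μ = 0` convexity, and `μ > 0` strong convexity on a bounded interval. -/
lemma add_mul_sub_add_le_of_hasDerivAt {f f' : ℝ → ℝ} (hf : ∀ t, HasDerivAt f (f' t) t) {s : Set ℝ}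
    (hs : s.OrdConnected) {μ : ℝ} (hmono : ∀ a ∈ s, ∀ b ∈ s, a ≤ b → 2 * μ * (b - a) ≤ f' b - f' a)
    {x y : ℝ} (hx : x ∈ s) (hy : y ∈ s) :
    f x + f' x * (y - x) + μ * (y - x) ^ 2 ≤ f y := by
  let g : ℝ → ℝ := fun t => f t - f' x * (t - x) - μ * (t - x) ^ 2
  have hg : ∀ t, HasDerivAt g (f' t - f' x - 2 * μ * (t - x)) t := by
    intro t
    have h1 := (((hasDerivAt_id t).sub_const x).const_mul (f' x))
    have h2 := ((((hasDerivAt_id t).sub_const x).pow 2).const_mul μ)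
    have := ((hf t).sub h1).sub h2
    refine this.congr_deriv ?_
    simp only [Nat.cast_ofNat, Nat.add_one_sub_one, pow_one, mul_one, id]
    ring
  suffices h : g x ≤ g y by
    simp only [g, sub_self] at h
    nlinarith
  rcases lt_trichotomy x y with h | h | h
  · obtain ⟨c, hc, he⟩ := exists_hasDerivAt_eq_slope g _ h
      (fun t _ => (hg t).continuousAt.continuousWithinAt) (fun t _ => hg t)
    have hcs : c ∈ s := hs.out hx hy ⟨hc.1.le, hc.2.le⟩
    have := hmono x hx c hcs hc.1.le
    rw [eq_div_iff (by linarith)] at he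
    have : 0 ≤ (f' c - f' x - 2 * μ * (c - x)) * (y - x) := mul_nonneg (by linarith) (by linarith)
    linarith
  · rw [h]
  · obtain ⟨c, hc, he⟩ := exists_hasDerivAt_eq_slope g _ h
      (fun t _ => (hg t).continuousAt.continuousWithinAt) (fun t _ => hg t)
    have hcs : c ∈ s := hs.out hy hx ⟨hc.1.le, hc.2.le⟩
    have := hmono c hcs x hx hc.2.le
    rw [eq_div_iff (by linarith)] at he
    have : 0 ≤ -(f' c - f' x - 2 * μ * (c - x)) * (x - y) := mul_nonneg (by linarith) (by linarith)
    linarith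

lemma sigmoid_sub_eq (a b : ℝ) (h : a ≤ b) : ∃ c ∈ Set.Icc a b,
    Real.sigmoid b - Real.sigmoid a = Real.sigmoid c * (1 - Real.sigmoid c) * (b - a) := by
  rcases h.eq_or_lt with rfl | h
  · exact ⟨a, ⟨le_rfl, le_rfl⟩, by ring⟩
  · obtain ⟨c, hc, he⟩ := exists_hasDerivAt_eq_slope Real.sigmoid _ h
      (_root_.continuous_sigmoid.continuousOn) (fun t _ => Real.hasDerivAt_sigmoid t)
    refine ⟨c, ⟨hc.1.le, hc.2.le⟩, ?_⟩
    rw [he, div_mul_cancel₀ _ (by linarith)]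

lemma sigmoid_mul_one_sub_le (c : ℝ) : Real.sigmoid c * (1 - Real.sigmoid c) ≤ 1 / 4 := by
  nlinarith [sq_nonneg (Real.sigmoid c - 1 / 2)]

lemma sigmoid_mul_one_sub_nonneg (c : ℝ) : 0 ≤ Real.sigmoid c * (1 - Real.sigmoid c) :=
  mul_nonneg (Real.sigmoid_nonneg c) (by linarith [Real.sigmoid_le_one c])

/-- The derivative of the sigmoid is `1 / ((1 + e^c)(1 + e^{-c}))`, whose denominator is at most `2
+ 2e^M ≤ 4e^M`. This is the origin of every factor `e^{-M₁}`. -/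
lemma exp_neg_div_four_le_sigmoid_mul {c M : ℝ} (hc : |c| ≤ M) :
    Real.exp (-M) / 4 ≤ Real.sigmoid c * (1 - Real.sigmoid c) := by
  rw [← Real.sigmoid_neg, Real.sigmoid_def, Real.sigmoid_def, neg_neg, ← mul_inv, Real.exp_neg M,
    ← one_div, ← one_div, div_div]
  have h1 := Real.exp_le_exp.mpr ((le_abs_self c).trans hc)
  have h2 := Real.exp_le_exp.mpr ((neg_le_abs c).trans hc)
  have h3 : Real.exp (-c) * Real.exp c = 1 := by rw [← Real.exp_add]; simp
  have h4 : 1 ≤ Real.exp M := Real.one_le_exp ((abs_nonneg c).trans hc)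
  refine one_div_le_one_div_of_le (by positivity) ?_
  nlinarith

lemma abs_sigmoid_sub_le (a b : ℝ) : |Real.sigmoid b - Real.sigmoid a| ≤ 1 / 4 * |b - a| := by
  wlog h : a ≤ b generalizing a b
  · rw [abs_sub_comm, abs_sub_comm b]; exact this b a (le_of_not_ge h)
  obtain ⟨c, -, hc⟩ := sigmoid_sub_eq a b h
  rw [hc, abs_mul, abs_of_nonneg (sigmoid_mul_one_sub_nonneg c)]
  exact mul_le_mul_of_nonneg_right (sigmoid_mul_one_sub_le c) (abs_nonneg _)

lemma softplus_le (x y : ℝ) :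
    softplus y ≤ softplus x + Real.sigmoid x * (y - x) + 1 / 8 * (y - x) ^ 2 := by
  have := add_mul_sub_add_le_of_hasDerivAt (f := fun t => -softplus t)
    (f' := fun t => -Real.sigmoid t) (fun t => (hasDerivAt_softplus t).neg) Set.ordConnected_univ
    (μ := -(1 / 8)) (fun a _ b _ hab => ?_) (Set.mem_univ x) (Set.mem_univ y)
  · linarith
  · have := abs_sigmoid_sub_le a b
    rw [abs_of_nonneg (sub_nonneg.mpr hab)] at this
    have := (le_abs_self _).trans this
    linarith

lemma le_softplus (x y : ℝ) : softplus x + Real.sigmoid x * (y - x) ≤ softplus y := by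
  have := add_mul_sub_add_le_of_hasDerivAt hasDerivAt_softplus Set.ordConnected_univ
    (μ := 0) (fun a _ b _ hab => ?_) (Set.mem_univ x) (Set.mem_univ y)
  · linarith
  · have := Real.sigmoid_le hab
    linarith

lemma le_softplus_of_abs_le {x y M : ℝ} (hx : |x| ≤ M) (hy : |y| ≤ M) :
    softplus x + Real.sigmoid x * (y - x) + Real.exp (-M) / 8 * (y - x) ^ 2 ≤ softplus y := by
  refine add_mul_sub_add_le_of_hasDerivAt hasDerivAt_softplus (s := Set.Icc (-M) M)
    Set.ordConnected_Icc (fun a ha b hb hab => ?_) (abs_le.mp hx) (abs_le.mp hy)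
  obtain ⟨c, hc, he⟩ := sigmoid_sub_eq a b hab
  rw [he]
  have hcM : |c| ≤ M := abs_le.mpr ⟨ha.1.trans hc.1, hc.2.trans hb.2⟩
  have := exp_neg_div_four_le_sigmoid_mul hcM
  exact mul_le_mul_of_nonneg_right (by linarith) (by linarith)

variable {n : ℕ}

/-- The negative log-likelihood (over all ordered pairs) of the adjacency matrix `A`. -/
noncomputable def negLogLik (A Θ : Matrix (Fin n) (Fin n) ℝ) : ℝ :=
  ∑ i, ∑ j, (softplus (Θ i j) - A i j * Θ i j)

lemma negLogLik_le (A Θ Θ' : Matrix (Fin n) (Fin n) ℝ) :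
    negLogLik A Θ' ≤ negLogLik A Θ - frobInner (A - sigmoidMat Θ) (Θ' - Θ)
      + 1 / 8 * frobNorm (Θ' - Θ) ^ 2 := by
  rw [frobNorm_sq, frobInner_eq_sum, negLogLik, negLogLik, Finset.mul_sum, ← Finset.sum_sub_distrib,
    ← Finset.sum_add_distrib]
  refine Finset.sum_le_sum fun i _ => ?_
  rw [Finset.mul_sum, ← Finset.sum_sub_distrib, ← Finset.sum_add_distrib]
  refine Finset.sum_le_sum fun j _ => ?_
  have := softplus_le (Θ i j) (Θ' i j)
  simp only [Matrix.sub_apply, sigmoidMat, Matrix.map_apply]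
  linarith

lemma le_negLogLik (A Θ Θ' : Matrix (Fin n) (Fin n) ℝ) :
    negLogLik A Θ - frobInner (A - sigmoidMat Θ) (Θ' - Θ) ≤ negLogLik A Θ' := by
  rw [frobInner_eq_sum, negLogLik, negLogLik, ← Finset.sum_sub_distrib]
  refine Finset.sum_le_sum fun i _ => ?_
  rw [← Finset.sum_sub_distrib]
  refine Finset.sum_le_sum fun j _ => ?_
  have := le_softplus (Θ i j) (Θ' i j)
  simp only [Matrix.sub_apply, sigmoidMat, Matrix.map_apply]
  linarith

lemma le_negLogLik_of_abs_le (A Θ Θ' : Matrix (Fin n) (Fin n) ℝ) {M : ℝ}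
    (h : ∀ i j, |Θ i j| ≤ M) (h' : ∀ i j, |Θ' i j| ≤ M) :
    negLogLik A Θ - frobInner (A - sigmoidMat Θ) (Θ' - Θ)
      + Real.exp (-M) / 8 * frobNorm (Θ' - Θ) ^ 2 ≤ negLogLik A Θ' := by
  rw [frobNorm_sq, frobInner_eq_sum, negLogLik, negLogLik, Finset.mul_sum, ← Finset.sum_sub_distrib,
    ← Finset.sum_add_distrib]
  refine Finset.sum_le_sum fun i _ => ?_
  rw [Finset.mul_sum, ← Finset.sum_sub_distrib, ← Finset.sum_add_distrib]
  refine Finset.sum_le_sum fun j _ => ?_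
  have := le_softplus_of_abs_le (h i j) (h' i j)
  simp only [Matrix.sub_apply, sigmoidMat, Matrix.map_apply]
  linarith

lemma frobNorm_sigmoidMat_sub_le (Θ Θ' : Matrix (Fin n) (Fin n) ℝ) :
    frobNorm (sigmoidMat Θ' - sigmoidMat Θ) ≤ 1 / 4 * frobNorm (Θ' - Θ) := by
  rw [← sq_le_sq₀ (frobNorm_nonneg _) (mul_nonneg (by norm_num) (frobNorm_nonneg _)),
    mul_pow, frobNorm_sq, frobNorm_sq, Finset.mul_sum]
  refine Finset.sum_le_sum fun i _ => ?_
  rw [Finset.mul_sum]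
  refine Finset.sum_le_sum fun j _ => ?_
  rw [← sq_abs, ← sq_abs ((Θ' - Θ) i j), ← mul_pow]
  exact pow_le_pow_left₀ (abs_nonneg _) (abs_sigmoid_sub_le (Θ i j) (Θ' i j)) 2

end Logistic

end LatentSpace

namespace LatentSpace

/-! ### Singular values -/

section SingularValues

variable {n k : ℕ}

/-- The basis diagonalizes `ZᵀZ`, that is, it consists of right singular vectors. The extremal
properties of the first and the last singular value are read off from this expansion. -/
lemma vecNorm_mulVec_sq_eq_sum (Z : Matrix (Fin n) (Fin k) ℝ) :
    ∃ b : OrthonormalBasis (Fin k) ℝ (EuclideanSpace ℝ (Fin k)), ∀ v : Fin k → ℝ,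
      vecNorm (Z *ᵥ v) ^ 2 = ∑ i : Fin k, singVal Z i ^ 2 * inner ℝ (b i) (WithLp.toLp 2 v) ^ 2 := by
  set T := Matrix.toEuclideanLin Z with hT
  have hn : Module.finrank ℝ (EuclideanSpace ℝ (Fin k)) = k := by simp
  refine ⟨T.isSymmetric_adjoint_comp_self.eigenvectorBasis hn, fun v => ?_⟩
  set b := T.isSymmetric_adjoint_comp_self.eigenvectorBasis hn with hb
  set x : EuclideanSpace ℝ (Fin k) := WithLp.toLp 2 v with hx
  have h1 : vecNorm (Z *ᵥ v) ^ 2 = inner ℝ x ((LinearMap.adjoint T ∘ₗ T) x) := by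
    rw [LinearMap.comp_apply, LinearMap.adjoint_inner_right, real_inner_self_eq_norm_sq]
    rfl
  rw [h1, ← b.sum_inner_mul_inner]
  refine Finset.sum_congr rfl fun i _ => ?_
  have h2 : inner ℝ (b i) ((LinearMap.adjoint T ∘ₗ T) x)
      = singVal Z i ^ 2 * inner ℝ (b i) x := by
    rw [← T.isSymmetric_adjoint_comp_self, hb,
      T.isSymmetric_adjoint_comp_self.apply_eigenvectorBasis hn i, ← hb, real_inner_smul_left]
    congr 1
    exact (T.sq_singularValues_fin hn i).symm
  rw [h2, real_inner_comm]
  ring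

lemma singVal_nonneg (Z : Matrix (Fin n) (Fin k) ℝ) (i : ℕ) : 0 ≤ singVal Z i :=
  LinearMap.singularValues_nonneg _ _

lemma singVal_antitone (Z : Matrix (Fin n) (Fin k) ℝ) {i j : ℕ} (h : i ≤ j) :
    singVal Z j ≤ singVal Z i :=
  LinearMap.singularValues_antitone _ h

lemma singVal_mul_vecNorm_le (Z : Matrix (Fin n) (Fin k) ℝ) (v : Fin k → ℝ) :
    singVal Z (k - 1) * vecNorm v ≤ vecNorm (Z *ᵥ v) := by
  obtain ⟨b, hb⟩ := vecNorm_mulVec_sq_eq_sum Z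
  rw [← sq_le_sq₀ (mul_nonneg (singVal_nonneg _ _) (vecNorm_nonneg _)) (vecNorm_nonneg _), hb,
    mul_pow, vecNorm, ← b.sum_sq_norm_inner_right, Finset.mul_sum]
  refine Finset.sum_le_sum fun i _ => ?_
  rw [Real.norm_eq_abs, sq_abs]
  exact mul_le_mul_of_nonneg_right (pow_le_pow_left₀ (singVal_nonneg _ _)
    (singVal_antitone Z (by omega)) 2) (sq_nonneg _)

lemma opNorm_eq_singVal_zero (hk : 1 ≤ k) (Z : Matrix (Fin n) (Fin k) ℝ) :
    opNorm Z = singVal Z 0 := by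
  obtain ⟨b, hb⟩ := vecNorm_mulVec_sq_eq_sum Z
  apply le_antisymm
  · refine opNorm_le_of_mulVec (singVal_nonneg _ _) fun v => ?_
    rw [← sq_le_sq₀ (vecNorm_nonneg _) (mul_nonneg (singVal_nonneg _ _) (vecNorm_nonneg _)), hb,
      mul_pow, vecNorm, ← b.sum_sq_norm_inner_right, Finset.mul_sum]
    refine Finset.sum_le_sum fun i _ => ?_
    rw [Real.norm_eq_abs, sq_abs]
    exact mul_le_mul_of_nonneg_right (pow_le_pow_left₀ (singVal_nonneg _ _)
      (singVal_antitone Z (by omega)) 2) (sq_nonneg _)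
  · have h := vecNorm_mulVec_le Z (b ⟨0, hk⟩).ofLp
    have h1 : vecNorm (b ⟨0, hk⟩).ofLp = 1 := b.orthonormal.1 _
    have h2 : vecNorm (Z *ᵥ (b ⟨0, hk⟩).ofLp) ^ 2 = singVal Z 0 ^ 2 := by
      rw [hb, Finset.sum_eq_single (⟨0, hk⟩ : Fin k)]
      · simp
      · intro i _ hi
        rw [WithLp.toLp_ofLp, b.orthonormal.2 hi]; simp
      · simp
    rw [h1, mul_one] at h
    rw [sq_eq_sq₀ (vecNorm_nonneg _) (singVal_nonneg _ _)] at h2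
    rwa [h2] at h

lemma singVal_mul_frobNorm_le {m : ℕ} (Z : Matrix (Fin n) (Fin k) ℝ) (B : Matrix (Fin k) (Fin m) ℝ) :
    singVal Z (k - 1) * frobNorm B ≤ frobNorm (Z * B) := by
  rw [← sq_le_sq₀ (mul_nonneg (singVal_nonneg _ _) (frobNorm_nonneg _)) (frobNorm_nonneg _),
    mul_pow, frobNorm_sq_eq_sum_col, frobNorm_sq_eq_sum_col, Finset.mul_sum]
  refine Finset.sum_le_sum fun j _ => ?_
  rw [← mul_pow]
  exact pow_le_pow_left₀ (mul_nonneg (singVal_nonneg _ _) (vecNorm_nonneg _))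
    (singVal_mul_vecNorm_le Z fun i => B i j) 2

lemma mul_sq_singVal_le (Z : Matrix (Fin n) (Fin k) ℝ) :
    k * singVal Z (k - 1) ^ 2 ≤ frobNorm Z ^ 2 := by
  have h := singVal_mul_frobNorm_le Z (1 : Matrix (Fin k) (Fin k) ℝ)
  have h2 := pow_le_pow_left₀ (mul_nonneg (singVal_nonneg _ _) (frobNorm_nonneg _)) h 2
  rw [mul_pow, frobNorm_one_sq, Matrix.mul_one] at h2
  linarith

end SingularValues

/-! ### The leading eigenspace of a positive semidefinite matrix -/

section TopEigen

variable {n k : ℕ} {G : Matrix (Fin n) (Fin n) ℝ} {Z : Matrix (Fin n) (Fin k) ℝ}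

open scoped MatrixOrder in
-- With `G = BᵀB` the quadratic form is `‖Bv‖²`, so the hypothesis says `‖B‖ ≤ c`.
lemma opNorm_le_of_posSemidef (hG : G.PosSemidef) {c : ℝ} (hc : 0 ≤ c)
    (h : ∀ v, v ⬝ᵥ (G *ᵥ v) ≤ c ^ 2 * (v ⬝ᵥ v)) : opNorm G ≤ c ^ 2 := by
  obtain ⟨B, rfl⟩ : ∃ B : Matrix (Fin n) (Fin n) ℝ, G = Bᵀ * B := by
    obtain ⟨B, hB⟩ := (CStarAlgebra.nonneg_iff_eq_star_mul_self (a := G)).mp hG.nonneg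
    exact ⟨B, hB⟩
  have hB : opNorm B ≤ c := by
    refine opNorm_le_of_mulVec hc fun v => ?_
    rw [← sq_le_sq₀ (vecNorm_nonneg _) (mul_nonneg hc (vecNorm_nonneg _)), mul_pow,
      vecNorm_sq_eq_dotProduct, vecNorm_sq_eq_dotProduct]
    have := h v
    rwa [← Matrix.mulVec_mulVec, Matrix.dotProduct_mulVec, Matrix.vecMul_transpose] at this
  calc opNorm (Bᵀ * B) ≤ opNorm Bᵀ * opNorm B := opNorm_mul_le _ _
    _ ≤ c * c := by rw [opNorm_transpose]; exact mul_self_le_mul_self (opNorm_nonneg _) hB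
    _ = c ^ 2 := by ring

/-- The column space of `U` is invariant under the symmetric matrix `G`, so its orthogonal
complement is invariant as well and splitting `v` produces no cross terms. -/
lemma quadForm_decomposition (hG : G.PosSemidef) {U : Matrix (Fin n) (Fin k) ℝ} {d : Fin k → ℝ}
    (hGU : G * U = U * Matrix.diagonal d) (hU : Uᵀ * U = 1) (v : Fin n → ℝ) :
    v ⬝ᵥ (G *ᵥ v) = ∑ j, d j * (Uᵀ *ᵥ v) j ^ 2
        + (v - U *ᵥ (Uᵀ *ᵥ v)) ⬝ᵥ (G *ᵥ (v - U *ᵥ (Uᵀ *ᵥ v)))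
      ∧ v ⬝ᵥ v = ∑ j, (Uᵀ *ᵥ v) j ^ 2 + (v - U *ᵥ (Uᵀ *ᵥ v)) ⬝ᵥ (v - U *ᵥ (Uᵀ *ᵥ v))
      ∧ Uᵀ *ᵥ (v - U *ᵥ (Uᵀ *ᵥ v)) = 0 := by
  set w := Uᵀ *ᵥ v with hw
  set u := v - U *ᵥ w with hu
  have hUu : Uᵀ *ᵥ u = 0 := by
    rw [hu, Matrix.mulVec_sub, Matrix.mulVec_mulVec, hU, Matrix.one_mulVec, ← hw, sub_self]
  have hv : v = U *ᵥ w + u := by rw [hu]; abel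
  have hGT : Gᵀ = G := hG.1
  have hz : ∀ y : Fin k → ℝ, (U *ᵥ y) ⬝ᵥ u = 0 := fun y => by
    rw [dotProduct_comm, Matrix.dotProduct_mulVec, ← Matrix.mulVec_transpose, hUu, zero_dotProduct]
  have hGw : G *ᵥ (U *ᵥ w) = U *ᵥ (Matrix.diagonal d *ᵥ w) := by
    rw [Matrix.mulVec_mulVec, hGU, ← Matrix.mulVec_mulVec]
  have huG : u ⬝ᵥ (G *ᵥ (U *ᵥ w)) = 0 := by rw [hGw, dotProduct_comm, hz]
  have hGu : (U *ᵥ w) ⬝ᵥ (G *ᵥ u) = 0 := by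
    rw [Matrix.dotProduct_mulVec, ← Matrix.mulVec_transpose, hGT, dotProduct_comm, huG]
  have hUU : ∀ y y' : Fin k → ℝ, (U *ᵥ y) ⬝ᵥ (U *ᵥ y') = y ⬝ᵥ y' := fun y y' => by
    rw [dotProduct_comm, Matrix.dotProduct_mulVec, ← Matrix.mulVec_transpose,
      Matrix.mulVec_mulVec, hU, Matrix.one_mulVec, dotProduct_comm]
  refine ⟨?_, ?_, hUu⟩
  · conv_lhs => rw [hv]
    rw [Matrix.mulVec_add, add_dotProduct, dotProduct_add, dotProduct_add, huG, hGu, hGw, hUU]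
    simp only [add_zero, zero_add, add_left_inj, dotProduct, Matrix.mulVec_diagonal]
    exact Finset.sum_congr rfl fun j _ => by ring
  · conv_lhs => rw [hv]
    rw [add_dotProduct, dotProduct_add, dotProduct_add, hz, dotProduct_comm u, hz, hUU]
    simp only [add_zero, zero_add, dotProduct, sq]

/-- The largest eigenvalue of `G` is among the `d j`, and each of these is a squared column norm of
`Z`. This turns signal strength stated for `G⋆` into a lower bound on `‖Z⋆‖²`. -/
lemma IsTopEigenFactor.opNorm_le (hk : 1 ≤ k) (hG : G.PosSemidef) (h : IsTopEigenFactor G Z) :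
    opNorm G ≤ opNorm Z ^ 2 := by
  obtain ⟨U, d, hU, -, hGU, htop, rfl⟩ := h
  have hd : ∀ j, d j ≤ opNorm (U * Matrix.diagonal fun j => √(d j)) ^ 2 := by
    intro j
    rcases le_total (d j) 0 with hj | hj
    · exact hj.trans (sq_nonneg _)
    have h1 := vecNorm_mulVec_le (U * Matrix.diagonal fun j => √(d j)) (Pi.single j 1)
    have h2 : vecNorm (Pi.single j 1 : Fin k → ℝ) = 1 := by
      have : vecNorm (Pi.single j 1 : Fin k → ℝ) ^ 2 = 1 := by
        rw [vecNorm_sq_eq_dotProduct]; simp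
      nlinarith [vecNorm_nonneg (Pi.single j 1 : Fin k → ℝ)]
    have h3 : vecNorm ((U * Matrix.diagonal fun j => √(d j)) *ᵥ Pi.single j 1) ^ 2 = d j := by
      have hUj := congrFun (congrFun hU j) j
      rw [Matrix.mul_apply, Matrix.one_apply_eq] at hUj
      simp only [Matrix.transpose_apply, ← sq] at hUj
      rw [vecNorm_sq]
      simp only [Matrix.mulVec_single_one, Matrix.col_apply, Matrix.mul_diagonal, mul_pow,
        Real.sq_sqrt hj, ← Finset.sum_mul, hUj, one_mul]
    rw [h2, mul_one] at h1
    rw [← h3]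
    exact pow_le_pow_left₀ (vecNorm_nonneg _) h1 2
  refine opNorm_le_of_posSemidef hG (opNorm_nonneg _) fun v => ?_
  obtain ⟨h1, h2, h3⟩ := quadForm_decomposition hG hGU hU v
  rw [h1, h2, mul_add, Finset.mul_sum]
  refine add_le_add (Finset.sum_le_sum fun j _ => mul_le_mul_of_nonneg_right (hd j) (sq_nonneg _)) ?_
  refine (htop _ h3 ⟨0, hk⟩).trans (mul_le_mul_of_nonneg_right (hd _) ?_)
  rw [← vecNorm_sq_eq_dotProduct]
  exact sq_nonneg _

lemma vecNorm_row_sq (Z : Matrix (Fin n) (Fin k) ℝ) (i : Fin n) :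
    vecNorm (Z i) ^ 2 = (Z * Zᵀ) i i := by
  rw [vecNorm_sq]
  simp [Matrix.mul_apply, sq]

lemma IsTopEigenFactor.diag_nonneg (hG : G.PosSemidef) {U : Matrix (Fin n) (Fin k) ℝ}
    {d : Fin k → ℝ} (hGU : G * U = U * Matrix.diagonal d) (hU : Uᵀ * U = 1) (j : Fin k) :
    0 ≤ d j := by
  have h := hG.dotProduct_mulVec_nonneg (U *ᵥ Pi.single j 1)
  rw [star_trivial, Matrix.mulVec_mulVec, hGU, ← Matrix.mulVec_mulVec, dotProduct_comm,
    Matrix.dotProduct_mulVec, ← Matrix.mulVec_transpose, Matrix.mulVec_mulVec, hU] at h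
  simpa using h

lemma IsTopEigenFactor.vecNorm_row_sq_le (hG : G.PosSemidef) (h : IsTopEigenFactor G Z)
    (i : Fin n) : vecNorm (Z i) ^ 2 ≤ G i i := by
  obtain ⟨U, d, hU, -, hGU, -, rfl⟩ := h
  have hd := IsTopEigenFactor.diag_nonneg hG hGU hU
  obtain ⟨h1, -, -⟩ := quadForm_decomposition hG hGU hU (Pi.single i 1)
  have h2 := hG.dotProduct_mulVec_nonneg (Pi.single i 1 - U *ᵥ (Uᵀ *ᵥ Pi.single i 1))
  rw [star_trivial] at h2
  have h3 : (Pi.single i 1 : Fin n → ℝ) ⬝ᵥ (G *ᵥ Pi.single i 1) = G i i := by simp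
  rw [h3] at h1
  rw [h1, vecNorm_sq]
  refine le_add_of_le_of_nonneg (le_of_eq (Finset.sum_congr rfl fun j _ => ?_)) h2
  simp only [Matrix.mul_diagonal, mul_pow, Real.sq_sqrt (hd j), Matrix.mulVec_single_one,
    Matrix.col_apply, Matrix.transpose_apply]
  ring

lemma IsTopEigenFactor.centered (hG : G.PosSemidef) (hJ : centering n * G = G)
    (h : IsTopEigenFactor G Z) : centering n * Z = Z := by
  obtain ⟨U, d, hU, -, hGU, -, rfl⟩ := h
  have hd := IsTopEigenFactor.diag_nonneg hG hGU hU
  -- The columns of `Z` lie in the range of `G`, where the centering acts trivially. At an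
  -- eigenvalue zero both sides vanish, because the inverse of zero is zero.
  have hZ : U * Matrix.diagonal (fun j => √(d j))
      = G * (U * Matrix.diagonal fun j => (√(d j))⁻¹) := by
    rw [← Matrix.mul_assoc, hGU, Matrix.mul_assoc, Matrix.diagonal_mul_diagonal]
    congr 2
    ext j
    rw [← div_eq_mul_inv, Real.div_sqrt]
  rw [hZ, ← Matrix.mul_assoc, hJ]

end TopEigen

end LatentSpace

namespace LatentSpace

/-! ### Feasible states -/

section Feasible

variable {n k : ℕ} {X : Matrix (Fin n) (Fin n) ℝ} {M₁ M₂ : ℝ}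

/-- All blocks of the state satisfy the constraints of the projection steps. -/
structure Iterate.Feasible (M₁ : ℝ) (X : Matrix (Fin n) (Fin n) ℝ) (x : Iterate n k) : Prop where
  memZ : x.Z ∈ constraintZ M₁ X k
  memAlpha : x.α ∈ constraintAlpha M₁ X
  memBeta : x.β ∈ constraintBeta M₁ X

lemma radius_nonneg (hM : 0 ≤ M₁) (X : Matrix (Fin n) (Fin n) ℝ) : 0 ≤ radius M₁ X := by
  unfold radius; split_ifs <;> positivity

lemma radius_le (hM : 0 ≤ M₁) (X : Matrix (Fin n) (Fin n) ℝ) : radius M₁ X ≤ M₁ / 3 := by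
  unfold radius; split_ifs <;> linarith

lemma abs_theta_le_of {α : Fin n → ℝ} {β : ℝ} {G : Matrix (Fin n) (Fin n) ℝ} {i j : Fin n}
    (hi : |α i| ≤ radius M₁ X) (hj : |α j| ≤ radius M₁ X) (hb : |β| * |X i j| ≤ radius M₁ X)
    (hG : |G i j| ≤ radius M₁ X) : |theta X α β G i j| ≤ M₁ := by
  rw [← abs_mul] at hb
  change |α i + α j + β * X i j + G i j| ≤ M₁
  by_cases hX : X = 0
  · have hr' : radius M₁ X = M₁ / 3 := by simp [radius, hX]
    rw [hr'] at hi hj hG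
    have h0 : β * X i j = 0 := by simp [hX]
    rw [h0, add_zero]
    calc |α i + α j + G i j| ≤ |α i| + |α j| + |G i j| := abs_add_three _ _ _
      _ ≤ M₁ := by linarith
  · have hr' : radius M₁ X = M₁ / 4 := by simp [radius, hX]
    rw [hr'] at hi hj hG hb
    calc |α i + α j + β * X i j + G i j|
        ≤ |α i + α j + β * X i j| + |G i j| := abs_add_le _ _
      _ ≤ |α i| + |α j| + |β * X i j| + |G i j| := by
          gcongr; exact abs_add_three _ _ _
      _ ≤ M₁ := by linarith

lemma Iterate.Feasible.abs_theta_le {x : Iterate n k} (hx : x.Feasible M₁ X) (i j : Fin n) :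
    |x.theta X i j| ≤ M₁ := by
  refine abs_theta_le_of (hx.memAlpha i) (hx.memAlpha j) (hx.memBeta i j) ?_
  have h1 : (x.Z * x.Zᵀ) i j = x.Z i ⬝ᵥ x.Z j := by
    simp [Matrix.mul_apply, dotProduct]
  rw [h1]
  have h2 := abs_dotProduct_le (x.Z i) (x.Z j)
  have hi := hx.memZ.2 i
  have hj := hx.memZ.2 j
  nlinarith [sq_nonneg (vecNorm (x.Z i) - vecNorm (x.Z j))]

lemma convex_constraintZ : Convex ℝ (constraintZ M₁ X k) := by
  intro Z hZ Y hY a b ha hb hab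
  refine ⟨?_, fun i => ?_⟩
  · rw [Matrix.mul_add, Matrix.mul_smul, Matrix.mul_smul, hZ.1, hY.1]
  · have h1 := hZ.2 i
    have h2 := hY.2 i
    have hr : 0 ≤ radius M₁ X := (sq_nonneg _).trans h1
    have e1 : vecNorm (Z i) ≤ √(radius M₁ X) := Real.le_sqrt_of_sq_le h1
    have e2 : vecNorm (Y i) ≤ √(radius M₁ X) := Real.le_sqrt_of_sq_le h2
    have h3 : vecNorm ((a • Z + b • Y) i) ≤ a * vecNorm (Z i) + b * vecNorm (Y i) := by
      have : WithLp.toLp 2 ((a • Z + b • Y) i) = a • WithLp.toLp 2 (Z i) + b • WithLp.toLp 2 (Y i) :=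
        rfl
      unfold vecNorm
      rw [this]
      refine (norm_add_le _ _).trans ?_
      rw [norm_smul, norm_smul, Real.norm_of_nonneg ha, Real.norm_of_nonneg hb]
    have h4 : vecNorm ((a • Z + b • Y) i) ≤ √(radius M₁ X) := by
      refine h3.trans ?_
      calc a * vecNorm (Z i) + b * vecNorm (Y i)
          ≤ a * √(radius M₁ X) + b * √(radius M₁ X) := by gcongr
        _ = √(radius M₁ X) := by rw [← add_mul, hab, one_mul]
    calc vecNorm ((a • Z + b • Y) i) ^ 2 ≤ √(radius M₁ X) ^ 2 :=
          pow_le_pow_left₀ (vecNorm_nonneg _) h4 2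
      _ = radius M₁ X := Real.sq_sqrt hr

lemma convex_constraintAlpha : Convex ℝ (constraintAlpha M₁ X) := by
  intro u hu v hv a b ha hb hab i
  calc |(a • u + b • v) i| ≤ |a * u i| + |b * v i| := abs_add_le _ _
    _ = a * |u i| + b * |v i| := by rw [abs_mul, abs_mul, abs_of_nonneg ha, abs_of_nonneg hb]
    _ ≤ a * radius M₁ X + b * radius M₁ X := by gcongr; exacts [hu i, hv i]
    _ = radius M₁ X := by rw [← add_mul, hab, one_mul]

lemma convex_constraintBeta : Convex ℝ (constraintBeta M₁ X) := by
  intro u hu v hv a b ha hb hab i j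
  calc |a • u + b • v| * |X i j| ≤ (|a * u| + |b * v|) * |X i j| := by
        gcongr; exact abs_add_le _ _
    _ = a * (|u| * |X i j|) + b * (|v| * |X i j|) := by
        rw [abs_mul, abs_mul, abs_of_nonneg ha, abs_of_nonneg hb]; ring
    _ ≤ a * radius M₁ X + b * radius M₁ X := by gcongr; exacts [hu i j, hv i j]
    _ = radius M₁ X := by rw [← add_mul, hab, one_mul]

/-- Feasibility starts at time 1, since the initial state need not satisfy the constraints. For this
reason the strong convexity bound is used at the new state of a step, never at the old one. -/
lemma IsPGD.feasible (hM : 0 ≤ M₁) {η : ℝ} {A : Matrix (Fin n) (Fin n) ℝ} {s : ℕ → Iterate n k}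
    (h : IsPGD M₁ η A X s) (t : ℕ) : (s (t + 1)).Feasible M₁ X := by
  refine ⟨(h.stepZ t).1, (h.stepAlpha t).1, ?_⟩
  by_cases hX : X = 0
  · intro i j
    simp only [hX, Matrix.zero_apply, abs_zero, mul_zero]
    exact radius_nonneg hM _
  · exact (h.stepBeta hX t).1

lemma gram_mul_orthogonal (Z : Matrix (Fin n) (Fin k) ℝ) {R : Matrix (Fin k) (Fin k) ℝ}
    (hR : R ∈ Matrix.orthogonalGroup (Fin k) ℝ) : Z * R * (Z * R)ᵀ = Z * Zᵀ := by
  have hR' : R * Rᵀ = 1 := (Matrix.mem_orthogonalGroup_iff (Fin k) ℝ).mp hR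
  rw [Matrix.transpose_mul, Matrix.mul_assoc, ← Matrix.mul_assoc R, hR', Matrix.one_mul]

/-- Every rotation of the truth lies in the constraint sets, so it is an admissible reference point
in the three-point inequalities. -/
lemma InClass.feasible {αs : Fin n → ℝ} {βs : ℝ} {Gs : Matrix (Fin n) (Fin n) ℝ}
    {Zs : Matrix (Fin n) (Fin k) ℝ} (hM : 0 ≤ M₁) (hX : IsCovariate X)
    (h : InClass M₁ M₂ X αs βs Gs) (hZ : IsTopEigenFactor Gs Zs) {R : Matrix (Fin k) (Fin k) ℝ}
    (hR : R ∈ Matrix.orthogonalGroup (Fin k) ℝ) :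
    (Iterate.mk (Zs * R) αs βs).Feasible M₁ X := by
  refine ⟨⟨?_, fun i => ?_⟩, h.alpha_le, fun i j => ?_⟩
  · rw [← Matrix.mul_assoc, hZ.centered h.posSemidef h.centered]
  · rw [vecNorm_row_sq, gram_mul_orthogonal Zs hR, ← vecNorm_row_sq]
    exact (hZ.vecNorm_row_sq_le h.posSemidef i).trans (h.diag_le i)
  · rcases lt_trichotomy i j with hij | rfl | hij
    · exact h.beta_le i j hij
    · simp only [hX.2, abs_zero, mul_zero]
      exact radius_nonneg hM _
    · have := h.beta_le j i hij
      rwa [← hX.1.apply] at this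

lemma centering_mul_eq_iff_sum (Z : Matrix (Fin n) (Fin k) ℝ) (hn : n ≠ 0)
    (h : centering n * Z = Z) (a : Fin k) : ∑ i, Z i a = 0 := by
  have h1 := congrFun (congrFun h ⟨0, Nat.pos_of_ne_zero hn⟩) a
  rw [centering, Matrix.sub_mul, Matrix.one_mul, Matrix.sub_apply, Matrix.smul_mul,
    Matrix.smul_apply, Matrix.mul_apply] at h1
  simp only [Matrix.of_apply, one_mul, smul_eq_mul, sub_eq_self, mul_eq_zero, one_div,
    inv_eq_zero, Nat.cast_eq_zero] at h1
  exact h1.resolve_left hn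

end Feasible

/-! ### Geometry of the parameter space -/

section Geometry

variable {n k : ℕ}

/-- The error `‖Z Zᵀ - Z⋆ Z⋆ᵀ‖_F` of the latent Gram matrix. -/
noncomputable def gramErr (Zs : Matrix (Fin n) (Fin k) ℝ) (x : Iterate n k) : ℝ :=
  frobNorm (x.Z * x.Zᵀ - Zs * Zsᵀ)

/-- The error `‖(α - α⋆) 1ᵀ‖_F`. -/
noncomputable def alphaErr (αs : Fin n → ℝ) (x : Iterate n k) : ℝ :=
  frobNorm (Matrix.vecMulVec (x.α - αs) (fun _ : Fin n => (1 : ℝ)))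

/-- The error `‖(β - β⋆) X‖_F`. -/
noncomputable def betaErr (X : Matrix (Fin n) (Fin n) ℝ) (βs : ℝ) (x : Iterate n k) : ℝ :=
  frobNorm ((x.β - βs) • X)

/-- The error `‖Θ - (α⋆ 1ᵀ + 1 α⋆ᵀ + β⋆ X + Z⋆ Z⋆ᵀ)‖_F`. -/
noncomputable def thetaErr (X : Matrix (Fin n) (Fin n) ℝ) (Zs : Matrix (Fin n) (Fin k) ℝ)
    (αs : Fin n → ℝ) (βs : ℝ) (x : Iterate n k) : ℝ :=
  frobNorm (x.theta X - theta X αs βs (Zs * Zsᵀ))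

lemma gramErr_nonneg (Zs : Matrix (Fin n) (Fin k) ℝ) (x : Iterate n k) : 0 ≤ gramErr Zs x :=
  frobNorm_nonneg _

lemma thetaErr_nonneg (X : Matrix (Fin n) (Fin n) ℝ) (Zs : Matrix (Fin n) (Fin k) ℝ)
    (αs : Fin n → ℝ) (βs : ℝ) (x : Iterate n k) : 0 ≤ thetaErr X Zs αs βs x :=
  frobNorm_nonneg _

lemma frobNorm_vecMulVec_one_sq (v : Fin n → ℝ) :
    frobNorm (Matrix.vecMulVec v (fun _ : Fin n => (1 : ℝ))) ^ 2 = n * vecNorm v ^ 2 := by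
  rw [frobNorm_sq, vecNorm_sq, Finset.mul_sum]
  simp [Matrix.vecMulVec_apply]

lemma theta_sub_theta (X : Matrix (Fin n) (Fin n) ℝ) (α α' : Fin n → ℝ) (β β' : ℝ)
    (G G' : Matrix (Fin n) (Fin n) ℝ) :
    theta X α β G - theta X α' β' G' = (G - G')
      + (Matrix.vecMulVec (α - α') (fun _ => (1 : ℝ))
        + (Matrix.vecMulVec (α - α') (fun _ => (1 : ℝ)))ᵀ) + (β - β') • X := by
  ext i j
  simp [theta, Matrix.vecMulVec_apply]
  ring

lemma abs_frobInner_vecMulVec_le (W : Matrix (Fin n) (Fin n) ℝ) (u v : Fin n → ℝ) :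
    |frobInner W (Matrix.vecMulVec u v)| ≤ opNorm W * frobNorm (Matrix.vecMulVec u v) := by
  refine (abs_frobInner_le_opNorm_mul_sqrt_rank _ _).trans ?_
  have h : √((Matrix.vecMulVec u v).rank : ℝ) ≤ 1 := by
    rw [Real.sqrt_le_one]
    exact_mod_cast Matrix.rank_vecMulVec_le u v
  have := mul_le_mul_of_nonneg_left h (opNorm_nonneg W)
  rw [mul_one] at this
  exact mul_le_mul_of_nonneg_right this (frobNorm_nonneg _)

lemma frobInner_vecMulVec_transpose {W : Matrix (Fin n) (Fin n) ℝ} (hW : W.IsSymm)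
    (u v : Fin n → ℝ) :
    frobInner W (Matrix.vecMulVec u v)ᵀ = frobInner W (Matrix.vecMulVec u v) := by
  conv_lhs => rw [← hW]
  exact frobInner_transpose _ _

variable {X : Matrix (Fin n) (Fin n) ℝ} {Zs : Matrix (Fin n) (Fin k) ℝ} {αs : Fin n → ℝ} {βs : ℝ}
  {x : Iterate n k}

/-- Near orthogonality of the three components of `Θ`. -/
lemma sum_sq_le_thetaErr_sq (hk : 1 ≤ k) (hX : X.IsSymm)
    (hstab : 128 * k * opNorm X ^ 2 ≤ frobNorm X ^ 2) (hZ : ∀ a, ∑ i, x.Z i a = 0)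
    (hZs : ∀ a, ∑ i, Zs i a = 0) :
    1 / 2 * (gramErr Zs x ^ 2 + 2 * alphaErr αs x ^ 2 + betaErr X βs x ^ 2)
      ≤ thetaErr X Zs αs βs x ^ 2 := by
  set D := x.Z * x.Zᵀ - Zs * Zsᵀ with hD
  set V := Matrix.vecMulVec (x.α - αs) (fun _ : Fin n => (1 : ℝ)) with hV
  set B := (x.β - βs) • X with hB
  have hDs : D.IsSymm := by
    simp [hD, Matrix.IsSymm, Matrix.transpose_sub]
  have hBs : B.IsSymm := hX.smul _
  have hD1 : ∀ i, ∑ j, D i j = 0 := by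
    intro i
    simp only [hD, Matrix.sub_apply, Matrix.mul_apply, Matrix.transpose_apply,
      Finset.sum_sub_distrib]
    rw [Finset.sum_comm, Finset.sum_comm (f := fun j a => Zs i a * Zs j a)]
    simp only [← Finset.mul_sum, hZ, hZs, mul_zero, Finset.sum_const_zero, sub_zero]
  have hDV : frobInner D V = 0 := by
    rw [frobInner_eq_sum]
    simp only [hV, Matrix.vecMulVec_apply, mul_one, ← Finset.sum_mul, hD1, zero_mul,
      Finset.sum_const_zero]
  have hDV' : frobInner D Vᵀ = 0 := by rw [hV, frobInner_vecMulVec_transpose hDs, ← hV, hDV]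
  have hBV' : frobInner B Vᵀ = frobInner B V := frobInner_vecMulVec_transpose hBs _ _
  -- The two copies of the degree part are not orthogonal, but their inner product is a square. The
  -- Gram part is orthogonal to both, because its rows sum to zero.
  have hVV : 0 ≤ frobInner V Vᵀ := by
    have : frobInner V Vᵀ = (∑ i, (x.α - αs) i) ^ 2 := by
      rw [frobInner_eq_sum, sq, Finset.sum_mul_sum]
      simp [hV, Matrix.vecMulVec_apply]
    rw [this]; exact sq_nonneg _
  have hk' : (1 : ℝ) ≤ k := by exact_mod_cast hk
  have hop0 := opNorm_nonneg X
  have hF0 := frobNorm_nonneg X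
  -- The stable rank assumption makes `X` nearly orthogonal to all matrices of rank at most `2k`.
  -- The 128 is `2 · 8²`, and it exceeds `11²` for the rank one part.
  have hop2 : opNorm X * √(2 * k) ≤ frobNorm X / 8 := by
    rw [← sq_le_sq₀ (by positivity) (by positivity), mul_pow, Real.sq_sqrt (by positivity)]
    nlinarith
  have hop1 : opNorm X ≤ frobNorm X / 11 := by
    rw [← sq_le_sq₀ hop0 (by positivity)]
    nlinarith [sq_nonneg (opNorm X)]
  have hgB : frobNorm B = |x.β - βs| * frobNorm X := frobNorm_smul _ _
  have hDB : |frobInner D B| ≤ frobNorm D * frobNorm B / 8 := by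
    rw [hB, frobInner_smul_right, frobInner_comm, abs_mul, ← hB, hgB]
    have h := abs_frobInner_gram_sub_gram_le X x.Z Zs
    have h2 : |frobInner X D| ≤ frobNorm X / 8 * frobNorm D :=
      h.trans (mul_le_mul_of_nonneg_right hop2 (frobNorm_nonneg _))
    have := mul_le_mul_of_nonneg_left h2 (abs_nonneg (x.β - βs))
    linarith
  have hVB : |frobInner B V| ≤ frobNorm V * frobNorm B / 11 := by
    rw [hB, frobInner_smul_left, abs_mul, ← hB, hgB]
    have h := abs_frobInner_vecMulVec_le X (x.α - αs) (fun _ : Fin n => (1 : ℝ))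
    have h2 : |frobInner X V| ≤ frobNorm X / 11 * frobNorm V :=
      h.trans (mul_le_mul_of_nonneg_right hop1 (frobNorm_nonneg _))
    have := mul_le_mul_of_nonneg_left h2 (abs_nonneg (x.β - βs))
    linarith
  have htot : thetaErr X Zs αs βs x ^ 2 = frobNorm D ^ 2 + 2 * frobNorm V ^ 2 + frobNorm B ^ 2
      + 2 * frobInner V Vᵀ + 2 * frobInner D B + 4 * frobInner B V := by
    unfold thetaErr Iterate.theta
    rw [theta_sub_theta, ← hD, ← hV, ← hB, frobNorm_add_sq, frobNorm_add_sq, frobNorm_add_sq,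
      frobInner_add_left, frobInner_add_right, frobInner_comm (V + Vᵀ) B, frobInner_add_right,
      hDV, hDV', hBV', frobNorm_transpose]
    ring
  rw [htot]
  have e1 : gramErr Zs x = frobNorm D := rfl
  have e2 : alphaErr αs x = frobNorm V := rfl
  have e3 : betaErr X βs x = frobNorm B := rfl
  rw [e1, e2, e3]
  have a1 := (abs_le.mp hDB).1
  have a2 := (abs_le.mp hVB).1
  nlinarith [sq_nonneg (frobNorm D - frobNorm B), sq_nonneg (frobNorm V - frobNorm B),
    sq_nonneg (frobNorm V), sq_nonneg (frobNorm B), sq_nonneg (frobNorm D)]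

end Geometry

/-! ### Noise -/

section Noise

variable {n k : ℕ}

/-- `ϖ` bounds the noise `A - P` in the directions that matter. -/
structure IsNoiseBound (k : ℕ) (A P X : Matrix (Fin n) (Fin n) ℝ) (ϖ : ℝ) : Prop where
  one_le : 1 ≤ ϖ
  opNorm_le : 2 * opNorm (A - P) ≤ ϖ
  inner_le : |frobInner (A - P) X| ≤ √k * ϖ * frobNorm X

lemma IsNoiseBound.of_zeta_le (hk : 1 ≤ k) {A P X : Matrix (Fin n) (Fin n) ℝ} {ϖ : ℝ}
    (h : zeta k A P X ≤ ϖ) : IsNoiseBound k A P X ϖ := by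
  obtain ⟨h1, h3⟩ := max_le_iff.mp h
  obtain ⟨h1, h2⟩ := max_le_iff.mp h1
  refine ⟨h3, h1, ?_⟩
  have hk' : 0 < √(k : ℝ) := Real.sqrt_pos.mpr (by exact_mod_cast hk)
  rw [div_le_iff₀ hk', frobInner_smul_right, abs_mul] at h2
  rcases (frobNorm_nonneg X).eq_or_lt with h0 | h0
  · have : X = 0 := frobNorm_eq_zero.mp h0.symm
    rw [this, ← zero_smul ℝ (0 : Matrix (Fin n) (Fin n) ℝ), frobInner_smul_right]
    simp [frobNorm_zero]
  · rw [abs_of_pos (inv_pos.mpr h0), inv_mul_le_iff₀ h0] at h2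
    linarith

variable {A P X : Matrix (Fin n) (Fin n) ℝ} {ϖ : ℝ}
  {Zs : Matrix (Fin n) (Fin k) ℝ} {αs : Fin n → ℝ} {βs : ℝ} {x : Iterate n k}

/-- Duality is applied to each component: the Gram part has rank at most `2k`, the degree part is
two transposed matrices of rank one, and the covariate direction has its own bound. Thus the noise
costs `√k ϖ` and not its Frobenius norm. -/
lemma IsNoiseBound.abs_inner_theta_le (h : IsNoiseBound k A P X ϖ) (hk : 1 ≤ k)
    (hW : (A - P).IsSymm) :
    |frobInner (A - P) (x.theta X - theta X αs βs (Zs * Zsᵀ))|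
      ≤ √k * ϖ * (gramErr Zs x + alphaErr αs x + betaErr X βs x) := by
  have hk' : (1 : ℝ) ≤ k := by exact_mod_cast hk
  have hs1 : 1 ≤ √(k : ℝ) := Real.one_le_sqrt.mpr hk'
  have hϖ : 0 ≤ ϖ := zero_le_one.trans h.one_le
  unfold Iterate.theta
  rw [theta_sub_theta, frobInner_add_right, frobInner_add_right, frobInner_add_right,
    frobInner_vecMulVec_transpose hW, frobInner_smul_right]
  have h1 : |frobInner (A - P) (x.Z * x.Zᵀ - Zs * Zsᵀ)| ≤ √k * ϖ * gramErr Zs x := by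
    refine (abs_frobInner_gram_sub_gram_le _ _ _).trans ?_
    refine mul_le_mul_of_nonneg_right ?_ (frobNorm_nonneg _)
    have h2 : √(2 * (k : ℝ)) ≤ 2 * √k := by
      rw [Real.sqrt_mul (by norm_num)]
      refine mul_le_mul_of_nonneg_right ?_ (Real.sqrt_nonneg _)
      rw [Real.sqrt_le_left (by norm_num)]; norm_num
    have := mul_le_mul h.opNorm_le h2 (Real.sqrt_nonneg _) hϖ
    linarith
  have h2 : |frobInner (A - P) (Matrix.vecMulVec (x.α - αs) fun _ => (1 : ℝ))|
      ≤ ϖ / 2 * alphaErr αs x := by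
    refine (abs_frobInner_vecMulVec_le _ _ _).trans ?_
    exact mul_le_mul_of_nonneg_right (by linarith [h.opNorm_le]) (frobNorm_nonneg _)
  have h3 : |(x.β - βs) * frobInner (A - P) X| ≤ √k * ϖ * betaErr X βs x := by
    rw [abs_mul, betaErr, frobNorm_smul]
    have := mul_le_mul_of_nonneg_left h.inner_le (abs_nonneg (x.β - βs))
    linarith
  have h4 : ϖ * alphaErr αs x ≤ √k * ϖ * alphaErr αs x := by
    have : 0 ≤ ϖ * alphaErr αs x := mul_nonneg hϖ (frobNorm_nonneg _)
    nlinarith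
  rw [abs_le] at *
  constructor <;> linarith [h1.1, h1.2, h2.1, h2.2, h3.1, h3.2]

end Noise

end LatentSpace

namespace LatentSpace

/-! ### One step of projected gradient descent -/

section Step

variable {n k : ℕ}

/-- The squared distance of two states in the geometry of the algorithm, with weight `z²` for the
latent positions. -/
noncomputable def stateDist (z : ℝ) (X : Matrix (Fin n) (Fin n) ℝ) (x y : Iterate n k) : ℝ :=
  z ^ 2 * frobNorm (x.Z - y.Z) ^ 2
    + 2 * frobNorm (Matrix.vecMulVec (x.α - y.α) (fun _ : Fin n => (1 : ℝ))) ^ 2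
    + 2 * frobNorm ((x.β - y.β) • X) ^ 2

lemma stateDist_nonneg (z : ℝ) (X : Matrix (Fin n) (Fin n) ℝ) (x y : Iterate n k) :
    0 ≤ stateDist z X x y := by
  unfold stateDist; positivity

/-- An exact second order expansion. The first term is what the gradient step in `Z` sees; the
second is the only failure of convexity in the whole problem. -/
lemma frobInner_gram_sub_gram {W : Matrix (Fin n) (Fin n) ℝ} (hW : W.IsSymm)
    (Z Y : Matrix (Fin n) (Fin k) ℝ) :
    frobInner W (Z * Zᵀ - Y * Yᵀ)
      = 2 * frobInner (W * Y) (Z - Y) + frobInner W ((Z - Y) * (Z - Y)ᵀ) := by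
  obtain ⟨D, rfl⟩ : ∃ D, Z = Y + D := ⟨Z - Y, by abel⟩
  have e : (Y + D) * (Y + D)ᵀ - Y * Yᵀ = D * Yᵀ + (D * Yᵀ)ᵀ + D * Dᵀ := by
    simp only [Matrix.transpose_add, Matrix.mul_add, Matrix.add_mul, Matrix.transpose_mul,
      Matrix.transpose_transpose]
    abel
  have e2 : frobInner W (D * Yᵀ)ᵀ = frobInner W (D * Yᵀ) := by
    conv_lhs => rw [← hW]
    exact frobInner_transpose _ _
  have e3 : frobInner W (D * Yᵀ) = frobInner (W * Y) D := by rw [frobInner_mul_left']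
  rw [e, frobInner_add_right, frobInner_add_right, e2, e3, add_sub_cancel_left]
  ring

lemma frobInner_theta_sub_theta {W : Matrix (Fin n) (Fin n) ℝ} (hW : W.IsSymm)
    (X : Matrix (Fin n) (Fin n) ℝ) (x y : Iterate n k) :
    frobInner W (x.theta X - y.theta X)
      = 2 * frobInner (W * y.Z) (x.Z - y.Z) + frobInner W ((x.Z - y.Z) * (x.Z - y.Z)ᵀ)
        + 2 * frobInner W (Matrix.vecMulVec (x.α - y.α) (fun _ : Fin n => (1 : ℝ)))
        + (x.β - y.β) * frobInner W X := by
  unfold Iterate.theta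
  rw [theta_sub_theta, frobInner_add_right, frobInner_add_right, frobInner_add_right,
    frobInner_vecMulVec_transpose hW, frobInner_smul_right, frobInner_gram_sub_gram hW]
  ring

lemma frobNorm_gram_sub_gram_le (Z Y : Matrix (Fin n) (Fin k) ℝ) :
    frobNorm (Z * Zᵀ - Y * Yᵀ) ≤ (opNorm Z + opNorm Y) * frobNorm (Z - Y) := by
  have e : Z * Zᵀ - Y * Yᵀ = Z * (Z - Y)ᵀ + (Z - Y) * Yᵀ := by
    simp only [Matrix.transpose_sub, Matrix.mul_sub, Matrix.sub_mul]
    abel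
  rw [e, add_mul]
  refine (frobNorm_add_le _ _).trans (add_le_add ?_ ?_)
  · refine (frobNorm_mul_le_opNorm_mul _ _).trans ?_
    rw [frobNorm_transpose]
  · refine (frobNorm_mul_le_mul_opNorm _ _).trans ?_
    rw [opNorm_transpose, mul_comm]

lemma frobNorm_theta_sub_theta_sq_le (X : Matrix (Fin n) (Fin n) ℝ) (x y : Iterate n k) :
    frobNorm (x.theta X - y.theta X) ^ 2
      ≤ 3 * ((opNorm x.Z + opNorm y.Z) ^ 2 * frobNorm (x.Z - y.Z) ^ 2
        + 4 * frobNorm (Matrix.vecMulVec (x.α - y.α) (fun _ : Fin n => (1 : ℝ))) ^ 2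
        + frobNorm ((x.β - y.β) • X) ^ 2) := by
  have h1 := frobNorm_gram_sub_gram_le x.Z y.Z
  have h2 : frobNorm (x.theta X - y.theta X)
      ≤ frobNorm (x.Z * x.Zᵀ - y.Z * y.Zᵀ)
        + 2 * frobNorm (Matrix.vecMulVec (x.α - y.α) (fun _ : Fin n => (1 : ℝ)))
        + frobNorm ((x.β - y.β) • X) := by
    unfold Iterate.theta
    rw [theta_sub_theta]
    refine (frobNorm_add_le _ _).trans (add_le_add ((frobNorm_add_le _ _).trans
      (add_le_add le_rfl ((frobNorm_add_le _ _).trans ?_))) le_rfl)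
    rw [frobNorm_transpose]
    linarith
  have h3 := h2.trans (add_le_add_left (add_le_add_left h1 _) _)
  have h4 := pow_le_pow_left₀ (frobNorm_nonneg _) h3 2
  refine h4.trans ?_
  rw [← mul_pow]
  nlinarith [sq_nonneg ((opNorm x.Z + opNorm y.Z) * frobNorm (x.Z - y.Z)
      - 2 * frobNorm (Matrix.vecMulVec (x.α - y.α) (fun _ : Fin n => (1 : ℝ)))),
    sq_nonneg ((opNorm x.Z + opNorm y.Z) * frobNorm (x.Z - y.Z) - frobNorm ((x.β - y.β) • X)),
    sq_nonneg (2 * frobNorm (Matrix.vecMulVec (x.α - y.α) (fun _ : Fin n => (1 : ℝ)))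
      - frobNorm ((x.β - y.β) • X))]

/-- Smoothness of the likelihood in the geometry of the algorithm. -/
lemma negLogLik_theta_le {A X : Matrix (Fin n) (Fin n) ℝ} {x y : Iterate n k} {z η : ℝ}
    (hη : 0 < η) (hη1 : η ≤ 1 / 2) (hW : (A - sigmoidMat (x.theta X)).IsSymm)
    (h1 : η * (opNorm y.Z + opNorm x.Z) ^ 2 ≤ 1 / 4 * z ^ 2)
    (h2 : 4 * η * opNorm (A - sigmoidMat (x.theta X)) ≤ z ^ 2) :
    negLogLik A (y.theta X) ≤ negLogLik A (x.theta X)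
      - 2 * frobInner ((A - sigmoidMat (x.theta X)) * x.Z) (y.Z - x.Z)
      - 2 * frobInner (A - sigmoidMat (x.theta X))
          (Matrix.vecMulVec (y.α - x.α) (fun _ : Fin n => (1 : ℝ)))
      - (y.β - x.β) * frobInner (A - sigmoidMat (x.theta X)) X
      + 1 / (2 * η) * stateDist z X y x := by
  have h := negLogLik_le A (x.theta X) (y.theta X)
  rw [frobInner_theta_sub_theta hW] at h
  have h3 := frobNorm_theta_sub_theta_sq_le X y x
  have h4 := (abs_le.mp (abs_frobInner_mul_transpose_le (A - sigmoidMat (x.theta X))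
    (y.Z - x.Z) (y.Z - x.Z))).1
  suffices hs : opNorm (A - sigmoidMat (x.theta X)) * frobNorm (y.Z - x.Z) * frobNorm (y.Z - x.Z)
      + 1 / 8 * frobNorm (y.theta X - x.theta X) ^ 2 ≤ 1 / (2 * η) * stateDist z X y x by
    linarith
  rw [← mul_le_mul_iff_right₀ (show 0 < 2 * η by positivity), ← mul_assoc (2 * η),
    mul_one_div_cancel (by positivity), one_mul]
  unfold stateDist
  set d := frobNorm (y.Z - x.Z)
  set b := frobNorm (Matrix.vecMulVec (y.α - x.α) (fun _ : Fin n => (1 : ℝ)))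
  set g := frobNorm ((y.β - x.β) • X)
  have e1 := mul_le_mul_of_nonneg_right h1 (sq_nonneg d)
  have e2 := mul_le_mul_of_nonneg_right h2 (sq_nonneg d)
  have e3 := mul_le_mul_of_nonneg_left h3 hη.le
  have e4 : η * b ^ 2 ≤ 1 / 2 * b ^ 2 := mul_le_mul_of_nonneg_right hη1 (sq_nonneg b)
  have e5 : η * g ^ 2 ≤ 1 / 2 * g ^ 2 := mul_le_mul_of_nonneg_right hη1 (sq_nonneg g)
  have e6 : 0 ≤ z ^ 2 * d ^ 2 := by positivity
  nlinarith [sq_nonneg b, sq_nonneg g]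

variable {M₁ η : ℝ} {A X : Matrix (Fin n) (Fin n) ℝ} {s : ℕ → Iterate n k}

lemma IsPGD.three_point_Z (h : IsPGD M₁ η A X s) (t : ℕ) {w : Matrix (Fin n) (Fin k) ℝ}
    (hw : w ∈ constraintZ M₁ X k) :
    4 * (η / opNorm (s 0).Z ^ 2)
        * frobInner ((A - sigmoidMat ((s t).theta X)) * (s t).Z) (w - (s (t + 1)).Z)
      ≤ frobNorm ((s t).Z - w) ^ 2 - frobNorm ((s t).Z - (s (t + 1)).Z) ^ 2
        - frobNorm (w - (s (t + 1)).Z) ^ 2 := by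
  have := (h.stepZ t).frob_three_point convex_constraintZ hw
  rw [frobInner_smul_left] at this
  linarith

lemma mulVec_one_dotProduct (W : Matrix (Fin n) (Fin n) ℝ) (v : Fin n → ℝ) :
    (W *ᵥ fun _ => 1) ⬝ᵥ v = frobInner W (Matrix.vecMulVec v (fun _ : Fin n => (1 : ℝ))) := by
  rw [frobInner_eq_sum]
  simp [dotProduct, Matrix.mulVec, Matrix.vecMulVec_apply, Finset.sum_mul]

lemma IsPGD.three_point_alpha (hn : n ≠ 0) (hη : 0 < η) (h : IsPGD M₁ η A X s) (t : ℕ)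
    {w : Fin n → ℝ} (hw : w ∈ constraintAlpha M₁ X) :
    2 * frobInner (A - sigmoidMat ((s t).theta X))
        (Matrix.vecMulVec (w - (s (t + 1)).α) (fun _ : Fin n => (1 : ℝ)))
      ≤ 1 / η * (frobNorm (Matrix.vecMulVec ((s t).α - w) (fun _ : Fin n => (1 : ℝ))) ^ 2
        - frobNorm (Matrix.vecMulVec ((s t).α - (s (t + 1)).α) (fun _ : Fin n => (1 : ℝ))) ^ 2
        - frobNorm (Matrix.vecMulVec (w - (s (t + 1)).α) (fun _ : Fin n => (1 : ℝ))) ^ 2) := by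
  have := (h.stepAlpha t).vec_three_point convex_constraintAlpha hw
  rw [smul_dotProduct, mulVec_one_dotProduct, smul_eq_mul] at this
  simp only [frobNorm_vecMulVec_one_sq]
  have hn' : (0 : ℝ) < n := by exact_mod_cast Nat.pos_of_ne_zero hn
  have h2 := mul_le_mul_of_nonneg_left this (show 0 ≤ (n : ℝ) / η by positivity)
  have e : (n : ℝ) / η * (2 * (2 * (η / (2 * n)) * frobInner (A - sigmoidMat ((s t).theta X))
        (Matrix.vecMulVec (w - (s (t + 1)).α) (fun _ : Fin n => (1 : ℝ)))))
      = 2 * frobInner (A - sigmoidMat ((s t).theta X))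
        (Matrix.vecMulVec (w - (s (t + 1)).α) (fun _ : Fin n => (1 : ℝ))) := by
    field_simp
  rw [e] at h2
  refine h2.trans (le_of_eq ?_)
  ring

lemma IsPGD.three_point_beta (hη : 0 < η) (h : IsPGD M₁ η A X s) (t : ℕ) {w : ℝ}
    (hw : w ∈ constraintBeta M₁ X) :
    (w - (s (t + 1)).β) * frobInner (A - sigmoidMat ((s t).theta X)) X
      ≤ 1 / η * (frobNorm (((s t).β - w) • X) ^ 2 - frobNorm (((s t).β - (s (t + 1)).β) • X) ^ 2
        - frobNorm ((w - (s (t + 1)).β) • X) ^ 2) := by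
  by_cases hX : X = 0
  · subst hX
    have : frobInner (A - sigmoidMat ((s t).theta 0)) (0 : Matrix (Fin n) (Fin n) ℝ) = 0 := by
      simp [frobInner]
    rw [this]
    simp [frobNorm_zero]
  · have := (h.stepBeta hX t).abs_three_point convex_constraintBeta hw
    simp only [frobNorm_smul, mul_pow, sq_abs]
    have hX' : 0 < frobNorm X :=
      lt_of_le_of_ne (frobNorm_nonneg X) fun h0 => hX (frobNorm_eq_zero.mp h0.symm)
    have h2 := mul_le_mul_of_nonneg_left this (show 0 ≤ frobNorm X ^ 2 / η by positivity)
    have e : frobNorm X ^ 2 / η * (2 * (η / (2 * frobNorm X ^ 2)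
          * frobInner (A - sigmoidMat ((s t).theta X)) X * (w - (s (t + 1)).β)))
        = (w - (s (t + 1)).β) * frobInner (A - sigmoidMat ((s t).theta X)) X := by
      field_simp
    rw [e] at h2
    refine h2.trans (le_of_eq ?_)
    ring

lemma frobNorm_vecMulVec_sub_comm (u v : Fin n → ℝ) :
    frobNorm (Matrix.vecMulVec (u - v) (fun _ : Fin n => (1 : ℝ)))
      = frobNorm (Matrix.vecMulVec (v - u) (fun _ : Fin n => (1 : ℝ))) := by
  rw [← frobNorm_neg, ← Matrix.neg_vecMulVec, neg_sub]

lemma frobNorm_sub_smul_comm (u v : ℝ) :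
    frobNorm ((u - v) • X) = frobNorm ((v - u) • X) := by
  rw [frobNorm_smul, frobNorm_smul, abs_sub_comm]

/-- The basic inequality for one step, with an arbitrary feasible state `w` as reference. -/
lemma IsPGD.negLogLik_sub_le (hn : n ≠ 0) (hη : 0 < η) (hη1 : η ≤ 1 / 2) (h : IsPGD M₁ η A X s)
    (t : ℕ) {w : Iterate n k} (hw : w.Feasible M₁ X) {z : ℝ} (h0 : 0 < opNorm (s 0).Z)
    (hW : (A - sigmoidMat ((s t).theta X)).IsSymm)
    (h1 : η * (opNorm (s (t + 1)).Z + opNorm (s t).Z) ^ 2 ≤ 1 / 4 * z ^ 2)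
    (h2 : 4 * η * opNorm (A - sigmoidMat ((s t).theta X)) ≤ z ^ 2) :
    negLogLik A ((s (t + 1)).theta X) - negLogLik A (w.theta X)
      ≤ 1 / (2 * η) * (stateDist z X (s t) w - stateDist z X (s (t + 1)) w)
        + frobInner (A - sigmoidMat ((s t).theta X)) (((s t).Z - w.Z) * ((s t).Z - w.Z)ᵀ)
        + 2 * (z ^ 2 / opNorm (s 0).Z ^ 2 - 1)
          * frobInner ((A - sigmoidMat ((s t).theta X)) * (s t).Z) ((s (t + 1)).Z - w.Z) := by
  -- Smoothness bounds the loss of the new state from above, convexity bounds the loss of the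
  -- reference from below, both expanded at the old state. The linear terms then combine into inner
  -- products with `w` minus the new state, which the projections control.
  have a1 := negLogLik_theta_le hη hη1 hW h1 h2
  have a2 := le_negLogLik A ((s t).theta X) (w.theta X)
  rw [frobInner_theta_sub_theta hW] at a2
  have b1 := h.three_point_Z t hw.memZ
  have b2 := h.three_point_alpha hn hη t hw.memAlpha
  have b3 := h.three_point_beta hη t hw.memBeta
  -- With this factor the three-point inequality for `Z` has the weight `z² / (2η)` of `stateDist`;
  -- those for `α` and `β` have `1 / η`, which explains the weights 2 there. Since the step in `Z`
  -- is scaled by `‖Z⁰‖` and not by `z`, the coefficient of the gradient term becomes `z² / ‖Z⁰‖²`;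
  -- its deviation from 1 is the last term of the claim.
  have b1' := mul_le_mul_of_nonneg_left b1 (show 0 ≤ z ^ 2 / (2 * η) by positivity)
  set W := A - sigmoidMat ((s t).theta X)
  have c1 : frobInner (W * (s t).Z) (w.Z - (s (t + 1)).Z)
      = - frobInner (W * (s t).Z) ((s (t + 1)).Z - w.Z) := by
    rw [frobInner_sub_right, frobInner_sub_right]; ring
  have c2 : frobInner (W * (s t).Z) ((s (t + 1)).Z - (s t).Z)
      = frobInner (W * (s t).Z) ((s (t + 1)).Z - w.Z)
        + frobInner (W * (s t).Z) (w.Z - (s t).Z) := by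
    rw [frobInner_sub_right, frobInner_sub_right, frobInner_sub_right]; ring
  have c3 : frobInner W (Matrix.vecMulVec ((s (t + 1)).α - (s t).α) (fun _ : Fin n => (1 : ℝ)))
      = - frobInner W (Matrix.vecMulVec (w.α - (s (t + 1)).α) (fun _ : Fin n => (1 : ℝ)))
        + frobInner W (Matrix.vecMulVec (w.α - (s t).α) (fun _ : Fin n => (1 : ℝ))) := by
    simp only [Matrix.sub_vecMulVec, frobInner_sub_right]; ring
  have c4 : (w.Z - (s t).Z) * (w.Z - (s t).Z)ᵀ = ((s t).Z - w.Z) * ((s t).Z - w.Z)ᵀ := by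
    rw [← neg_sub, Matrix.transpose_neg, Matrix.neg_mul, Matrix.mul_neg, neg_neg]
  have e : z ^ 2 / (2 * η) * (4 * (η / opNorm (s 0).Z ^ 2)
        * frobInner (W * (s t).Z) (w.Z - (s (t + 1)).Z))
      = -(2 * (z ^ 2 / opNorm (s 0).Z ^ 2)
        * frobInner (W * (s t).Z) ((s (t + 1)).Z - w.Z)) := by
    rw [c1]; field_simp; ring
  rw [e] at b1'
  unfold stateDist at *
  rw [c2, c3] at a1
  rw [c4] at a2
  rw [frobNorm_sub_comm (s t).Z (s (t + 1)).Z, frobNorm_sub_comm w.Z (s (t + 1)).Z] at b1'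
  rw [frobNorm_vecMulVec_sub_comm (s t).α (s (t + 1)).α,
    frobNorm_vecMulVec_sub_comm w.α (s (t + 1)).α] at b2
  rw [frobNorm_sub_smul_comm (s t).β (s (t + 1)).β, frobNorm_sub_smul_comm w.β (s (t + 1)).β] at b3
  have f1 : z ^ 2 / (2 * η) = 1 / (2 * η) * z ^ 2 := by ring
  have f2 : 1 / η = 1 / (2 * η) * 2 := by field_simp
  rw [f1] at b1'
  rw [f2] at b2 b3
  linarith

/-- A step from a feasible state does not increase the loss. -/
lemma IsPGD.negLogLik_succ_le (hn : n ≠ 0) (hη : 0 < η) (hη1 : η ≤ 1 / 2) (h : IsPGD M₁ η A X s)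
    (t : ℕ) (hx : (s t).Feasible M₁ X) {z : ℝ} (hz : z ^ 2 ≤ 2 * opNorm (s 0).Z ^ 2)
    (h0 : 0 < opNorm (s 0).Z)
    (hW : (A - sigmoidMat ((s t).theta X)).IsSymm)
    (h1 : η * (opNorm (s (t + 1)).Z + opNorm (s t).Z) ^ 2 ≤ 1 / 4 * z ^ 2)
    (h2 : 4 * η * opNorm (A - sigmoidMat ((s t).theta X)) ≤ z ^ 2) :
    negLogLik A ((s (t + 1)).theta X) ≤ negLogLik A ((s t).theta X) := by
  have a1 := negLogLik_theta_le hη hη1 hW h1 h2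
  have b1 := h.three_point_Z t hx.memZ
  have b2 := h.three_point_alpha hn hη t hx.memAlpha
  have b3 := h.three_point_beta hη t hx.memBeta
  set W := A - sigmoidMat ((s t).theta X)
  have b1' := mul_le_mul_of_nonneg_left b1
    (show 0 ≤ opNorm (s 0).Z ^ 2 / (2 * η) by positivity)
  have c1 : frobInner (W * (s t).Z) ((s t).Z - (s (t + 1)).Z)
      = - frobInner (W * (s t).Z) ((s (t + 1)).Z - (s t).Z) := by
    rw [frobInner_sub_right, frobInner_sub_right]; ring
  have c3 : frobInner W (Matrix.vecMulVec ((s (t + 1)).α - (s t).α) (fun _ : Fin n => (1 : ℝ)))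
      = - frobInner W (Matrix.vecMulVec ((s t).α - (s (t + 1)).α) (fun _ : Fin n => (1 : ℝ))) := by
    simp only [Matrix.sub_vecMulVec, frobInner_sub_right]; ring
  have e : opNorm (s 0).Z ^ 2 / (2 * η) * (4 * (η / opNorm (s 0).Z ^ 2)
        * frobInner (W * (s t).Z) ((s t).Z - (s (t + 1)).Z))
      = -(2 * frobInner (W * (s t).Z) ((s (t + 1)).Z - (s t).Z)) := by
    rw [c1]; field_simp; ring
  rw [e] at b1'
  unfold stateDist at *
  rw [c3] at a1
  rw [frobNorm_sub_comm (s t).Z (s (t + 1)).Z] at b1'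
  rw [frobNorm_vecMulVec_sub_comm (s t).α (s (t + 1)).α] at b2
  rw [frobNorm_sub_smul_comm (s t).β (s (t + 1)).β] at b3
  simp only [sub_self, frobNorm_zero, Matrix.zero_vecMulVec, zero_smul] at b1' b2 b3
  have f1 : opNorm (s 0).Z ^ 2 / (2 * η) = 1 / (2 * η) * opNorm (s 0).Z ^ 2 := by ring
  have f2 : 1 / η = 1 / (2 * η) * 2 := by field_simp
  rw [f1] at b1'
  rw [f2] at b2 b3
  have hp : 0 < 1 / (2 * η) := by positivity
  -- With the old state as reference, the three-point inequality yields the squared step length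
  -- twice. This is why `z² ≤ 2‖Z⁰‖²` suffices.
  have g1 := mul_nonneg hp.le (mul_nonneg (sub_nonneg.mpr hz)
    (sq_nonneg (frobNorm ((s (t + 1)).Z - (s t).Z))))
  have g2 := mul_nonneg hp.le
    (sq_nonneg (frobNorm (Matrix.vecMulVec ((s (t + 1)).α - (s t).α) (fun _ : Fin n => (1 : ℝ)))))
  have g3 := mul_nonneg hp.le (sq_nonneg (frobNorm (((s (t + 1)).β - (s t).β) • X)))
  nlinarith

end Step

end LatentSpace

namespace LatentSpace

/-! ### The regime of the deterministic analysis -/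

section Regime

variable {n k : ℕ}

lemma opNorm_mul_orthogonal_le (Z : Matrix (Fin n) (Fin k) ℝ) {R : Matrix (Fin k) (Fin k) ℝ}
    (hR : R ∈ Matrix.orthogonalGroup (Fin k) ℝ) : opNorm (Z * R) ≤ opNorm Z := by
  have hR' : Rᵀ * R = 1 := (Matrix.mem_orthogonalGroup_iff' (Fin k) ℝ).mp hR
  have h1 : opNorm R ≤ 1 := by
    refine opNorm_le_of_mulVec zero_le_one fun v => ?_
    rw [one_mul, ← sq_le_sq₀ (vecNorm_nonneg _) (vecNorm_nonneg _), vecNorm_sq_eq_dotProduct,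
      vecNorm_sq_eq_dotProduct, Matrix.dotProduct_mulVec, ← Matrix.mulVec_transpose,
      Matrix.mulVec_mulVec, hR', Matrix.one_mulVec]
  exact (opNorm_mul_le _ _).trans (mul_le_of_le_one_right (opNorm_nonneg _) h1)

lemma opNorm_mul_orthogonal (Z : Matrix (Fin n) (Fin k) ℝ) {R : Matrix (Fin k) (Fin k) ℝ}
    (hR : R ∈ Matrix.orthogonalGroup (Fin k) ℝ) : opNorm (Z * R) = opNorm Z := by
  refine le_antisymm (opNorm_mul_orthogonal_le Z hR) ?_
  have hR' : R * star R = 1 := Unitary.mul_star_self_of_mem hR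
  have h := opNorm_mul_orthogonal_le (Z * R) (Unitary.star_mem hR)
  rwa [Matrix.mul_assoc, hR', Matrix.mul_one] at h

/-- The size of the noise in the energy inequalities: `48 e^{M₁} ϖ² k + γ² / 4`, where `ϖ` bounds
the noise and `γ` is the norm of the remainder of the low rank approximation. -/
noncomputable def noiseLevel (k : ℕ) (M₁ ϖ γ : ℝ) : ℝ :=
  48 * Real.exp M₁ * ϖ ^ 2 * k + γ ^ 2 / 4

/-- The assumptions of the deterministic analysis.  Here `Θs` is the true parameter and
`α⋆ 1ᵀ + 1 α⋆ᵀ + β⋆ X + Z⋆ Z⋆ᵀ` its low rank approximation. -/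
structure Regime (M₁ η ϖ : ℝ) (A X Θs : Matrix (Fin n) (Fin n) ℝ) (Zs : Matrix (Fin n) (Fin k) ℝ)
    (αs : Fin n → ℝ) (βs : ℝ) : Prop where
  hk : 1 ≤ k
  hn : n ≠ 0
  hM : 0 ≤ M₁
  eta_pos : 0 < η
  eta_le : η ≤ 1 / 1024
  symmX : X.IsSymm
  stable : 128 * k * opNorm X ^ 2 ≤ frobNorm X ^ 2
  symmA : A.IsSymm
  symmTheta : Θs.IsSymm
  feasible : ∀ R ∈ Matrix.orthogonalGroup (Fin k) ℝ, (Iterate.mk (Zs * R) αs βs).Feasible M₁ X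
  theta_le : ∀ i j, |Θs i j| ≤ M₁
  sv_pos : 0 < singVal Zs (k - 1)
  noise : IsNoiseBound k A (sigmoidMat Θs) X ϖ
  signal : η * condNum Zs ^ 2 * Real.exp M₁
      * noiseLevel k M₁ ϖ (frobNorm (Θs - theta X αs βs (Zs * Zsᵀ)))
    ≤ 1 / 10 ^ 6 * opNorm Zs ^ 4

variable {M₁ η ϖ : ℝ} {A X Θs : Matrix (Fin n) (Fin n) ℝ} {Zs : Matrix (Fin n) (Fin k) ℝ}
  {αs : Fin n → ℝ} {βs : ℝ} {x : Iterate n k} {s : ℕ → Iterate n k}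

lemma sigmoidMat_isSymm {Θ : Matrix (Fin n) (Fin n) ℝ} (h : Θ.IsSymm) : (sigmoidMat Θ).IsSymm :=
  h.map _

lemma Iterate.theta_isSymm (hX : X.IsSymm) (x : Iterate n k) : (x.theta X).IsSymm := by
  ext i j
  have h1 : (x.Z * x.Zᵀ)ᵀ = x.Z * x.Zᵀ := by simp
  have h2 := congrFun (congrFun h1 i) j
  have h3 := congrFun (congrFun hX i) j
  rw [Matrix.transpose_apply] at *
  change x.α j + x.α i + x.β * X j i + (x.Z * x.Zᵀ) j i
    = x.α i + x.α j + x.β * X i j + (x.Z * x.Zᵀ) i j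
  rw [h2, h3]; ring

namespace Regime

lemma symmW (H : Regime M₁ η ϖ A X Θs Zs αs βs) (x : Iterate n k) :
    (A - sigmoidMat (x.theta X)).IsSymm :=
  H.symmA.sub (sigmoidMat_isSymm (x.theta_isSymm H.symmX))

lemma opNorm_pos (H : Regime M₁ η ϖ A X Θs Zs αs βs) : 0 < opNorm Zs := by
  rw [opNorm_eq_singVal_zero H.hk]
  exact H.sv_pos.trans_le (singVal_antitone Zs (Nat.zero_le _))

lemma singVal_eq (H : Regime M₁ η ϖ A X Θs Zs αs βs) :
    condNum Zs * singVal Zs (k - 1) = opNorm Zs := by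
  rw [condNum, div_mul_cancel₀ _ H.sv_pos.ne', opNorm_eq_singVal_zero H.hk]

lemma one_le_condNum (H : Regime M₁ η ϖ A X Θs Zs αs βs) : 1 ≤ condNum Zs := by
  rw [condNum, one_le_div H.sv_pos]
  exact singVal_antitone Zs (Nat.zero_le _)

lemma noiseLevel_nonneg (M₁ ϖ γ : ℝ) : 0 ≤ noiseLevel k M₁ ϖ γ := by
  unfold noiseLevel; positivity

/-- The squared error metric with weight `2` on the covariate part. -/
noncomputable def lyap (X : Matrix (Fin n) (Fin n) ℝ) (Zs : Matrix (Fin n) (Fin k) ℝ)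
    (αs : Fin n → ℝ) (βs : ℝ) (x : Iterate n k) : ℝ :=
  opNorm Zs ^ 2 * procrustesDist x.Z Zs ^ 2 + 2 * alphaErr αs x ^ 2 + 2 * betaErr X βs x ^ 2

lemma lyap_nonneg (x : Iterate n k) : 0 ≤ lyap X Zs αs βs x := by
  unfold lyap; positivity

lemma err_le_lyap (x : Iterate n k) : err X Zs αs βs x ≤ lyap X Zs αs βs x := by
  have := sq_nonneg (betaErr X βs x)
  unfold err lyap
  unfold betaErr alphaErr at *
  linarith

lemma lyap_le_two_err (x : Iterate n k) : lyap X Zs αs βs x ≤ 2 * err X Zs αs βs x := by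
  have h1 : 0 ≤ opNorm Zs ^ 2 * procrustesDist x.Z Zs ^ 2 := by positivity
  have h2 := sq_nonneg (alphaErr αs x)
  unfold err lyap
  unfold betaErr alphaErr at *
  linarith

lemma lyap_le_stateDist (x : Iterate n k) {R : Matrix (Fin k) (Fin k) ℝ}
    (hR : R ∈ Matrix.orthogonalGroup (Fin k) ℝ) :
    lyap X Zs αs βs x ≤ stateDist (opNorm Zs) X x (Iterate.mk (Zs * R) αs βs) := by
  have := pow_le_pow_left₀ (procrustesDist_nonneg _ _) (procrustesDist_le x.Z Zs hR) 2
  unfold lyap stateDist alphaErr betaErr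
  gcongr

lemma lyap_eq_stateDist (x : Iterate n k) {R : Matrix (Fin k) (Fin k) ℝ}
    (h : procrustesDist x.Z Zs = frobNorm (x.Z - Zs * R)) :
    lyap X Zs αs βs x = stateDist (opNorm Zs) X x (Iterate.mk (Zs * R) αs βs) := by
  unfold lyap stateDist alphaErr betaErr
  rw [h]

/-- `‖Z⋆‖² dist(Z, Z⋆)² ≤ (5/4) κ² ‖Z Zᵀ - Z⋆ Z⋆ᵀ‖_F²`. -/
lemma dist_sq_le (H : Regime M₁ η ϖ A X Θs Zs αs βs) (x : Iterate n k) :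
    opNorm Zs ^ 2 * procrustesDist x.Z Zs ^ 2 ≤ 5 / 4 * condNum Zs ^ 2 * gramErr Zs x ^ 2 := by
  obtain ⟨R, hR, hd, hpsd⟩ := exists_procrustes_alignment x.Z Zs
  have hR' : Rᵀ * R = 1 := (Matrix.mem_orthogonalGroup_iff' (Fin k) ℝ).mp hR
  have h := frobNorm_sub_sq_le_gram x.Z (Zs * R) hpsd H.sv_pos.le (fun B => by
    have h1 : frobNorm (R * B) = frobNorm B := by
      rw [← sq_eq_sq₀ (frobNorm_nonneg _) (frobNorm_nonneg _), ← frobInner_self,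
        frobInner_mul_left, ← Matrix.mul_assoc, hR', Matrix.one_mul, frobInner_self]
    rw [← h1, Matrix.mul_assoc]
    exact singVal_mul_frobNorm_le Zs (R * B))
  rw [gram_mul_orthogonal Zs hR, ← hd] at h
  have h2 := mul_le_mul_of_nonneg_left h (sq_nonneg (condNum Zs))
  rw [← H.singVal_eq, gramErr]
  nlinarith

lemma sum_Zs (H : Regime M₁ η ϖ A X Θs Zs αs βs) (a : Fin k) : ∑ i, Zs i a = 0 := by
  have := (H.feasible 1 (one_mem _)).memZ.1
  rw [Matrix.mul_one] at this
  exact centering_mul_eq_iff_sum Zs H.hn this a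

lemma sum_sq_le (H : Regime M₁ η ϖ A X Θs Zs αs βs) (hx : x.Feasible M₁ X) :
    1 / 2 * (gramErr Zs x ^ 2 + 2 * alphaErr αs x ^ 2 + betaErr X βs x ^ 2)
      ≤ thetaErr X Zs αs βs x ^ 2 :=
  sum_sq_le_thetaErr_sq H.hk H.symmX H.stable
    (fun a => centering_mul_eq_iff_sum x.Z H.hn hx.memZ.1 a) H.sum_Zs

lemma gramErr_sq_le (H : Regime M₁ η ϖ A X Θs Zs αs βs) (hx : x.Feasible M₁ X) :
    gramErr Zs x ^ 2 ≤ 2 * thetaErr X Zs αs βs x ^ 2 := by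
  have := H.sum_sq_le hx
  nlinarith [sq_nonneg (alphaErr αs x), sq_nonneg (betaErr X βs x)]

/-- The Procrustes bound costs `5κ²/4`, and near orthogonality a factor 2. The weight 2 on the
covariate part of `lyap` then determines the constant 4. -/
lemma lyap_le (H : Regime M₁ η ϖ A X Θs Zs αs βs) (hx : x.Feasible M₁ X) :
    lyap X Zs αs βs x ≤ 4 * condNum Zs ^ 2 * thetaErr X Zs αs βs x ^ 2 := by
  have h1 := H.sum_sq_le hx
  have h2 := H.dist_sq_le x
  have h3 : 1 ≤ condNum Zs ^ 2 := one_le_pow₀ H.one_le_condNum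
  have h4 := mul_le_mul_of_nonneg_left h1 (sq_nonneg (condNum Zs))
  unfold lyap
  nlinarith [mul_nonneg (sub_nonneg.mpr h3) (sq_nonneg (alphaErr αs x)),
    mul_nonneg (sub_nonneg.mpr h3) (sq_nonneg (betaErr X βs x)),
    mul_nonneg (sq_nonneg (condNum Zs)) (sq_nonneg (gramErr Zs x))]

lemma star_theta {R : Matrix (Fin k) (Fin k) ℝ} (hR : R ∈ Matrix.orthogonalGroup (Fin k) ℝ) :
    (Iterate.mk (Zs * R) αs βs).theta X = LatentSpace.theta X αs βs (Zs * Zsᵀ) := by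
  unfold Iterate.theta
  simp only [gram_mul_orthogonal Zs hR]

/-- The energy of a feasible state controls its distance from the truth. -/
lemma energy_lower (H : Regime M₁ η ϖ A X Θs Zs αs βs) (hx : x.Feasible M₁ X) :
    Real.exp (-M₁) / 32 * thetaErr X Zs αs βs x ^ 2
        - noiseLevel k M₁ ϖ (frobNorm (Θs - LatentSpace.theta X αs βs (Zs * Zsᵀ)))
      ≤ negLogLik A (x.theta X) - negLogLik A (LatentSpace.theta X αs βs (Zs * Zsᵀ)) := by
  set Θk := LatentSpace.theta X αs βs (Zs * Zsᵀ) with hΘk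
  set γ := frobNorm (Θs - Θk) with hγ
  set τ := thetaErr X Zs αs βs x with hτ
  -- Both expansions are taken at the true `Θs`, the one point where the residual is pure noise.
  -- Moving the reference to the rank `k` truth costs only multiples of `γ²`.
  have h1 := le_negLogLik_of_abs_le A Θs (x.theta X) H.theta_le (hx.abs_theta_le)
  have h2 := negLogLik_le A Θs Θk
  rw [frobNorm_sub_comm Θk, ← hγ] at h2
  have h3 : frobInner (A - sigmoidMat Θs) (x.theta X - Θk)
      = frobInner (A - sigmoidMat Θs) (x.theta X - Θs)
        - frobInner (A - sigmoidMat Θs) (Θk - Θs) := by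
    simp only [frobInner_sub_right]; ring
  have h4 := H.noise.abs_inner_theta_le (Zs := Zs) (αs := αs) (βs := βs) (x := x) H.hk
    (H.symmA.sub (sigmoidMat_isSymm H.symmTheta))
  rw [← hΘk, h3] at h4
  have h4' := (abs_le.mp h4).2
  have h5 : τ ^ 2 ≤ 2 * frobNorm (x.theta X - Θs) ^ 2 + 2 * γ ^ 2 := by
    have : τ ≤ frobNorm (x.theta X - Θs) + γ := by
      rw [hτ, hγ, thetaErr, ← hΘk]
      have := frobNorm_add_le (x.theta X - Θs) (Θs - Θk)
      rwa [sub_add_sub_cancel] at this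
    have := pow_le_pow_left₀ (thetaErr_nonneg _ _ _ _ _) this 2
    nlinarith [sq_nonneg (frobNorm (x.theta X - Θs) - γ)]
  have h6 := H.sum_sq_le hx
  rw [← hτ] at h6
  set a := gramErr Zs x
  set b := alphaErr αs x
  set g := betaErr X βs x
  set e := Real.exp (-M₁) with he
  have he0 : 0 < e := Real.exp_pos _
  have he1 : e ≤ 1 := by rw [he, Real.exp_le_one_iff]; linarith [H.hM]
  have heE : e * Real.exp M₁ = 1 := by rw [he, ← Real.exp_add]; simp
  set q := √(k : ℝ) * ϖ with hq
  have hq2 : q ^ 2 = ϖ ^ 2 * k := by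
    rw [hq, mul_pow, Real.sq_sqrt (Nat.cast_nonneg k)]; ring
  have h7 : (a + b + g) ^ 2 ≤ 6 * τ ^ 2 := by
    nlinarith [sq_nonneg (a - b), sq_nonneg (a - g), sq_nonneg (b - g), sq_nonneg b]
  -- Young's inequality spends half of the available curvature `e τ² / 16` on the noise. With `(a +
  -- b + g)² ≤ 6τ²` this produces the 48 in `noiseLevel`.
  have h8 : q * (a + b + g) ≤ e / 32 * τ ^ 2 + 48 * Real.exp M₁ * q ^ 2 := by
    have : 0 ≤ Real.exp M₁ * (48 * q - e * (a + b + g) / 2) ^ 2 := by positivity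
    have h9 : Real.exp M₁ * (48 * q - e * (a + b + g) / 2) ^ 2
        = 48 * (48 * Real.exp M₁ * q ^ 2) - 48 * q * (a + b + g) * (e * Real.exp M₁)
          + (e * Real.exp M₁) * e / 4 * (a + b + g) ^ 2 := by ring
    rw [h9, heE] at this
    nlinarith [mul_le_mul_of_nonneg_left h7 he0.le]
  have h10 := mul_le_mul_of_nonneg_left h5 (show 0 ≤ e / 16 by positivity)
  have h11 : e * γ ^ 2 ≤ γ ^ 2 := mul_le_of_le_one_left (sq_nonneg _) he1
  have h12 : noiseLevel k M₁ ϖ γ = 48 * Real.exp M₁ * q ^ 2 + γ ^ 2 / 4 := by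
    rw [noiseLevel, hq2]; ring
  rw [h12]
  linarith

/-- The energy of an arbitrary state is bounded in terms of its distance from the truth. -/
lemma energy_upper (H : Regime M₁ η ϖ A X Θs Zs αs βs) (hx : x.Feasible M₁ X) :
    negLogLik A (x.theta X) - negLogLik A (LatentSpace.theta X αs βs (Zs * Zsᵀ))
      ≤ noiseLevel k M₁ ϖ (frobNorm (Θs - LatentSpace.theta X αs βs (Zs * Zsᵀ)))
        + thetaErr X Zs αs βs x ^ 2 := by
  set Θk := LatentSpace.theta X αs βs (Zs * Zsᵀ) with hΘk
  set γ := frobNorm (Θs - Θk) with hγ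
  set τ := thetaErr X Zs αs βs x with hτ
  have h1 := negLogLik_le A Θk (x.theta X)
  have hτ' : frobNorm (x.theta X - Θk) = τ := rfl
  rw [hτ'] at h1
  have h3 : A - sigmoidMat Θk = (A - sigmoidMat Θs) + (sigmoidMat Θs - sigmoidMat Θk) := by abel
  have h4 := H.noise.abs_inner_theta_le (Zs := Zs) (αs := αs) (βs := βs) (x := x) H.hk
    (H.symmA.sub (sigmoidMat_isSymm H.symmTheta))
  rw [← hΘk] at h4
  have h4' := (abs_le.mp h4).1
  have h5 := (abs_le.mp (abs_frobInner_le (sigmoidMat Θs - sigmoidMat Θk) (x.theta X - Θk))).1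
  rw [hτ'] at h5
  have h5' : frobNorm (sigmoidMat Θs - sigmoidMat Θk) * τ ≤ 1 / 4 * γ * τ :=
    mul_le_mul_of_nonneg_right (frobNorm_sigmoidMat_sub_le Θk Θs) (thetaErr_nonneg _ _ _ _ _)
  rw [h3, frobInner_add_left] at h1
  have h6 := H.sum_sq_le hx
  rw [← hτ] at h6
  set a := gramErr Zs x
  set b := alphaErr αs x
  set g := betaErr X βs x
  have hE : 1 ≤ Real.exp M₁ := Real.one_le_exp H.hM
  set q := √(k : ℝ) * ϖ with hq
  have hq2 : q ^ 2 = ϖ ^ 2 * k := by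
    rw [hq, mul_pow, Real.sq_sqrt (Nat.cast_nonneg k)]; ring
  have h7 : (a + b + g) ^ 2 ≤ 6 * τ ^ 2 := by
    nlinarith [sq_nonneg (a - b), sq_nonneg (a - g), sq_nonneg (b - g), sq_nonneg b]
  have h12 : noiseLevel k M₁ ϖ γ = 48 * Real.exp M₁ * q ^ 2 + γ ^ 2 / 4 := by
    rw [noiseLevel, hq2]; ring
  rw [h12]
  nlinarith [sq_nonneg (8 * q - (a + b + g)), mul_nonneg (sub_nonneg.mpr hE) (sq_nonneg q),
    sq_nonneg (γ - τ / 2), sq_nonneg τ]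

/-- The size of the residual `A - σ(Θ)` relative to the iterate. -/
noncomputable def resid (k : ℕ) (ϖ γ τ : ℝ) : ℝ := √k * ϖ / 2 + γ / 4 + τ / 4

lemma frobNorm_sigmoid_sub_le (x : Iterate n k) :
    frobNorm (sigmoidMat Θs - sigmoidMat (x.theta X))
      ≤ frobNorm (Θs - LatentSpace.theta X αs βs (Zs * Zsᵀ)) / 4 + thetaErr X Zs αs βs x / 4 := by
  have h1 := frobNorm_sigmoidMat_sub_le (x.theta X) Θs
  have h2 := frobNorm_sub_le (Θs - LatentSpace.theta X αs βs (Zs * Zsᵀ))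
    (x.theta X - LatentSpace.theta X αs βs (Zs * Zsᵀ))
  rw [sub_sub_sub_cancel_right] at h2
  unfold thetaErr
  linarith

lemma opNorm_resid_le (H : Regime M₁ η ϖ A X Θs Zs αs βs) (x : Iterate n k) :
    opNorm (A - sigmoidMat (x.theta X))
      ≤ resid k ϖ (frobNorm (Θs - LatentSpace.theta X αs βs (Zs * Zsᵀ)))
          (thetaErr X Zs αs βs x) := by
  have hk' : (1 : ℝ) ≤ √k := Real.one_le_sqrt.mpr (by exact_mod_cast H.hk)
  have h1 := opNorm_add_le (A - sigmoidMat Θs) (sigmoidMat Θs - sigmoidMat (x.theta X))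
  rw [sub_add_sub_cancel] at h1
  have h2 := (opNorm_le_frobNorm _).trans (frobNorm_sigmoid_sub_le (X := X) (Θs := Θs) (Zs := Zs) (αs := αs) (βs := βs) x)
  have h3 := H.noise.opNorm_le
  have h4 : ϖ ≤ √k * ϖ := le_mul_of_one_le_left (zero_le_one.trans H.noise.one_le) hk'
  unfold resid
  linarith

lemma frobNorm_resid_mul_le (H : Regime M₁ η ϖ A X Θs Zs αs βs) (x : Iterate n k) :
    frobNorm ((A - sigmoidMat (x.theta X)) * x.Z)
      ≤ opNorm x.Z * resid k ϖ (frobNorm (Θs - LatentSpace.theta X αs βs (Zs * Zsᵀ)))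
          (thetaErr X Zs αs βs x) := by
  have e : (A - sigmoidMat (x.theta X)) * x.Z = (A - sigmoidMat Θs) * x.Z
      + (sigmoidMat Θs - sigmoidMat (x.theta X)) * x.Z := by
    rw [← Matrix.add_mul, sub_add_sub_cancel]
  have hz := opNorm_nonneg x.Z
  have h1 : frobNorm ((A - sigmoidMat Θs) * x.Z) ≤ opNorm x.Z * (√k * ϖ / 2) := by
    refine (frobNorm_mul_le_opNorm_mul _ _).trans ?_
    have h2 := frobNorm_le_sqrt_mul_opNorm x.Z
    have h3 : opNorm (A - sigmoidMat Θs) ≤ ϖ / 2 := by linarith [H.noise.opNorm_le]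
    have := mul_le_mul h3 h2 (frobNorm_nonneg _) (by linarith [H.noise.one_le])
    linarith
  have h2 : frobNorm ((sigmoidMat Θs - sigmoidMat (x.theta X)) * x.Z)
      ≤ opNorm x.Z * (frobNorm (Θs - LatentSpace.theta X αs βs (Zs * Zsᵀ)) / 4
        + thetaErr X Zs αs βs x / 4) := by
    refine (frobNorm_mul_le_mul_opNorm _ _).trans ?_
    rw [mul_comm]
    exact mul_le_mul_of_nonneg_left (frobNorm_sigmoid_sub_le x) hz
  rw [e]
  refine (frobNorm_add_le _ _).trans ((add_le_add h1 h2).trans (le_of_eq ?_))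
  unfold resid
  ring

/-- For a matrix `D Dᵀ` the noise enters through its operator norm times `‖D‖_F²`. Unlike in `resid`
there is no factor `√k`, so the weak noise condition does not involve `k`. -/
lemma abs_inner_gram_le (H : Regime M₁ η ϖ A X Θs Zs αs βs) (x : Iterate n k)
    (D : Matrix (Fin n) (Fin k) ℝ) :
    |frobInner (A - sigmoidMat (x.theta X)) (D * Dᵀ)|
      ≤ (ϖ / 2 + frobNorm (Θs - LatentSpace.theta X αs βs (Zs * Zsᵀ)) / 4
        + thetaErr X Zs αs βs x / 4) * frobNorm D ^ 2 := by
  have e : frobInner (A - sigmoidMat (x.theta X)) (D * Dᵀ)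
      = frobInner (A - sigmoidMat Θs) (D * Dᵀ)
        + frobInner (sigmoidMat Θs - sigmoidMat (x.theta X)) (D * Dᵀ) := by
    rw [← frobInner_add_left, sub_add_sub_cancel]
  have h1 : |frobInner (A - sigmoidMat Θs) (D * Dᵀ)| ≤ ϖ / 2 * frobNorm D ^ 2 := by
    refine (abs_frobInner_mul_transpose_le _ D D).trans ?_
    have h3 : opNorm (A - sigmoidMat Θs) ≤ ϖ / 2 := by linarith [H.noise.opNorm_le]
    rw [mul_assoc, ← sq]
    exact mul_le_mul_of_nonneg_right h3 (sq_nonneg _)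
  have h2 : |frobInner (sigmoidMat Θs - sigmoidMat (x.theta X)) (D * Dᵀ)|
      ≤ (frobNorm (Θs - LatentSpace.theta X αs βs (Zs * Zsᵀ)) / 4
        + thetaErr X Zs αs βs x / 4) * frobNorm D ^ 2 := by
    refine (abs_frobInner_le _ _).trans ?_
    have h4 : frobNorm (D * Dᵀ) ≤ frobNorm D ^ 2 := by
      have := frobNorm_mul_le D Dᵀ
      rwa [frobNorm_transpose, ← sq] at this
    exact mul_le_mul (frobNorm_sigmoid_sub_le x) h4 (frobNorm_nonneg _)
      (add_nonneg (by have := frobNorm_nonneg (Θs - LatentSpace.theta X αs βs (Zs * Zsᵀ)); linarith)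
        (by have := thetaErr_nonneg X Zs αs βs x; linarith))
  rw [e]
  refine (abs_add_le _ _).trans ((add_le_add h1 h2).trans (le_of_eq ?_))
  ring

end Regime

end Regime

end LatentSpace

namespace LatentSpace

/-! ### Convergence of the iterates -/

namespace Regime

section Recursion

variable {n k : ℕ} {M₁ η ϖ : ℝ} {A X Θs : Matrix (Fin n) (Fin n) ℝ} {Zs : Matrix (Fin n) (Fin k) ℝ}
  {αs : Fin n → ℝ} {βs : ℝ} {x : Iterate n k} {s : ℕ → Iterate n k}

local notation "z⋆" => opNorm Zs
local notation "κ⋆" => condNum Zs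
local notation "γ⋆" => frobNorm (Θs - LatentSpace.theta X αs βs (Zs * Zsᵀ))
local notation "N⋆" => noiseLevel k M₁ ϖ (frobNorm (Θs - LatentSpace.theta X αs βs (Zs * Zsᵀ)))

/-- The contraction constant `e^{-M₁} / κ²`. -/
noncomputable def contr (M₁ : ℝ) (Zs : Matrix (Fin n) (Fin k) ℝ) : ℝ :=
  Real.exp (-M₁) / condNum Zs ^ 2

/-- The excess loss over the low rank approximation of the truth. -/
noncomputable def excess (A X : Matrix (Fin n) (Fin n) ℝ) (Zs : Matrix (Fin n) (Fin k) ℝ)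
    (αs : Fin n → ℝ) (βs : ℝ) (x : Iterate n k) : ℝ :=
  negLogLik A (x.theta X) - negLogLik A (LatentSpace.theta X αs βs (Zs * Zsᵀ))

lemma one_le_sq_condNum (H : Regime M₁ η ϖ A X Θs Zs αs βs) : 1 ≤ κ⋆ ^ 2 :=
  one_le_pow₀ H.one_le_condNum

lemma contr_pos (H : Regime M₁ η ϖ A X Θs Zs αs βs) : 0 < contr M₁ Zs :=
  div_pos (Real.exp_pos _) (zero_lt_one.trans_le H.one_le_sq_condNum)

lemma contr_mul (H : Regime M₁ η ϖ A X Θs Zs αs βs) :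
    contr M₁ Zs * (κ⋆ ^ 2 * Real.exp M₁) = 1 := by
  have := (zero_lt_one.trans_le H.one_le_condNum).ne'
  rw [contr, Real.exp_neg]
  field_simp

lemma one_le_sq_condNum_mul_exp (H : Regime M₁ η ϖ A X Θs Zs αs βs) :
    1 ≤ κ⋆ ^ 2 * Real.exp M₁ :=
  one_le_mul_of_one_le_of_one_le H.one_le_sq_condNum (Real.one_le_exp H.hM)

lemma contr_le_one (H : Regime M₁ η ϖ A X Θs Zs αs βs) : contr M₁ Zs ≤ 1 := by
  have h1 := H.contr_mul
  have h2 := H.one_le_sq_condNum_mul_exp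
  nlinarith [H.contr_pos]

lemma eta_exp_noise_le (H : Regime M₁ η ϖ A X Θs Zs αs βs) :
    η * (Real.exp M₁ * N⋆) ≤ 1 / 10 ^ 6 * z⋆ ^ 4 := by
  refine le_trans ?_ H.signal
  have h := H.one_le_sq_condNum
  have h2 : 0 ≤ η * (Real.exp M₁ * N⋆) :=
    mul_nonneg H.eta_pos.le (mul_nonneg (Real.exp_pos _).le (noiseLevel_nonneg _ _ _))
  nlinarith

lemma eta_noise_le (H : Regime M₁ η ϖ A X Θs Zs αs βs) : η * N⋆ ≤ 1 / 10 ^ 6 * z⋆ ^ 4 := by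
  refine le_trans ?_ H.eta_exp_noise_le
  have h : 1 ≤ Real.exp M₁ := Real.one_le_exp H.hM
  have h2 : 0 ≤ η * N⋆ := mul_nonneg H.eta_pos.le (noiseLevel_nonneg _ _ _)
  nlinarith

lemma resid_sq_le (H : Regime M₁ η ϖ A X Θs Zs αs βs) (τ : ℝ) :
    resid k ϖ γ⋆ τ ^ 2 ≤ N⋆ + τ ^ 2 * (3 / 16) := by
  have h : 1 ≤ Real.exp M₁ := Real.one_le_exp H.hM
  have hq2 : (√(k : ℝ) * ϖ) ^ 2 = ϖ ^ 2 * k := by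
    rw [mul_pow, Real.sq_sqrt (Nat.cast_nonneg k)]; ring
  unfold resid noiseLevel
  have h2 : ϖ ^ 2 * k ≤ Real.exp M₁ * (ϖ ^ 2 * k) := le_mul_of_one_le_left (by positivity) h
  set q := √(k : ℝ) * ϖ
  rw [← hq2] at h2
  have e : 48 * Real.exp M₁ * ϖ ^ 2 * k = 48 * (Real.exp M₁ * q ^ 2) := by rw [hq2]; ring
  rw [e]
  nlinarith [sq_nonneg (q / 2 - γ⋆ / 4), sq_nonneg (q / 2 - τ / 4), sq_nonneg (γ⋆ / 4 - τ / 4),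
    sq_nonneg q, sq_nonneg γ⋆]

lemma opNorm_iterate_le (x : Iterate n k) : opNorm x.Z ≤ z⋆ + procrustesDist x.Z Zs := by
  obtain ⟨R, hR, hd, -⟩ := exists_procrustes_alignment x.Z Zs
  rw [hd, ← opNorm_mul_orthogonal Zs hR]
  have := opNorm_add_le (Zs * R) (x.Z - Zs * R)
  rw [add_sub_cancel] at this
  linarith [opNorm_le_frobNorm (x.Z - Zs * R)]

lemma opNorm_le_iterate (x : Iterate n k) : z⋆ ≤ opNorm x.Z + procrustesDist x.Z Zs := by
  obtain ⟨R, hR, hd, -⟩ := exists_procrustes_alignment x.Z Zs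
  rw [hd, ← opNorm_mul_orthogonal Zs hR]
  have := opNorm_add_le x.Z (-(x.Z - Zs * R))
  rw [opNorm_neg, neg_sub, add_sub_cancel] at this
  linarith [opNorm_le_frobNorm (x.Z - Zs * R)]

/-- The next position stays within the noise of the aligned truth. -/
lemma frobNorm_succ_sub_le (H : Regime M₁ η ϖ A X Θs Zs αs βs) (hs : IsPGD M₁ η A X s) (t : ℕ)
    {R : Matrix (Fin k) (Fin k) ℝ} (hR : R ∈ Matrix.orthogonalGroup (Fin k) ℝ) :
    frobNorm ((s (t + 1)).Z - Zs * R) ≤ frobNorm ((s t).Z - Zs * R)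
      + 4 * (η / opNorm (s 0).Z ^ 2)
        * (opNorm (s t).Z * resid k ϖ γ⋆ (thetaErr X Zs αs βs (s t))) := by
  have h := hs.three_point_Z t (H.feasible R hR).memZ
  have h2 := (abs_le.mp (abs_frobInner_le
    ((A - sigmoidMat ((s t).theta X)) * (s t).Z) (Zs * R - (s (t + 1)).Z))).1
  have h3 := H.frobNorm_resid_mul_le (s t)
  have h4 : 0 ≤ 4 * (η / opNorm (s 0).Z ^ 2) := by have := H.eta_pos; positivity
  simp only [frobNorm_sub_comm (Zs * R)] at h h2
  set D := frobNorm ((s (t + 1)).Z - Zs * R)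
  set d := frobNorm ((s t).Z - Zs * R)
  have hD : 0 ≤ D := frobNorm_nonneg _
  have hd : 0 ≤ d := frobNorm_nonneg _
  set ω := opNorm (s t).Z * resid k ϖ γ⋆ (thetaErr X Zs αs βs (s t))
  set c := 4 * (η / opNorm (s 0).Z ^ 2)
  have hω : 0 ≤ ω := (frobNorm_nonneg _).trans h3
  have h5 := mul_le_mul_of_nonneg_left h2 h4
  have h6 := mul_le_mul_of_nonneg_left (mul_le_mul_of_nonneg_right h3 hD) h4
  -- This is a quadratic inequality in `D`; any `D > d + cω` would violate it.
  have h7 : D ^ 2 ≤ d ^ 2 + c * ω * D := by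
    nlinarith [sq_nonneg (frobNorm ((s t).Z - (s (t + 1)).Z))]
  by_contra! hlt
  have hcω : 0 ≤ c * ω := mul_nonneg h4 hω
  nlinarith [mul_pos (sub_pos.mpr hlt) (lt_of_le_of_lt (add_nonneg hd hcω) hlt)]

/-- The step sizes are small enough if the residual and the distance to the truth are moderate. -/
lemma step_small (H : Regime M₁ η ϖ A X Θs Zs αs βs) (hs : IsPGD M₁ η A X s) (t : ℕ)
    (h0 : z⋆ ^ 2 ≤ 2 * opNorm (s 0).Z ^ 2)
    (hω : η * resid k ϖ γ⋆ (thetaErr X Zs αs βs (s t)) ^ 2 ≤ 1 / 400 * z⋆ ^ 4)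
    (hδ : η * procrustesDist (s t).Z Zs ^ 2 ≤ 1 / 100 * z⋆ ^ 2) :
    η * (opNorm (s (t + 1)).Z + opNorm (s t).Z) ^ 2 ≤ 1 / 4 * z⋆ ^ 2 ∧
      4 * η * opNorm (A - sigmoidMat ((s t).theta X)) ≤ z⋆ ^ 2 := by
  obtain ⟨R, hR, hd, -⟩ := exists_procrustes_alignment (s t).Z Zs
  have e1 := H.frobNorm_succ_sub_le hs t hR
  rw [← hd] at e1
  have e2 := opNorm_iterate_le (Zs := Zs) (s t)
  have e3 := opNorm_add_le (Zs * R) ((s (t + 1)).Z - Zs * R)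
  rw [add_sub_cancel, opNorm_mul_orthogonal Zs hR] at e3
  have e4 := opNorm_le_frobNorm ((s (t + 1)).Z - Zs * R)
  have e5 := H.opNorm_resid_le (s t)
  have hz := H.opNorm_pos
  have hq : 0 < opNorm (s 0).Z ^ 2 := by nlinarith
  have hω0 : 0 ≤ resid k ϖ γ⋆ (thetaErr X Zs αs βs (s t)) := (opNorm_nonneg _).trans e5
  set ω := resid k ϖ γ⋆ (thetaErr X Zs αs βs (s t))
  set δ := procrustesDist (s t).Z Zs
  have hδ0 : 0 ≤ δ := procrustesDist_nonneg _ _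
  have hy0 := opNorm_nonneg (s t).Z
  have hy1 := opNorm_nonneg (s (t + 1)).Z
  -- All bounds below are scaled by `√η`, so that the quadratic hypotheses become linear ones in the
  -- residual and the distance.
  obtain ⟨r, hr0, hr2⟩ : ∃ r : ℝ, 0 ≤ r ∧ η = r ^ 2 :=
    ⟨√η, Real.sqrt_nonneg _, (Real.sq_sqrt H.eta_pos.le).symm⟩
  have hr1 : r ≤ 1 / 32 := by
    rw [← sq_le_sq₀ hr0 (by norm_num), ← hr2]; have := H.eta_le; norm_num at *; linarith
  have f1 : r * ω ≤ 1 / 20 * z⋆ ^ 2 := by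
    rw [← sq_le_sq₀ (by positivity) (by positivity), mul_pow, ← hr2]
    refine hω.trans (le_of_eq ?_); ring
  have f2 : r * δ ≤ 1 / 10 * z⋆ := by
    rw [← sq_le_sq₀ (by positivity) (by positivity), mul_pow, ← hr2]
    refine hδ.trans (le_of_eq ?_); ring
  have f3 : r * opNorm (s t).Z ≤ 1 / 7 * z⋆ := by
    have := mul_le_mul_of_nonneg_left e2 hr0
    nlinarith
  have f4 : r * (4 * (η / opNorm (s 0).Z ^ 2) * (opNorm (s t).Z * ω)) ≤ 1 / 500 * z⋆ := by
    have g1 : η / opNorm (s 0).Z ^ 2 ≤ 2 * η / z⋆ ^ 2 := by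
      rw [div_le_div_iff₀ hq (by positivity)]
      nlinarith [H.eta_pos]
    have g2 : r * (4 * (η / opNorm (s 0).Z ^ 2) * (opNorm (s t).Z * ω))
        ≤ r * (4 * (2 * η / z⋆ ^ 2) * (opNorm (s t).Z * ω)) := by gcongr
    refine g2.trans ?_
    have g3 : r * (4 * (2 * η / z⋆ ^ 2) * (opNorm (s t).Z * ω))
        = 8 * r / z⋆ ^ 2 * ((r * opNorm (s t).Z) * (r * ω)) := by rw [hr2]; ring
    have g4 : (r * opNorm (s t).Z) * (r * ω) ≤ (1 / 7 * z⋆) * (1 / 20 * z⋆ ^ 2) :=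
      mul_le_mul f3 f1 (by positivity) (by positivity)
    rw [g3]
    calc 8 * r / z⋆ ^ 2 * ((r * opNorm (s t).Z) * (r * ω))
        ≤ 8 * (1 / 32) / z⋆ ^ 2 * ((1 / 7 * z⋆) * (1 / 20 * z⋆ ^ 2)) := by gcongr
      _ = 1 / 560 * z⋆ := by field_simp; norm_num
      _ ≤ _ := by linarith
  have f5 : r * opNorm (s (t + 1)).Z ≤ 1 / 7 * z⋆ := by
    have := mul_le_mul_of_nonneg_left (e3.trans (add_le_add_right (e4.trans e1) _)) hr0
    nlinarith
  constructor
  · have : r * (opNorm (s (t + 1)).Z + opNorm (s t).Z) ≤ 2 / 7 * z⋆ := by linarith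
    have := pow_le_pow_left₀ (by positivity) this 2
    rw [mul_pow, ← hr2] at this
    nlinarith
  · have : 4 * η * opNorm (A - sigmoidMat ((s t).theta X)) ≤ 4 * η * ω :=
      mul_le_mul_of_nonneg_left e5 (by have := H.eta_pos; positivity)
    have h2 : 4 * η * ω = 4 * r * (r * ω) := by rw [hr2]; ring
    have h3 : 4 * r * (r * ω) ≤ 4 * (1 / 32) * (1 / 20 * z⋆ ^ 2) := by gcongr
    nlinarith

/-- The basin of attraction. -/
def InBasin (M₁ : ℝ) (X : Matrix (Fin n) (Fin n) ℝ) (Zs : Matrix (Fin n) (Fin k) ℝ)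
    (αs : Fin n → ℝ) (βs : ℝ) (x : Iterate n k) : Prop :=
  lyap X Zs αs βs x ≤ 4 / 10 ^ 10 * contr M₁ Zs ^ 2 * opNorm Zs ^ 4

/-- The square root of the basin threshold. That threshold is twice the constant `2 / 10^10` of the
initialization, because `lyap` is at most twice `err`. -/
lemma InBasin.dist_le (H : Regime M₁ η ϖ A X Θs Zs αs βs) (hx : InBasin M₁ X Zs αs βs x) :
    procrustesDist x.Z Zs ≤ 2 / 10 ^ 5 * contr M₁ Zs * z⋆ := by
  have hz := H.opNorm_pos
  have hc := H.contr_pos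
  have h1 : z⋆ ^ 2 * procrustesDist x.Z Zs ^ 2 ≤ z⋆ ^ 2 * (2 / 10 ^ 5 * contr M₁ Zs * z⋆) ^ 2 := by
    unfold InBasin lyap at hx
    nlinarith [sq_nonneg (alphaErr αs x), sq_nonneg (betaErr X βs x)]
  have h2 := le_of_mul_le_mul_left h1 (by positivity)
  exact (sq_le_sq₀ (procrustesDist_nonneg _ _) (by positivity)).mp h2

lemma InBasin.dist_le' (H : Regime M₁ η ϖ A X Θs Zs αs βs) (hx : InBasin M₁ X Zs αs βs x) :
    procrustesDist x.Z Zs ≤ 2 / 10 ^ 5 * z⋆ := by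
  refine (hx.dist_le H).trans ?_
  have hz := H.opNorm_pos
  have hc := H.contr_le_one
  nlinarith

/-- `thetaErr` in terms of the distance of states. -/
lemma thetaErr_sq_le_of_opNorm (x : Iterate n k) {R : Matrix (Fin k) (Fin k) ℝ}
    (hR : R ∈ Matrix.orthogonalGroup (Fin k) ℝ) (h : opNorm x.Z ≤ 101 / 100 * z⋆) :
    thetaErr X Zs αs βs x ^ 2 ≤ 13 * stateDist z⋆ X x (Iterate.mk (Zs * R) αs βs) := by
  have h1 := frobNorm_theta_sub_theta_sq_le X x (Iterate.mk (Zs * R) αs βs)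
  rw [star_theta hR] at h1
  simp only [opNorm_mul_orthogonal Zs hR] at h1
  unfold thetaErr stateDist
  refine h1.trans ?_
  have h2 : (opNorm x.Z + z⋆) ^ 2 ≤ (201 / 100 * z⋆) ^ 2 :=
    pow_le_pow_left₀ (add_nonneg (opNorm_nonneg _) (opNorm_nonneg _)) (by linarith) 2
  have h3 := mul_le_mul_of_nonneg_right h2 (sq_nonneg (frobNorm (x.Z - Zs * R)))
  have h4 : 0 ≤ z⋆ ^ 2 * frobNorm (x.Z - Zs * R) ^ 2 := by positivity
  nlinarith [sq_nonneg (frobNorm (vecMulVec (x.α - αs) fun _ : Fin n => (1 : ℝ))),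
    sq_nonneg (frobNorm ((x.β - βs) • X))]

lemma InBasin.opNorm_le (H : Regime M₁ η ϖ A X Θs Zs αs βs) (hx : InBasin M₁ X Zs αs βs x) :
    opNorm x.Z ≤ 101 / 100 * z⋆ := by
  have := hx.dist_le' H
  have := opNorm_iterate_le (Zs := Zs) x
  have := H.opNorm_pos
  linarith

lemma InBasin.thetaErr_sq_le (H : Regime M₁ η ϖ A X Θs Zs αs βs) (hx : InBasin M₁ X Zs αs βs x) :
    thetaErr X Zs αs βs x ^ 2 ≤ 13 * lyap X Zs αs βs x := by
  obtain ⟨R, hR, hd, -⟩ := exists_procrustes_alignment x.Z Zs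
  rw [lyap_eq_stateDist x hd]
  exact thetaErr_sq_le_of_opNorm x hR (hx.opNorm_le H)

lemma InBasin.gramErr_sq_le (H : Regime M₁ η ϖ A X Θs Zs αs βs) (hx : InBasin M₁ X Zs αs βs x) :
    gramErr Zs x ^ 2 ≤ 13 * lyap X Zs αs βs x := by
  obtain ⟨R, hR, hd, -⟩ := exists_procrustes_alignment x.Z Zs
  have h1 := frobNorm_gram_sub_gram_le x.Z (Zs * R)
  rw [gram_mul_orthogonal Zs hR, opNorm_mul_orthogonal Zs hR, ← hd] at h1
  have h2 := hx.opNorm_le H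
  have hz := H.opNorm_pos
  have hd0 := procrustesDist_nonneg x.Z Zs
  have h3 : gramErr Zs x ≤ 3 * z⋆ * procrustesDist x.Z Zs :=
    h1.trans (mul_le_mul_of_nonneg_right (by linarith) hd0)
  have h4 := pow_le_pow_left₀ (gramErr_nonneg _ _) h3 2
  unfold lyap
  nlinarith [sq_nonneg (alphaErr αs x), sq_nonneg (betaErr X βs x),
    sq_nonneg (z⋆ * procrustesDist x.Z Zs)]

/-- In the basin of attraction the step sizes are small enough. -/
lemma InBasin.step_small (H : Regime M₁ η ϖ A X Θs Zs αs βs) (hs : IsPGD M₁ η A X s) (t : ℕ)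
    (h0 : z⋆ ^ 2 ≤ 2 * opNorm (s 0).Z ^ 2) (hx : InBasin M₁ X Zs αs βs (s t)) :
    η * (opNorm (s (t + 1)).Z + opNorm (s t).Z) ^ 2 ≤ 1 / 4 * z⋆ ^ 2 ∧
      4 * η * opNorm (A - sigmoidMat ((s t).theta X)) ≤ z⋆ ^ 2 := by
  have hz := H.opNorm_pos
  have hη := H.eta_pos
  have hη1 := H.eta_le
  have hc := H.contr_le_one
  have hc0 := H.contr_pos
  refine H.step_small hs t h0 ?_ ?_
  · have h1 := mul_le_mul_of_nonneg_left (H.resid_sq_le (thetaErr X Zs αs βs (s t))) hη.le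
    have h2 := H.eta_noise_le
    have h3 := hx.thetaErr_sq_le H
    have h4 : lyap X Zs αs βs (s t) ≤ 4 / 10 ^ 10 * z⋆ ^ 4 := by
      refine le_trans hx ?_
      have : contr M₁ Zs ^ 2 ≤ 1 := pow_le_one₀ hc0.le hc
      have hz4 : 0 ≤ z⋆ ^ 4 := by positivity
      nlinarith
    have hz4 : 0 ≤ z⋆ ^ 4 := by positivity
    have h5 : η * thetaErr X Zs αs βs (s t) ^ 2 ≤ 1 * (13 * (4 / 10 ^ 10 * z⋆ ^ 4)) :=
      mul_le_mul (by linarith) (by linarith) (sq_nonneg _) zero_le_one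
    linarith
  · have h1 := pow_le_pow_left₀ (procrustesDist_nonneg _ _) (hx.dist_le' H) 2
    have h2 : η * procrustesDist (s t).Z Zs ^ 2 ≤ 1 * (2 / 10 ^ 5 * z⋆) ^ 2 :=
      mul_le_mul (by linarith) h1 (sq_nonneg _) zero_le_one
    nlinarith

/-- States of small loss have moderate error. -/
lemma thetaErr_sq_le_of_excess (H : Regime M₁ η ϖ A X Θs Zs αs βs) (hf : x.Feasible M₁ X)
    (hx : excess A X Zs αs βs x ≤ 30 * N⋆) :
    thetaErr X Zs αs βs x ^ 2 ≤ 992 * (Real.exp M₁ * N⋆) := by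
  have h := (H.energy_lower hf).trans hx
  have hE : Real.exp (-M₁) * Real.exp M₁ = 1 := by rw [← Real.exp_add]; simp
  have := mul_le_mul_of_nonneg_left h (Real.exp_pos M₁).le
  nlinarith

/-- A feasible state of small loss has reached the limiting accuracy without being known to lie in
the basin. The constant is `4 · 32 · (30 + 1)`, just below the 4000 of the final error floor. -/
lemma lyap_le_of_excess (H : Regime M₁ η ϖ A X Θs Zs αs βs) (hf : x.Feasible M₁ X)
    (hx : excess A X Zs αs βs x ≤ 30 * N⋆) :
    lyap X Zs αs βs x ≤ 3968 * (κ⋆ ^ 2 * Real.exp M₁ * N⋆) := by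
  have h1 := H.thetaErr_sq_le_of_excess hf hx
  have h2 := H.lyap_le hf
  have := mul_le_mul_of_nonneg_left h1 (show 0 ≤ 4 * κ⋆ ^ 2 by positivity)
  linarith

/-- The loss decreases from a feasible state of small loss. -/
lemma excess_succ_le (H : Regime M₁ η ϖ A X Θs Zs αs βs) (hs : IsPGD M₁ η A X s) (t : ℕ)
    (h0 : z⋆ ^ 2 ≤ 2 * opNorm (s 0).Z ^ 2) (hf : (s t).Feasible M₁ X)
    (hx : excess A X Zs αs βs (s t) ≤ 30 * N⋆) :
    excess A X Zs αs βs (s (t + 1)) ≤ 30 * N⋆ := by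
  have hz := H.opNorm_pos
  have hη := H.eta_pos
  have hη1 := H.eta_le
  have hq : 0 < opNorm (s 0).Z :=
    lt_of_le_of_ne (opNorm_nonneg _) fun h => by rw [← h] at h0; nlinarith
  have h1 := H.thetaErr_sq_le_of_excess hf hx
  have h2 := H.lyap_le_of_excess hf hx
  have h3 := H.eta_exp_noise_le
  -- The signal strength condition is needed here. It makes `η` times the error of a small-loss
  -- state small against `z⋆⁴`, so the smoothness inequality still applies outside the basin.
  have h4 : η * (κ⋆ ^ 2 * Real.exp M₁ * N⋆) ≤ 1 / 10 ^ 6 * z⋆ ^ 4 := by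
    have := H.signal; linarith
  have hsm := H.step_small hs t h0
    (by
      have e1 := mul_le_mul_of_nonneg_left (H.resid_sq_le (thetaErr X Zs αs βs (s t))) hη.le
      have e2 := H.eta_noise_le
      have e3 := mul_le_mul_of_nonneg_left h1 hη.le
      have : 0 ≤ z⋆ ^ 4 := by positivity
      linarith)
    (by
      have e1 : z⋆ ^ 2 * procrustesDist (s t).Z Zs ^ 2 ≤ lyap X Zs αs βs (s t) := by
        unfold lyap
        nlinarith [sq_nonneg (alphaErr αs (s t)), sq_nonneg (betaErr X βs (s t))]
      have e2 := mul_le_mul_of_nonneg_left (e1.trans h2) hη.le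
      have e3 : z⋆ ^ 2 * (η * procrustesDist (s t).Z Zs ^ 2) ≤ z⋆ ^ 2 * (1 / 100 * z⋆ ^ 2) := by
        have : 0 ≤ z⋆ ^ 4 := by positivity
        nlinarith
      exact le_of_mul_le_mul_left e3 (by positivity))
  have := hs.negLogLik_succ_le H.hn hη (by linarith) t hf h0 hq (H.symmW _) hsm.1 hsm.2
  unfold excess at *
  linarith

/-- Bounds on the initial state. -/
lemma InBasin.init (H : Regime M₁ η ϖ A X Θs Zs αs βs) (hx : InBasin M₁ X Zs αs βs x) :
    0 < opNorm x.Z ∧ z⋆ ^ 2 ≤ 2 * opNorm x.Z ^ 2 ∧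
      |z⋆ ^ 2 / opNorm x.Z ^ 2 - 1| ≤ 6 / 10 ^ 5 * contr M₁ Zs := by
  have hz := H.opNorm_pos
  have hc := H.contr_le_one
  have hc0 := H.contr_pos
  have h1 := hx.dist_le H
  have h2 := opNorm_iterate_le (Zs := Zs) x
  have h3 := opNorm_le_iterate (Zs := Zs) x
  set q := opNorm x.Z
  set c := contr M₁ Zs
  have h4 : q ≤ z⋆ + 2 / 10 ^ 5 * c * z⋆ := by linarith
  have h5 : z⋆ - 2 / 10 ^ 5 * c * z⋆ ≤ q := by linarith
  have h6 : c * z⋆ ≤ z⋆ := mul_le_of_le_one_left hz.le hc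
  have hq : 0 < q := by linarith
  have hcz : 0 < c * z⋆ := by positivity
  refine ⟨hq, by nlinarith, ?_⟩
  have e : z⋆ ^ 2 / q ^ 2 - 1 = (z⋆ - q) * (z⋆ + q) / q ^ 2 := by field_simp; ring
  rw [e, abs_div, abs_of_pos (show 0 < q ^ 2 by positivity), div_le_iff₀ (by positivity), abs_mul,
    abs_of_pos (show 0 < z⋆ + q by positivity)]
  have h7 : |z⋆ - q| ≤ 2 / 10 ^ 5 * c * z⋆ := abs_le.mpr ⟨by linarith, by linarith⟩
  have h8 : z⋆ ≤ 1001 / 1000 * q := by linarith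
  calc |z⋆ - q| * (z⋆ + q) ≤ (2 / 10 ^ 5 * c * (1001 / 1000 * q)) * (1001 / 1000 * q + q) := by
        refine mul_le_mul (h7.trans ?_) (by linarith) (by positivity) (by positivity)
        gcongr
    _ = (2 / 10 ^ 5 * (1001 / 1000) * (1001 / 1000 + 1)) * (c * q ^ 2) := by ring
    _ ≤ 6 / 10 ^ 5 * c * q ^ 2 := by
        have : 0 ≤ c * q ^ 2 := by positivity
        norm_num
        nlinarith

end Recursion

end Regime

end LatentSpace

namespace LatentSpace

/-! ### Contraction in the basin, the first step, and the dichotomy between decreasing error and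
small loss -/

namespace Regime

section Induction

variable {n k : ℕ} {M₁ η ϖ : ℝ} {A X Θs : Matrix (Fin n) (Fin n) ℝ} {Zs : Matrix (Fin n) (Fin k) ℝ}
  {αs : Fin n → ℝ} {βs : ℝ} {x : Iterate n k} {s : ℕ → Iterate n k}

local notation "z⋆" => opNorm Zs
local notation "κ⋆" => condNum Zs
local notation "γ⋆" => frobNorm (Θs - LatentSpace.theta X αs βs (Zs * Zsᵀ))
local notation "N⋆" => noiseLevel k M₁ ϖ (frobNorm (Θs - LatentSpace.theta X αs βs (Zs * Zsᵀ)))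

/-- This absorbs the nonconvex term. In the basin the noise, `δ²` and the error in Θ are all small
multiples of `c z²`, so they cost a fraction of the curvature gain `c L`. The low rank remainder may
be large, so Young's inequality charges it to `N`. -/
lemma quadratic_term_le {ϖ γ τ δ N c z L : ℝ} (hc0 : 0 < c) (hc : c ≤ 1)
    (hϖ : ϖ ≤ c * z ^ 2 / 1000) (hδ0 : 0 ≤ δ) (hδ : δ ≤ 2 / 10 ^ 5 * c * z)
    (hτ : τ ≤ 1 / 10 ^ 4 * (c * z ^ 2)) (hγ : γ ^ 2 ≤ 4 * N) (hL : z ^ 2 * δ ^ 2 ≤ L) :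
    (ϖ / 2 + γ / 4 + τ / 4) * δ ^ 2 ≤ N / 16 + 1 / 1900 * (c * L) := by
  have e1 : γ / 4 * δ ^ 2 ≤ γ ^ 2 / 64 + δ ^ 2 * δ ^ 2 := by
    linarith [sq_nonneg (γ / 8 - δ ^ 2)]
  have h0 : 0 ≤ c * z ^ 2 := by positivity
  have e2 : δ ^ 2 ≤ 1 / 10 ^ 8 * (c * z ^ 2) := by
    have h1 := pow_le_pow_left₀ hδ0 hδ 2
    have h2 : c * (c * z ^ 2) ≤ c * z ^ 2 := mul_le_of_le_one_left h0 hc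
    linarith
  have e3 : ϖ / 2 + δ ^ 2 + τ / 4 ≤ 1 / 1900 * (c * z ^ 2) := by linarith
  have e4 := mul_le_mul_of_nonneg_right e3 (sq_nonneg δ)
  have e5 := mul_le_mul_of_nonneg_left hL hc0.le
  linarith

/-- `E'` is the distance of the new state to the old alignment, which dominates `L'`. Replacing it
gives `L'(1 + 7y/512) ≤ L(1 + y/512) + 11ηN/5` with `y = ηc`, and `1 + y/512 ≤ (1 - y/128)(1 +
7y/512)`. -/
lemma contraction_of_le {η c L L' E' N : ℝ} (hη : 0 < η) (hη1 : η ≤ 1 / 1024) (hc0 : 0 < c)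
    (hc : c ≤ 1) (hL : 0 ≤ L) (hN : 0 ≤ N) (hle : L' ≤ E')
    (h : 1 / 128 * c * L' - N
      ≤ 1 / (2 * η) * (L - E') + N / 10 + 1 / 1024 * c * (L + E')) :
    L' ≤ (1 - η * c / 128) * L + 4 * η * N := by
  have e2 := mul_le_mul_of_nonneg_left h (show 0 ≤ 2 * η by positivity)
  have e3 : 2 * η * (1 / (2 * η) * (L - E') + N / 10 + 1 / 1024 * c * (L + E'))
      = (L - E') + η * N / 5 + η * c * (L + E') / 512 := by field_simp; ring
  rw [e3] at e2
  have hy0 : 0 ≤ η * c := by positivity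
  have hy1 : η * c ≤ 1 := mul_le_one₀ (by linarith) hc0.le hc
  have hηN : 0 ≤ η * N := by positivity
  have e1 : 2 * η * (1 / 128 * c * L' - N) = η * c * L' / 64 - 2 * (η * N) := by ring
  rw [e1] at e2
  generalize η * c = y at *
  have e8 : 4 * η * N = 4 * (η * N) := by ring
  rw [e8]
  generalize η * N = ν at *
  have e0 := mul_nonneg (sub_nonneg.mpr hle) (show 0 ≤ 1 - y / 512 by linarith)
  have e4 : L' * (1 + 7 / 512 * y) ≤ L * (1 + y / 512) + 11 / 5 * ν := by linarith
  have e5 : L * (1 + y / 512) ≤ L * ((1 - y / 128) * (1 + 7 / 512 * y)) := by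
    refine mul_le_mul_of_nonneg_left ?_ hL
    nlinarith
  have e6 : 0 ≤ y * ν := by positivity
  have e7 : L' * (1 + 7 / 512 * y) ≤ ((1 - y / 128) * L + 4 * ν) * (1 + 7 / 512 * y) := by
    linarith
  exact le_of_mul_le_mul_right e7 (by positivity)

/-- If the error grows, the difference of distances is negative and its coefficient `1 / (2η)` beats
the perturbations. The excess `h` is then at most `N/10 + cL/512`, while `cL < cL' ≤ 128(h + N)`;
together these bound `h` by a multiple of `N`. -/
lemma excess_le_of_lt {η c L L' E' N h : ℝ} (hη : 0 < η) (hη1 : η ≤ 1 / 1024) (hc0 : 0 < c)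
    (hc : c ≤ 1) (hN : 0 ≤ N) (hle : L' ≤ E') (hlt : L < L') (h1 : 1 / 128 * c * L' - N ≤ h)
    (h2 : h ≤ 1 / (2 * η) * (L - E') + N / 10 + 1 / 1024 * c * (L + E')) : h ≤ 30 * N := by
  have hp : 512 ≤ 1 / (2 * η) := by
    rw [le_div_iff₀ (by positivity)]; linarith
  have e1 : (1 / (2 * η) - c / 1024) * (L - E') ≤ 0 :=
    mul_nonpos_of_nonneg_of_nonpos (by linarith) (by linarith)
  have e2 := mul_le_mul_of_nonneg_left hlt.le hc0.le
  have e3 : h ≤ N / 10 + 1 / 512 * (c * L) := by linarith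
  linarith

/-- Without weak noise the nonconvex term cannot be charged to curvature, but `4ηw ≤ z²` bounds it
by half of `L` after multiplication by `2η`. The distance can thus grow only by a constant factor in
one step. -/
lemma first_step_dist_le {η N L E' w δ z : ℝ} (hη : 0 < η) (hη1 : η ≤ 1 / 1024) (hN : 0 ≤ N)
    (hL : 0 ≤ L) (hE : 0 ≤ E') (hδL : z ^ 2 * δ ^ 2 ≤ L) (hw : 4 * η * w ≤ z ^ 2)
    (h : -N ≤ 1 / (2 * η) * (L - E') + w * δ * δ + 1 / 10 ^ 4 * (N + 5 / 2 * L + E')) :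
    E' ≤ 8 / 5 * L + 3 * (η * N) := by
  have k2 := mul_le_mul_of_nonneg_left h (show 0 ≤ 2 * η by positivity)
  have k3 : 2 * η * (1 / (2 * η) * (L - E') + w * δ * δ + 1 / 10 ^ 4 * (N + 5 / 2 * L + E'))
      = (L - E') + 1 / 2 * (4 * η * w) * δ ^ 2 + 2 / 10 ^ 4 * η * (N + 5 / 2 * L + E') := by
    field_simp; ring
  rw [k3] at k2
  have k4 := mul_le_mul_of_nonneg_right hw (sq_nonneg δ)
  have k5 : η * (N + 5 / 2 * L + E') ≤ η * N + 1 / 1024 * (5 / 2 * L + E') := by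
    have : η * (5 / 2 * L + E') ≤ 1 / 1024 * (5 / 2 * L + E') := by gcongr
    linarith
  have : 0 ≤ η * N := by positivity
  linarith

/-- The error made by using `‖Z⁰‖` instead of `‖Z⋆‖` in the step size. -/
lemma init_term_le (H : Regime M₁ η ϖ A X Θs Zs αs βs) (hb : InBasin M₁ X Zs αs βs (s 0))
    {t : ℕ} (hx : InBasin M₁ X Zs αs βs (s t)) (R : Matrix (Fin k) (Fin k) ℝ) :
    2 * (z⋆ ^ 2 / opNorm (s 0).Z ^ 2 - 1)
        * frobInner ((A - sigmoidMat ((s t).theta X)) * (s t).Z) ((s (t + 1)).Z - Zs * R)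
      ≤ 1 / 10 ^ 4 * contr M₁ Zs * (N⋆ + 5 / 2 * lyap X Zs αs βs (s t)
        + stateDist z⋆ X (s (t + 1)) (Iterate.mk (Zs * R) αs βs)) := by
  have hz := H.opNorm_pos
  have hc0 := H.contr_pos
  have h1 := (hb.init H).2.2
  have h2 := hx.opNorm_le H
  have h3 := H.frobNorm_resid_mul_le (s t)
  have h4 := abs_frobInner_le ((A - sigmoidMat ((s t).theta X)) * (s t).Z)
    ((s (t + 1)).Z - Zs * R)
  have h5 := H.resid_sq_le (thetaErr X Zs αs βs (s t))
  have h6 := hx.thetaErr_sq_le H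
  have hω0 : 0 ≤ resid k ϖ γ⋆ (thetaErr X Zs αs βs (s t)) :=
    (opNorm_nonneg _).trans (H.opNorm_resid_le (s t))
  set ω := resid k ϖ γ⋆ (thetaErr X Zs αs βs (s t))
  set D := frobNorm ((s (t + 1)).Z - Zs * R) with hD
  have hD0 : 0 ≤ D := frobNorm_nonneg _
  have hE : z⋆ ^ 2 * D ^ 2 ≤ stateDist z⋆ X (s (t + 1)) (Iterate.mk (Zs * R) αs βs) := by
    unfold stateDist
    have := sq_nonneg (frobNorm (vecMulVec ((s (t + 1)).α - αs) fun _ : Fin n => (1 : ℝ)))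
    have := sq_nonneg (frobNorm (((s (t + 1)).β - βs) • X))
    linarith
  set I := frobInner ((A - sigmoidMat ((s t).theta X)) * (s t).Z) ((s (t + 1)).Z - Zs * R)
  have h7 : |I| ≤ 101 / 100 * (ω * (z⋆ * D)) := by
    refine h4.trans ?_
    calc _ ≤ (opNorm (s t).Z * ω) * D := mul_le_mul_of_nonneg_right h3 hD0
      _ ≤ (101 / 100 * z⋆ * ω) * D := by gcongr
      _ = _ := by ring
  have h8 : ω * (z⋆ * D) ≤ (ω ^ 2 + z⋆ ^ 2 * D ^ 2) / 2 := by
    nlinarith [sq_nonneg (ω - z⋆ * D)]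
  have h9 : ω ^ 2 ≤ N⋆ + 5 / 2 * lyap X Zs αs βs (s t) := by
    have := lyap_nonneg (X := X) (Zs := Zs) (αs := αs) (βs := βs) (s t)
    linarith
  have h10 : |I| ≤ 101 / 200 * (N⋆ + 5 / 2 * lyap X Zs αs βs (s t)
      + stateDist z⋆ X (s (t + 1)) (Iterate.mk (Zs * R) αs βs)) := by linarith
  have hB := (abs_nonneg I).trans h10
  calc _ ≤ |2 * (z⋆ ^ 2 / opNorm (s 0).Z ^ 2 - 1) * I| := le_abs_self _
    _ = 2 * (|z⋆ ^ 2 / opNorm (s 0).Z ^ 2 - 1| * |I|) := by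
        rw [abs_mul, abs_mul, abs_of_pos (by norm_num : (0 : ℝ) < 2)]; ring
    _ ≤ 2 * ((6 / 10 ^ 5 * contr M₁ Zs) * (101 / 200 * (N⋆ + 5 / 2 * lyap X Zs αs βs (s t)
      + stateDist z⋆ X (s (t + 1)) (Iterate.mk (Zs * R) αs βs)))) := by
        gcongr
    _ ≤ _ := by
        have := mul_nonneg hc0.le hB
        nlinarith

/-- One step in the basin of attraction under weak noise: the error contracts, or the loss is
small. -/
lemma step_of_noise_le (H : Regime M₁ η ϖ A X Θs Zs αs βs) (hs : IsPGD M₁ η A X s)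
    (hϖ : ϖ ≤ contr M₁ Zs * z⋆ ^ 2 / 1000) (hb : InBasin M₁ X Zs αs βs (s 0))
    {t : ℕ} (hx : InBasin M₁ X Zs αs βs (s t)) :
    lyap X Zs αs βs (s (t + 1))
        ≤ (1 - η * contr M₁ Zs / 128) * lyap X Zs αs βs (s t) + 4 * η * N⋆ ∧
      (lyap X Zs αs βs (s t) < lyap X Zs αs βs (s (t + 1)) →
        excess A X Zs αs βs (s (t + 1)) ≤ 30 * N⋆) := by
  obtain ⟨R, hR, hd, -⟩ := exists_procrustes_alignment (s t).Z Zs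
  have hz := H.opNorm_pos
  have hη := H.eta_pos
  have hη1 := H.eta_le
  have hc := H.contr_le_one
  have hc0 := H.contr_pos
  have hN0 : 0 ≤ N⋆ := noiseLevel_nonneg _ _ _
  have hi := hb.init H
  have hsm := hx.step_small H hs t hi.2.1
  have hmain := hs.negLogLik_sub_le H.hn hη (by linarith) t (H.feasible R hR) hi.1 (H.symmW _)
    hsm.1 hsm.2
  have hterm := H.init_term_le hb hx R
  have hgram := (abs_le.mp (H.abs_inner_gram_le (s t) ((s t).Z - Zs * R))).2
  have hf := hs.feasible H.hM t
  have hlow := H.energy_lower hf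
  have hll := H.lyap_le hf
  have hτ := hx.thetaErr_sq_le H
  have hle := lyap_le_stateDist (X := X) (αs := αs) (βs := βs) (s (t + 1)) (Zs := Zs) hR
  rw [star_theta hR, ← lyap_eq_stateDist (s t) hd] at hmain
  change excess A X Zs αs βs (s (t + 1)) ≤ _ at hmain
  change _ ≤ excess A X Zs αs βs (s (t + 1)) at hlow
  simp only at hmain hterm
  rw [← hd] at hgram
  set c := contr M₁ Zs with hcdef
  set δ := procrustesDist (s t).Z Zs with hδ
  have hδ0 : 0 ≤ δ := procrustesDist_nonneg _ _
  have hδle : δ ≤ 2 / 10 ^ 5 * c * z⋆ := hx.dist_le H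
  have hL0 := lyap_nonneg (X := X) (Zs := Zs) (αs := αs) (βs := βs) (s t)
  have hL0' := lyap_nonneg (X := X) (Zs := Zs) (αs := αs) (βs := βs) (s (t + 1))
  have hLδ : z⋆ ^ 2 * δ ^ 2 ≤ lyap X Zs αs βs (s t) := by
    unfold lyap
    nlinarith [sq_nonneg (alphaErr αs (s t)), sq_nonneg (betaErr X βs (s t))]
  have hLB : lyap X Zs αs βs (s t) ≤ 4 / 10 ^ 10 * c ^ 2 * z⋆ ^ 4 := hx
  have hγN : γ⋆ ^ 2 ≤ 4 * N⋆ := by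
    unfold noiseLevel
    have : 0 ≤ 48 * Real.exp M₁ * ϖ ^ 2 * k := by positivity
    linarith
  set L := lyap X Zs αs βs (s t)
  set L' := lyap X Zs αs βs (s (t + 1))
  set E' := stateDist z⋆ X (s (t + 1)) (Iterate.mk (Zs * R) αs βs)
  set N := N⋆
  set γ := γ⋆
  set τ := thetaErr X Zs αs βs (s t)
  have hτ0 : 0 ≤ τ := thetaErr_nonneg _ _ _ _ _
  have hτle : τ ≤ 1 / 10 ^ 4 * (c * z⋆ ^ 2) := by
    rw [← sq_le_sq₀ hτ0 (by positivity)]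
    have : 0 ≤ c ^ 2 * z⋆ ^ 4 := by positivity
    linarith
  have hq := quadratic_term_le hc0 hc hϖ hδ0 hδle hτle hγN hLδ
  have hcN : c * N ≤ N := mul_le_of_le_one_left hN0 hc
  have hkey : excess A X Zs αs βs (s (t + 1))
      ≤ 1 / (2 * η) * (L - E') + N / 10 + 1 / 1024 * c * (L + E') := by
    have hcL : 0 ≤ c * L := by positivity
    have hcE : 0 ≤ c * E' := mul_nonneg hc0.le (hL0'.trans hle)
    linarith
  -- Strong convexity in terms of the error metric: `e^{-M₁} = cκ²` and `L' ≤ 4κ²τ²` turn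
  -- `e^{-M₁}τ²/32` into `cL'/128`, where τ is the error in Θ of the new state.
  have hlow' : 1 / 128 * c * L' - N ≤ excess A X Zs αs βs (s (t + 1)) := by
    have hcon := H.contr_mul
    have e1 : Real.exp (-M₁) = c * κ⋆ ^ 2 := by
      rw [hcdef, contr, div_mul_cancel₀]
      exact (zero_lt_one.trans_le H.one_le_sq_condNum).ne'
    rw [e1] at hlow
    have := mul_le_mul_of_nonneg_left hll hc0.le
    linarith
  exact ⟨contraction_of_le hη hη1 hc0 hc hL0 hN0 hle (hlow'.trans hkey),
    fun hlt => excess_le_of_lt hη hη1 hc0 hc hN0 hle hlt hlow' hkey⟩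

/-- The first step, from an initial state of error below the noise level. -/
lemma step_of_lyap_le_noise (H : Regime M₁ η ϖ A X Θs Zs αs βs) (hs : IsPGD M₁ η A X s)
    (hb : InBasin M₁ X Zs αs βs (s 0)) (h0 : lyap X Zs αs βs (s 0) ≤ N⋆) :
    excess A X Zs αs βs (s 1) ≤ 30 * N⋆ := by
  obtain ⟨R, hR, hd, -⟩ := exists_procrustes_alignment (s 0).Z Zs
  have hz := H.opNorm_pos
  have hη := H.eta_pos
  have hη1 := H.eta_le
  have hc := H.contr_le_one
  have hc0 := H.contr_pos
  have hN0 : 0 ≤ N⋆ := noiseLevel_nonneg _ _ _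
  have hi := hb.init H
  have hsm := hb.step_small H hs 0 hi.2.1
  have hmain := hs.negLogLik_sub_le H.hn hη (by linarith) 0 (H.feasible R hR) hi.1 (H.symmW _)
    hsm.1 hsm.2
  have hterm := H.init_term_le hb hb R
  have hgram := (abs_le.mp (abs_frobInner_mul_transpose_le (A - sigmoidMat ((s 0).theta X))
    ((s 0).Z - Zs * R) ((s 0).Z - Zs * R))).2
  have hf := hs.feasible H.hM 0
  have hlow := H.energy_lower hf
  have hup := H.energy_upper hf
  rw [star_theta hR, ← lyap_eq_stateDist (s 0) hd] at hmain
  simp only [zero_add] at hmain hterm hlow hup hf hsm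
  change excess A X Zs αs βs (s 1) ≤ _ at hmain
  change _ ≤ excess A X Zs αs βs (s 1) at hlow
  change excess A X Zs αs βs (s 1) ≤ _ at hup
  rw [← hd] at hgram
  have hL0 := lyap_nonneg (X := X) (Zs := Zs) (αs := αs) (βs := βs) (s 0)
  have hδL : z⋆ ^ 2 * procrustesDist (s 0).Z Zs ^ 2 ≤ lyap X Zs αs βs (s 0) := by
    unfold lyap
    nlinarith [sq_nonneg (alphaErr αs (s 0)), sq_nonneg (betaErr X βs (s 0))]
  have hE0 := stateDist_nonneg z⋆ X (s 1) (Iterate.mk (Zs * R) αs βs)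
  have hD : z⋆ ^ 2 * frobNorm ((s 1).Z - Zs * R) ^ 2
      ≤ stateDist z⋆ X (s 1) (Iterate.mk (Zs * R) αs βs) := by
    unfold stateDist
    have := sq_nonneg (frobNorm (vecMulVec ((s 1).α - αs) fun _ : Fin n => (1 : ℝ)))
    have := sq_nonneg (frobNorm (((s 1).β - βs) • X))
    linarith
  have hLB : lyap X Zs αs βs (s 0) ≤ 4 / 10 ^ 10 * z⋆ ^ 4 := by
    refine le_trans hb ?_
    have : contr M₁ Zs ^ 2 ≤ 1 := pow_le_one₀ hc0.le hc
    have hz4 : 0 ≤ z⋆ ^ 4 := by positivity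
    nlinarith
  have hlow0 : -N⋆ ≤ excess A X Zs αs βs (s 1) := by
    have : 0 ≤ Real.exp (-M₁) / 32 * thetaErr X Zs αs βs (s 1) ^ 2 :=
      mul_nonneg (by positivity) (sq_nonneg _)
    linarith
  have hηN := H.eta_noise_le
  have hthe := thetaErr_sq_le_of_opNorm (X := X) (αs := αs) (βs := βs) (Zs := Zs) (s 1) hR
  have e3 := opNorm_add_le (Zs * R) ((s 1).Z - Zs * R)
  rw [add_sub_cancel, opNorm_mul_orthogonal Zs hR] at e3
  have e4 := opNorm_le_frobNorm ((s 1).Z - Zs * R)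
  set D := frobNorm ((s 1).Z - Zs * R)
  have hD0 : 0 ≤ D := frobNorm_nonneg _
  set c := contr M₁ Zs
  set δ := procrustesDist (s 0).Z Zs
  set L := lyap X Zs αs βs (s 0)
  set E' := stateDist z⋆ X (s 1) (Iterate.mk (Zs * R) αs βs)
  set N := N⋆
  set w := opNorm (A - sigmoidMat ((s 0).theta X))
  have hterm' : 1 / 10 ^ 4 * c * (N + 5 / 2 * L + E') ≤ 1 / 10 ^ 4 * (N + 5 / 2 * L + E') := by
    have : 0 ≤ N + 5 / 2 * L + E' := by positivity
    have := mul_le_mul_of_nonneg_right hc this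
    linarith
  have k1 : -N ≤ 1 / (2 * η) * (L - E') + w * δ * δ + 1 / 10 ^ 4 * (N + 5 / 2 * L + E') := by
    linarith
  -- The threshold 30 is set by this lemma: `E' ≤ (8/5 + 3/1024)N`, the squared error in Θ is at
  -- most `13E'`, and `energy_upper` adds one more `N`, about `22N` in total.
  have k6 := first_step_dist_le hη hη1 hN0 hL0 hE0 hδL hsm.2 k1
  have k7 : η * N ≤ 1 / 1024 * N := by gcongr
  have k8 : D ≤ 1 / 100 * z⋆ := by
    rw [← sq_le_sq₀ hD0 (by positivity)]
    have : z⋆ ^ 2 * D ^ 2 ≤ z⋆ ^ 2 * (1 / 100 * z⋆) ^ 2 := by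
      have : 0 ≤ z⋆ ^ 4 := by positivity
      linarith
    exact le_of_mul_le_mul_left this (by positivity)
  have k9 := hthe (by linarith)
  linarith

/-- The limiting accuracy. -/
noncomputable def floorLevel (k : ℕ) (M₁ ϖ : ℝ) (X Θs : Matrix (Fin n) (Fin n) ℝ)
    (Zs : Matrix (Fin n) (Fin k) ℝ) (αs : Fin n → ℝ) (βs : ℝ) : ℝ :=
  4000 * (condNum Zs ^ 2 * Real.exp M₁
    * noiseLevel k M₁ ϖ (frobNorm (Θs - LatentSpace.theta X αs βs (Zs * Zsᵀ))))

local notation "F⋆" => floorLevel k M₁ ϖ X Θs Zs αs βs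

lemma floorLevel_nonneg : 0 ≤ F⋆ := by
  have := noiseLevel_nonneg (k := k) M₁ ϖ γ⋆
  unfold floorLevel
  positivity

/-- Either the state is in the basin of attraction with geometrically decaying error, or its loss
is small. -/
lemma dichotomy (H : Regime M₁ η ϖ A X Θs Zs αs βs) (hs : IsPGD M₁ η A X s)
    (hb : InBasin M₁ X Zs αs βs (s 0))
    (hreg : ϖ ≤ contr M₁ Zs * z⋆ ^ 2 / 1000 ∨ lyap X Zs αs βs (s 0) ≤ N⋆) (t : ℕ) :
    (InBasin M₁ X Zs αs βs (s t) ∧ lyap X Zs αs βs (s t)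
        ≤ (1 - η * contr M₁ Zs / 128) ^ t * lyap X Zs αs βs (s 0) + F⋆) ∨
      ((s t).Feasible M₁ X ∧ excess A X Zs αs βs (s t) ≤ 30 * N⋆) := by
  have hF : 0 ≤ F⋆ := floorLevel_nonneg
  have hinit : InBasin M₁ X Zs αs βs (s 0) ∧ lyap X Zs αs βs (s 0)
        ≤ (1 - η * contr M₁ Zs / 128) ^ 0 * lyap X Zs αs βs (s 0) + F⋆ :=
    ⟨hb, by rw [pow_zero, one_mul]; linarith⟩
  rcases hreg with hϖ | h0
  · induction t with
    | zero => exact Or.inl hinit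
    | succ t ih =>
      have hf := hs.feasible H.hM t
      rcases ih with ⟨h1, h2⟩ | ⟨h1, h2⟩
      · obtain ⟨h3, h4⟩ := H.step_of_noise_le hs hϖ hb h1
        by_cases hlt : lyap X Zs αs βs (s t) < lyap X Zs αs βs (s (t + 1))
        · exact Or.inr ⟨hf, h4 hlt⟩
        · refine Or.inl ⟨(not_lt.mp hlt).trans h1, h3.trans ?_⟩
          have hη := H.eta_pos
          have hη1 := H.eta_le
          have hc0 := H.contr_pos
          have hc := H.contr_le_one
          -- The contraction removes `ηcF⋆/128 = 31.25 ηN⋆` from the floor, which more than pays for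
          -- the `4ηN⋆` added in each step.
          have e1 : η * contr M₁ Zs * F⋆ = 4000 * η * N⋆ := by
            unfold floorLevel
            have := H.contr_mul
            linear_combination 4000 * η * N⋆ * this
          have e2 : 0 ≤ 1 - η * contr M₁ Zs / 128 := by nlinarith
          have e3 := mul_le_mul_of_nonneg_left h2 e2
          have hN0 : 0 ≤ η * N⋆ := mul_nonneg hη.le (noiseLevel_nonneg _ _ _)
          rw [pow_succ']
          linarith
      · exact Or.inr ⟨hf, H.excess_succ_le hs t (hb.init H).2.1 h1 h2⟩
  · rcases t with - | t
    · exact Or.inl hinit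
    · right
      induction t with
      | zero => exact ⟨hs.feasible H.hM 0, H.step_of_lyap_le_noise hs hb h0⟩
      | succ t ih =>
        exact ⟨hs.feasible H.hM _, H.excess_succ_le hs _ (hb.init H).2.1 ih.1 ih.2⟩

/-- The deterministic error bounds. -/
theorem error_le (H : Regime M₁ η ϖ A X Θs Zs αs βs) (hs : IsPGD M₁ η A X s)
    (hb : InBasin M₁ X Zs αs βs (s 0))
    (hreg : ϖ ≤ contr M₁ Zs * z⋆ ^ 2 / 1000 ∨ lyap X Zs αs βs (s 0) ≤ N⋆) (t : ℕ) :
    lyap X Zs αs βs (s t) ≤ (1 - η * contr M₁ Zs / 128) ^ t * lyap X Zs αs βs (s 0) + F⋆ ∧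
    gramErr Zs (s t) ^ 2
      ≤ 13 * ((1 - η * contr M₁ Zs / 128) ^ t * lyap X Zs αs βs (s 0) + F⋆) ∧
    thetaErr X Zs αs βs (s t) ^ 2
      ≤ 13 * ((1 - η * contr M₁ Zs / 128) ^ t * lyap X Zs αs βs (s 0) + F⋆) := by
  have hη := H.eta_pos
  have hη1 := H.eta_le
  have hc0 := H.contr_pos
  have hc := H.contr_le_one
  have e2 : 0 ≤ 1 - η * contr M₁ Zs / 128 := by nlinarith
  have h0 : 0 ≤ (1 - η * contr M₁ Zs / 128) ^ t * lyap X Zs αs βs (s 0) :=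
    mul_nonneg (pow_nonneg e2 t) (lyap_nonneg _)
  rcases H.dichotomy hs hb hreg t with ⟨h1, h2⟩ | ⟨h1, h2⟩
  · have h3 := h1.thetaErr_sq_le H
    have h4 := h1.gramErr_sq_le H
    exact ⟨h2, by linarith, by linarith⟩
  · have h3 := H.lyap_le_of_excess h1 h2
    have h4 := H.thetaErr_sq_le_of_excess h1 h2
    have h5 := H.gramErr_sq_le h1
    have h6 := H.one_le_sq_condNum
    have hN0 : 0 ≤ Real.exp M₁ * N⋆ := mul_nonneg (Real.exp_pos _).le (noiseLevel_nonneg _ _ _)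
    have h7 : Real.exp M₁ * N⋆ ≤ κ⋆ ^ 2 * Real.exp M₁ * N⋆ := by
      rw [mul_assoc]; exact le_mul_of_one_le_left hN0 h6
    unfold floorLevel
    exact ⟨by linarith, by linarith, by linarith⟩

end Induction

end Regime

end LatentSpace

namespace LatentSpace

/-! ### The deterministic error bounds for the model -/

section Model

variable {n k : ℕ} {M₁ M₂ η ϖ : ℝ} {A X : Matrix (Fin n) (Fin n) ℝ} {αs : Fin n → ℝ} {βs : ℝ}
  {Gs : Matrix (Fin n) (Fin n) ℝ} {Zs : Matrix (Fin n) (Fin k) ℝ}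

lemma abs_entry_le_of_posSemidef {G : Matrix (Fin n) (Fin n) ℝ} (hG : G.PosSemidef) {r : ℝ}
    (hr : ∀ i, G i i ≤ r) (i j : Fin n) : |G i j| ≤ r := by
  have hs : G j i = G i j := by
    have := congrFun (congrFun hG.1 i) j
    simpa using this
  have h : ∀ c : ℝ, 0 ≤ G i i + 2 * c * G i j + c ^ 2 * G j j := by
    intro c
    -- The test vectors `e_i ± e_j` suffice.
    have h1 := hG.dotProduct_mulVec_nonneg (Pi.single i 1 + c • Pi.single j 1)
    simp only [star_trivial, Matrix.mulVec_add, Matrix.mulVec_smul, Matrix.mulVec_single_one,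
      add_dotProduct, dotProduct_add, smul_dotProduct, dotProduct_smul, single_one_dotProduct,
      Matrix.col_apply, smul_eq_mul, hs] at h1
    linarith
  have h1 := h 1
  have h2 := h (-1)
  have h3 := hr i
  have h4 := hr j
  exact abs_le.mpr ⟨by linarith, by linarith⟩

lemma InClass.abs_theta_le (hM : 0 ≤ M₁) (hX : IsCovariate X) (h : InClass M₁ M₂ X αs βs Gs)
    (i j : Fin n) : |theta X αs βs Gs i j| ≤ M₁ := by
  refine abs_theta_le_of (h.alpha_le i) (h.alpha_le j) ?_
    (abs_entry_le_of_posSemidef h.posSemidef h.diag_le i j)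
  rcases lt_trichotomy i j with hij | rfl | hij
  · exact h.beta_le i j hij
  · simp only [hX.2, abs_zero, mul_zero]
    exact radius_nonneg hM _
  · have := h.beta_le j i hij
    rwa [← hX.1.apply] at this

lemma InClass.theta_isSymm (hX : IsCovariate X) (h : InClass M₁ M₂ X αs βs Gs) :
    (theta X αs βs Gs).IsSymm := by
  ext i j
  have h2 : Gs j i = Gs i j := by
    have := congrFun (congrFun h.posSemidef.1 i) j
    simpa using this
  have h3 := congrFun (congrFun hX.1 i) j
  rw [Matrix.transpose_apply] at *
  change αs j + αs i + βs * X j i + Gs j i = αs i + αs j + βs * X i j + Gs i j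
  rw [h2, h3]; ring

lemma theta_sub_theta_gram (X : Matrix (Fin n) (Fin n) ℝ) (αs : Fin n → ℝ) (βs : ℝ)
    (G G' : Matrix (Fin n) (Fin n) ℝ) : theta X αs βs G - theta X αs βs G' = G - G' := by
  ext i j
  simp [theta]

lemma ne_zero_of_singVal_pos (hsv : 0 < singVal Zs (k - 1)) : n ≠ 0 := by
  rintro rfl
  have h1 : Zs = 0 := Subsingleton.elim _ _
  have h2 : 0 < singVal Zs 0 := hsv.trans_le (singVal_antitone Zs (Nat.zero_le _))
  rcases Nat.eq_zero_or_pos k with rfl | hk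
  · rw [singVal, LinearMap.singularValues_of_finrank_le _ (by simp)] at h2
    exact lt_irrefl _ h2
  · rw [← opNorm_eq_singVal_zero hk, opNorm_eq_zero.mpr h1] at h2
    exact lt_irrefl _ h2

lemma stable_of_stableRank (hX : X ≠ 0 → 128 * k ≤ stableRank X) :
    128 * k * opNorm X ^ 2 ≤ frobNorm X ^ 2 := by
  by_cases h : X = 0
  · rw [opNorm_eq_zero.mpr h]
    simpa using sq_nonneg (frobNorm X)
  · have h1 : 0 < opNorm X := lt_of_le_of_ne (opNorm_nonneg X) fun h0 => h (opNorm_eq_zero.mp h0.symm)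
    have h2 := hX h
    rwa [stableRank, le_div_iff₀ (by positivity)] at h2

/-- The assumptions on the model in the form used by the deterministic analysis. -/
lemma InClass.regime (hk : 1 ≤ k) (hM : 0 ≤ M₁) (hη : 0 < η) (hη1 : η ≤ 1 / 1024)
    (hX : IsCovariate X) (hXs : X ≠ 0 → 128 * k ≤ stableRank X) (h : InClass M₁ M₂ X αs βs Gs)
    (hZ : IsTopEigenFactor Gs Zs) (hsv : 0 < singVal Zs (k - 1)) (hA : A.IsSymm)
    (hϖ : IsNoiseBound k A (sigmoidMat (theta X αs βs Gs)) X ϖ)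
    (hsig : η * condNum Zs ^ 2 * Real.exp M₁ * noiseLevel k M₁ ϖ (frobNorm (Gs - Zs * Zsᵀ))
      ≤ 1 / 10 ^ 6 * opNorm Zs ^ 4) :
    Regime M₁ η ϖ A X (theta X αs βs Gs) Zs αs βs where
  hk := hk
  hn := ne_zero_of_singVal_pos hsv
  hM := hM
  eta_pos := hη
  eta_le := hη1
  symmX := hX.1
  stable := stable_of_stableRank hXs
  symmA := hA
  symmTheta := h.theta_isSymm hX
  feasible _ hR := h.feasible hM hX hZ hR
  theta_le := h.abs_theta_le hM hX
  sv_pos := hsv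
  noise := hϖ
  signal := by rwa [theta_sub_theta_gram]

/-- A sufficient signal strength, for noise of size `ϖ`. -/
structure IsStrongSignal (k : ℕ) (M₁ η ϖ γ κ g : ℝ) : Prop where
  noise : η * κ ^ 4 * Real.exp M₁ ^ 2 * ϖ ^ 2 * k ≤ 1 / 10 ^ 8 * g ^ 2
  remainder : η * κ ^ 4 * Real.exp M₁ * γ ^ 2 ≤ 1 / 10 ^ 8 * g ^ 2

lemma IsStrongSignal.noiseLevel_le {γ κ g : ℝ} (h : IsStrongSignal k M₁ η ϖ γ κ g) (hM : 0 ≤ M₁)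
    (hη : 0 ≤ η) (hκ : 1 ≤ κ) :
    η * κ ^ 2 * Real.exp M₁ * noiseLevel k M₁ ϖ γ ≤ 1 / 10 ^ 6 * g ^ 2 := by
  have hE : 1 ≤ Real.exp M₁ := Real.one_le_exp hM
  have hκ2 : κ ^ 2 ≤ κ ^ 4 := pow_le_pow_right₀ hκ (by norm_num)
  have h1 : η * κ ^ 2 * Real.exp M₁ ^ 2 * ϖ ^ 2 * k ≤ η * κ ^ 4 * Real.exp M₁ ^ 2 * ϖ ^ 2 * k := by
    gcongr
  have h2 : η * κ ^ 2 * Real.exp M₁ * γ ^ 2 ≤ η * κ ^ 4 * Real.exp M₁ * γ ^ 2 := by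
    gcongr
  have h3 := h.noise
  have h4 := h.remainder
  have h5 : 0 ≤ g ^ 2 := sq_nonneg g
  unfold noiseLevel
  linarith

lemma rate_eq (M₁ η : ℝ) (Zs : Matrix (Fin n) (Fin k) ℝ) :
    rate M₁ η (1 / 128) (condNum Zs) = 1 - η * Regime.contr M₁ Zs / 128 := by
  rw [rate, Regime.contr, Real.exp_neg]
  ring

lemma frobNorm_add_sq_le {m l : ℕ} (B C : Matrix (Fin m) (Fin l) ℝ) :
    frobNorm (B + C) ^ 2 ≤ 2 * frobNorm B ^ 2 + 2 * frobNorm C ^ 2 := by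
  have := pow_le_pow_left₀ (frobNorm_nonneg _) (frobNorm_add_le B C) 2
  nlinarith [sq_nonneg (frobNorm B - frobNorm C)]

/-- The error bounds in terms of an arbitrary bound `ϖ` on the noise.  Either the noise is weak, or
the initial error is below the noise level. -/
theorem error_le_of_isNoiseBound (hk : 1 ≤ k) (hM : 0 ≤ M₁) (hη : 0 < η) (hη1 : η ≤ 1 / 1024)
    (hX : IsCovariate X) (hXs : X ≠ 0 → 128 * k ≤ stableRank X) (h : InClass M₁ M₂ X αs βs Gs)
    (hZ : IsTopEigenFactor Gs Zs) (hsv : 0 < singVal Zs (k - 1)) (hA : A.IsSymm)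
    (hϖ : IsNoiseBound k A (sigmoidMat (theta X αs βs Gs)) X ϖ)
    (hsig : IsStrongSignal k M₁ η ϖ (frobNorm (Gs - Zs * Zsᵀ)) (condNum Zs) (opNorm Gs))
    {s : ℕ → Iterate n k} (hs : IsPGD M₁ η A X s)
    (h0 : err X Zs αs βs (s 0)
      ≤ 2 / 10 ^ 10 * Real.exp (-2 * M₁) * opNorm Zs ^ 4 / condNum Zs ^ 4)
    (hreg : 1000 * condNum Zs ^ 2 * Real.exp M₁ * ϖ ≤ opNorm Gs ∨
      2 * err X Zs αs βs (s 0) ≤ 48 * Real.exp M₁ * ϖ ^ 2 * k) (t : ℕ) :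
    let B := 2 * rate M₁ η (1 / 128) (condNum Zs) ^ t * err X Zs αs βs (s 0)
      + condNum Zs ^ 2 * (192000 * (Real.exp M₁ ^ 2 * ϖ ^ 2 * k)
        + 1000 * (Real.exp M₁ * frobNorm (Gs - Zs * Zsᵀ) ^ 2))
    err X Zs αs βs (s t) ≤ B ∧
      frobNorm ((s t).Z * (s t).Zᵀ - Zs * Zsᵀ) ^ 2 ≤ 13 * B ∧
      frobNorm ((s t).Z * (s t).Zᵀ - Gs) ^ 2 ≤ 28 * B ∧
      frobNorm ((s t).theta X - theta X αs βs Gs) ^ 2 ≤ 28 * B := by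
  intro B
  have hzG := hZ.opNorm_le hk h.posSemidef
  have hκ : 1 ≤ condNum Zs := by
    rw [condNum, one_le_div hsv]
    exact singVal_antitone Zs (Nat.zero_le _)
  have hz4 : opNorm Gs ^ 2 ≤ opNorm Zs ^ 4 := by
    have := pow_le_pow_left₀ (opNorm_nonneg _) hzG 2
    rwa [← pow_mul] at this
  have H := h.regime hk hM hη hη1 hX hXs hZ hsv hA hϖ
    ((hsig.noiseLevel_le hM hη.le hκ).trans (mul_le_mul_of_nonneg_left hz4 (by norm_num)))
  have hγ : frobNorm (theta X αs βs Gs - theta X αs βs (Zs * Zsᵀ)) = frobNorm (Gs - Zs * Zsᵀ) := by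
    rw [theta_sub_theta_gram]
  have hL := Regime.lyap_le_two_err (X := X) (Zs := Zs) (αs := αs) (βs := βs) (s 0)
  have hκ0 : 0 < condNum Zs := by linarith
  have hb : Regime.InBasin M₁ X Zs αs βs (s 0) := by
    refine hL.trans ?_
    have e : Real.exp (-2 * M₁) = Real.exp (-M₁) ^ 2 := by
      rw [← Real.exp_nat_mul]; congr 1; push_cast; ring
    rw [e] at h0
    refine (mul_le_mul_of_nonneg_left h0 zero_le_two).trans (le_of_eq ?_)
    rw [Regime.contr]
    field_simp
    norm_num
    ring
  have hreg' : ϖ ≤ Regime.contr M₁ Zs * opNorm Zs ^ 2 / 1000 ∨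
      Regime.lyap X Zs αs βs (s 0) ≤ noiseLevel k M₁ ϖ
        (frobNorm (theta X αs βs Gs - theta X αs βs (Zs * Zsᵀ))) := by
    refine hreg.imp (fun h1 => ?_) fun h1 => ?_
    · have h2 := mul_le_mul_of_nonneg_left (h1.trans hzG) H.contr_pos.le
      have h3 := H.contr_mul
      have h4 : Regime.contr M₁ Zs * (1000 * condNum Zs ^ 2 * Real.exp M₁ * ϖ)
          = 1000 * ϖ * (Regime.contr M₁ Zs * (condNum Zs ^ 2 * Real.exp M₁)) := by ring
      rw [h4, h3] at h2
      linarith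
    · unfold noiseLevel
      linarith [sq_nonneg (frobNorm (theta X αs βs Gs - theta X αs βs (Zs * Zsᵀ)))]
  obtain ⟨h1, h2, h3⟩ := H.error_le hs hb hreg' t
  -- The constants are `4000 · 48` and `4000 / 4`.
  have hF : Regime.floorLevel k M₁ ϖ X (theta X αs βs Gs) Zs αs βs
      = condNum Zs ^ 2 * (192000 * (Real.exp M₁ ^ 2 * ϖ ^ 2 * k)
        + 1000 * (Real.exp M₁ * frobNorm (Gs - Zs * Zsᵀ) ^ 2)) := by
    rw [Regime.floorLevel, hγ, noiseLevel]; ring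
  rw [hF, ← rate_eq] at h1 h2 h3
  have hrate : 0 ≤ rate M₁ η (1 / 128) (condNum Zs) := by
    rw [rate_eq]
    nlinarith [H.contr_pos, H.contr_le_one]
  have h4 := mul_le_mul_of_nonneg_left hL (pow_nonneg hrate t)
  have hB : rate M₁ η (1 / 128) (condNum Zs) ^ t * Regime.lyap X Zs αs βs (s 0)
      + condNum Zs ^ 2 * (192000 * (Real.exp M₁ ^ 2 * ϖ ^ 2 * k)
        + 1000 * (Real.exp M₁ * frobNorm (Gs - Zs * Zsᵀ) ^ 2)) ≤ B := by
    simp only [B]; linarith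
  -- Passing from the rank `k` truth to the full truth costs `2γ²`. Since `κ²e^{M₁} ≥ 1`, this is at
  -- most `2B`, which makes the constant `2 · 13 + 2 = 28`.
  have hGB : frobNorm (Gs - Zs * Zsᵀ) ^ 2 ≤ B := by
    have e1 : 0 ≤ rate M₁ η (1 / 128) (condNum Zs) ^ t * Regime.lyap X Zs αs βs (s 0) :=
      mul_nonneg (pow_nonneg hrate t) (Regime.lyap_nonneg _)
    have e2 : 1 ≤ condNum Zs ^ 2 * Real.exp M₁ := H.one_le_sq_condNum_mul_exp
    have e3 : 0 ≤ condNum Zs ^ 2 * (Real.exp M₁ ^ 2 * ϖ ^ 2 * k) := by positivity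
    have e4 := mul_le_mul_of_nonneg_right e2 (sq_nonneg (frobNorm (Gs - Zs * Zsᵀ)))
    linarith [sq_nonneg (frobNorm (Gs - Zs * Zsᵀ))]
  have h1' := (Regime.err_le_lyap (X := X) (Zs := Zs) (αs := αs) (βs := βs) (s t)).trans
    (h1.trans hB)
  unfold gramErr at h2
  unfold thetaErr at h3
  refine ⟨h1', by linarith, ?_, ?_⟩
  · have e := frobNorm_add_sq_le ((s t).Z * (s t).Zᵀ - Zs * Zsᵀ) (-(Gs - Zs * Zsᵀ))
    rw [frobNorm_neg, neg_sub, sub_add_sub_cancel] at e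
    linarith
  · have e := frobNorm_add_sq_le ((s t).theta X - theta X αs βs (Zs * Zsᵀ))
      (-(theta X αs βs Gs - theta X αs βs (Zs * Zsᵀ)))
    rw [frobNorm_neg, hγ, neg_sub, sub_add_sub_cancel] at e
    linarith

/-- The consequences of a signal strength condition with base noise `D`. -/
lemma signalFactor_bounds {D ζ g : ℝ} {Gbar : Matrix (Fin n) (Fin n) ℝ} (hη : 0 ≤ η) (hD : 0 ≤ D)
    (hζ : 1 ≤ ζ) (h : D * signalFactor k M₁ η ζ Gbar ≤ g) :
    D ≤ g ∧ D ^ 2 * (η * k * Real.exp M₁) ≤ g ^ 2 ∧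
      D ^ 2 * (η * frobNorm Gbar ^ 2) ≤ g ^ 2 * ζ ^ 2 := by
  have h1 : D * √(η * k * Real.exp M₁) ≤ g :=
    (mul_le_mul_of_nonneg_left ((le_max_left _ _).trans (le_max_left _ _)) hD).trans h
  have h2 : D * √(η * frobNorm Gbar ^ 2 / ζ ^ 2) ≤ g :=
    (mul_le_mul_of_nonneg_left ((le_max_right _ _).trans (le_max_left _ _)) hD).trans h
  have h3 : D * 1 ≤ g := (mul_le_mul_of_nonneg_left (le_max_right _ _) hD).trans h
  refine ⟨by linarith, ?_, ?_⟩
  · have := pow_le_pow_left₀ (by positivity) h1 2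
    rwa [mul_pow, Real.sq_sqrt (by positivity)] at this
  · have := pow_le_pow_left₀ (by positivity) h2 2
    rw [mul_pow, Real.sq_sqrt (by positivity), mul_div_assoc', div_le_iff₀ (by positivity)] at this
    exact this

/-- The deterministic error bound. -/
theorem deterministic_error_le {C₁ C : ℝ} (hC₁ : 10 ^ 4 ≤ C₁) (hC : 1500 ≤ C)
    (hk : 1 ≤ k) (hM : 0 ≤ M₁) (hη : 0 < η) (hη1 : η ≤ 1 / 1024)
    (hX : IsCovariate X) (hXs : X ≠ 0 → 128 * k ≤ stableRank X) (h : InClass M₁ M₂ X αs βs Gs)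
    (hZ : IsTopEigenFactor Gs Zs) (hsv : 0 < singVal Zs (k - 1)) (hA : IsAdjacency A) {ζ : ℝ}
    (hζ : ζ = zeta k A (sigmoidMat (theta X αs βs Gs)) X)
    (hsig : C₁ * condNum Zs ^ 2 * Real.exp M₁ * ζ * signalFactor k M₁ η ζ (Gs - Zs * Zsᵀ)
      ≤ opNorm Gs) {s : ℕ → Iterate n k} (hs : IsPGD M₁ η A X s)
    (h0 : err X Zs αs βs (s 0)
      ≤ 2 / 10 ^ 10 * Real.exp (-2 * M₁) * opNorm Zs ^ 4 / condNum Zs ^ 4) (t : ℕ) :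
    err X Zs αs βs (s t) ≤ 2 * rate M₁ η (1 / 128) (condNum Zs) ^ t * err X Zs αs βs (s 0)
      + C * condNum Zs ^ 2 / (1 / 128) * (Real.exp (2 * M₁) * ζ ^ 2 * k
        + Real.exp M₁ * frobNorm (Gs - Zs * Zsᵀ) ^ 2) := by
  have hN : IsNoiseBound k A (sigmoidMat (theta X αs βs Gs)) X ζ :=
    IsNoiseBound.of_zeta_le hk hζ.ge
  have hζ1 := hN.one_le
  have hE : 1 ≤ Real.exp M₁ := Real.one_le_exp hM
  obtain ⟨h1, h2, h3⟩ := signalFactor_bounds hη.le (by positivity) hζ1 hsig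
  have hC2 : 10 ^ 8 ≤ C₁ ^ 2 := by
    have := pow_le_pow_left₀ (by norm_num) hC₁ 2
    norm_num at this ⊢; exact this
  set E := Real.exp M₁ with hEdef
  set κ := condNum Zs
  set γ := frobNorm (Gs - Zs * Zsᵀ)
  have hst : IsStrongSignal k M₁ η ζ γ κ (opNorm Gs) := by
    constructor
    · rw [← hEdef]
      have : 10 ^ 8 * (η * κ ^ 4 * E ^ 2 * ζ ^ 2 * k) ≤ C₁ ^ 2 * (η * κ ^ 4 * E ^ 3 * ζ ^ 2 * k) := by
        gcongr
        norm_num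
      linarith
    · rw [← hEdef]
      have e1 : 10 ^ 8 * (η * κ ^ 4 * E * γ ^ 2) * ζ ^ 2 ≤ opNorm Gs ^ 2 * ζ ^ 2 := by
        refine le_trans ?_ h3
        have e2 : E ≤ E ^ 2 := le_self_pow₀ hE (by norm_num)
        calc 10 ^ 8 * (η * κ ^ 4 * E * γ ^ 2) * ζ ^ 2
            ≤ C₁ ^ 2 * (η * κ ^ 4 * E ^ 2 * γ ^ 2) * ζ ^ 2 := by gcongr
          _ = _ := by ring
      have := le_of_mul_le_mul_right e1 (by positivity)
      linarith
  have hreg : 1000 * κ ^ 2 * E * ζ ≤ opNorm Gs := by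
    refine le_trans ?_ h1
    gcongr
    linarith
  obtain ⟨h4, -⟩ := error_le_of_isNoiseBound hk hM hη hη1 hX hXs h hZ hsv hA.1 hN hst hs h0
    (Or.inl hreg) t
  refine h4.trans ?_
  rw [← hEdef]
  have e1 : Real.exp (2 * M₁) = E ^ 2 := by
    rw [hEdef, ← Real.exp_nat_mul]; push_cast; rfl
  rw [e1]
  have e2 : 0 ≤ κ ^ 2 * (E ^ 2 * ζ ^ 2 * k) := by positivity
  have e3 : 0 ≤ κ ^ 2 * (E * γ ^ 2) := by positivity
  -- The requirement `C ≥ 1500` is `1500 · 128 = 192000`.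
  have e4 := mul_le_mul_of_nonneg_right hC e2
  have e5 := mul_le_mul_of_nonneg_right hC e3
  linarith

end Model

end LatentSpace

namespace LatentSpace

/-! ### Closed walks -/

section Walks

variable {s L : ℕ}

/-- The pairs `a < b`, that is the edges of the complete graph. -/
abbrev Pair (s : ℕ) : Type := {p : Fin s × Fin s // p.1 < p.2}

/-- `a` and `b` are the endpoints of the edge `p`. -/
def Joins (p : Pair s) (a b : Fin s) : Prop :=
  (a = p.1.1 ∧ b = p.1.2) ∨ (a = p.1.2 ∧ b = p.1.1)

instance (p : Pair s) (a b : Fin s) : Decidable (Joins p a b) :=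
  inferInstanceAs (Decidable ((_ ∧ _) ∨ (_ ∧ _)))

lemma exists_joins {a b : Fin s} (h : a ≠ b) : ∃ p, Joins p a b := by
  rcases lt_or_gt_of_ne h with h | h
  · exact ⟨⟨(a, b), h⟩, Or.inl ⟨rfl, rfl⟩⟩
  · exact ⟨⟨(b, a), h⟩, Or.inr ⟨rfl, rfl⟩⟩

lemma Joins.unique {p q : Pair s} {a b : Fin s} (hp : Joins p a b) (hq : Joins q a b) : p = q := by
  obtain ⟨⟨p1, p2⟩, h1⟩ := p
  obtain ⟨⟨q1, q2⟩, h2⟩ := q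
  simp only [Joins] at hp hq h1 h2
  rcases hp with ⟨rfl, rfl⟩ | ⟨rfl, rfl⟩ <;> rcases hq with ⟨e1, e2⟩ | ⟨e1, e2⟩ <;>
    subst e1 <;> subst e2
  · rfl
  · exact absurd h1 h2.not_gt
  · exact absurd h1 h2.not_gt
  · rfl

/-- The number of times that the walk `w` uses the edge `p`. -/
def edgeCount (w : Fin (L + 1) → Fin s) (p : Pair s) : ℕ :=
  (Finset.univ.filter fun t : Fin L => Joins p (w t.castSucc) (w t.succ)).card

/-- Grouping the steps of a walk by their undirected edge makes the factors independent when the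
entries above the diagonal are. -/
lemma prod_walk_eq {M : Matrix (Fin s) (Fin s) ℝ} (hM : M.IsSymm) {w : Fin (L + 1) → Fin s}
    (hw : ∀ t : Fin L, w t.castSucc ≠ w t.succ) :
    ∏ t : Fin L, M (w t.castSucc) (w t.succ) = ∏ p : Pair s, M p.1.1 p.1.2 ^ edgeCount w p := by
  choose g hg using fun t => exists_joins (hw t)
  rw [← Finset.prod_fiberwise Finset.univ g]
  refine Finset.prod_congr rfl fun p _ => ?_
  have h1 : edgeCount w p = (Finset.univ.filter fun t : Fin L => g t = p).card := by
    refine congrArg Finset.card (Finset.filter_congr fun t _ => ⟨fun h => (hg t).unique h, ?_⟩)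
    rintro rfl
    exact hg t
  rw [h1]
  refine Finset.prod_eq_pow_card fun t ht => ?_
  obtain rfl := (Finset.mem_filter.mp ht).2
  rcases hg t with ⟨e1, e2⟩ | ⟨e1, e2⟩
  · rw [← e1, ← e2]
  · rw [← e1, ← e2, hM.apply]

lemma pow_apply_eq_sum_walks (M : Matrix (Fin s) (Fin s) ℝ) (L : ℕ) (i j : Fin s) :
    (M ^ L) i j = ∑ w : Fin (L + 1) → Fin s,
      if w 0 = i ∧ w (Fin.last L) = j then ∏ t : Fin L, M (w t.castSucc) (w t.succ) else 0 := by
  induction L generalizing i j with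
  | zero =>
    rw [pow_zero, ← (Equiv.funUnique (Fin 1) (Fin s)).symm.sum_comp]
    simp only [Equiv.funUnique_symm_apply, uniqueElim_const, Finset.univ_eq_empty,
      Finset.prod_empty, Matrix.one_apply]
    rw [Finset.sum_eq_single i]
    · simp
    · intro b _ hb
      simp [hb]
    · simp
  | succ L ih =>
    rw [pow_succ', Matrix.mul_apply, ← (Fin.consEquiv fun _ : Fin (L + 2) => Fin s).sum_comp,
      Fintype.sum_prod_type]
    simp only [ih, Finset.mul_sum]
    refine Finset.sum_comm.trans (Eq.trans (Finset.sum_congr rfl fun w _ => ?_) Finset.sum_comm)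
    rw [Finset.sum_eq_single (w 0), Finset.sum_eq_single i]
    · simp [Fin.consEquiv, Fin.prod_univ_succ, ← Fin.succ_last]
    · intro b _ hb
      simp [Fin.consEquiv, hb]
    · simp
    · intro b _ hb
      simp [hb.symm]
    · simp

lemma trace_pow_eq_sum_walks (M : Matrix (Fin s) (Fin s) ℝ) (L : ℕ) :
    (M ^ L).trace = ∑ w : Fin (L + 1) → Fin s,
      if w 0 = w (Fin.last L) then ∏ t : Fin L, M (w t.castSucc) (w t.succ) else 0 := by
  simp only [Matrix.trace, Matrix.diag_apply, pow_apply_eq_sum_walks]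
  rw [Finset.sum_comm]
  refine Finset.sum_congr rfl fun w _ => ?_
  rw [Finset.sum_eq_single (w 0)]
  · simp [eq_comm]
  · intro b _ hb
    simp [hb.symm]
  · simp

/-- A closed walk without loops that uses no edge exactly once. -/
def IsGoodWalk (w : Fin (L + 1) → Fin s) : Prop :=
  w 0 = w (Fin.last L) ∧ (∀ t : Fin L, w t.castSucc ≠ w t.succ) ∧ ∀ p, edgeCount w p ≠ 1

instance (w : Fin (L + 1) → Fin s) : Decidable (IsGoodWalk w) :=
  inferInstanceAs (Decidable (_ ∧ _ ∧ _))

/-- The edges of a walk. -/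
def walkEdges (w : Fin (L + 1) → Fin s) : Finset (Pair s) :=
  Finset.univ.filter fun p => edgeCount w p ≠ 0

lemma mem_walkEdges {w : Fin (L + 1) → Fin s} {p : Pair s} :
    p ∈ walkEdges w ↔ ∃ t : Fin L, Joins p (w t.castSucc) (w t.succ) := by
  simp [walkEdges, edgeCount, Finset.filter_eq_empty_iff]

/-- A walk visits at most one vertex more than it uses edges. -/
lemma card_image_walk_le (w : Fin (L + 1) → Fin s) :
    (Finset.univ.image w).card ≤ (walkEdges w).card + 1 := by
  induction L with
  | zero =>
    refine (Finset.card_image_le).trans ?_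
    simp
  | succ L ih =>
    obtain ⟨a, v, rfl⟩ : ∃ a v, w = Fin.cons a v := ⟨w 0, Fin.tail w, (Fin.cons_self_tail w).symm⟩
    have hV : Finset.univ.image (Fin.cons a v : Fin (L + 2) → Fin s)
        = insert a (Finset.univ.image v) := by
      ext b
      simp [Fin.exists_fin_succ, eq_comm]
    have hE : walkEdges v ⊆ walkEdges (Fin.cons a v : Fin (L + 2) → Fin s) := by
      intro p hp
      obtain ⟨t, ht⟩ := mem_walkEdges.mp hp
      exact mem_walkEdges.mpr ⟨t.succ, by simpa [← Fin.succ_castSucc] using ht⟩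
    rw [hV]
    by_cases ha : a ∈ Finset.univ.image v
    · rw [Finset.insert_eq_of_mem ha]
      exact (ih v).trans (Nat.succ_le_succ (Finset.card_le_card hE))
    -- If the first vertex is not visited again, the edge leaving it is not used again either, so a
    -- new vertex always brings a new edge.
    · rw [Finset.card_insert_of_notMem ha]
      have hne : a ≠ v 0 := fun h => ha (h ▸ Finset.mem_image_of_mem v (Finset.mem_univ _))
      obtain ⟨p, hp⟩ := exists_joins hne
      have hp1 : p ∈ walkEdges (Fin.cons a v : Fin (L + 2) → Fin s) :=
        mem_walkEdges.mpr ⟨0, by simpa using hp⟩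
      have hp2 : p ∉ walkEdges v := by
        intro h
        obtain ⟨t, ht⟩ := mem_walkEdges.mp h
        apply ha
        have h1 : v t.castSucc ∈ Finset.univ.image v := Finset.mem_image_of_mem v (Finset.mem_univ _)
        have h2 : v t.succ ∈ Finset.univ.image v := Finset.mem_image_of_mem v (Finset.mem_univ _)
        rcases hp with ⟨e1, e2⟩ | ⟨e1, e2⟩ <;> rcases ht with ⟨f1, f2⟩ | ⟨f1, f2⟩
        · rwa [e1, ← f1]
        · rwa [e1, ← f2]
        · rwa [e1, ← f2]
        · rwa [e1, ← f1]
      have h3 := Finset.card_lt_card (Finset.ssubset_iff_of_subset hE |>.mpr ⟨p, hp1, hp2⟩)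
      have := ih v
      omega

/-- The number of good walks of length `L` on `s` vertices. -/
def goodWalkCount (s L : ℕ) : ℕ :=
  (Finset.univ.filter fun w : Fin (L + 1) → Fin s => IsGoodWalk w).card

/-- The number of good walks inside a set of vertices depends only on its size. -/
lemma card_goodWalks_subset_le (S : Finset (Fin s)) :
    (Finset.univ.filter fun w : Fin (L + 1) → Fin s =>
      IsGoodWalk w ∧ Finset.univ.image w ⊆ S).card ≤ goodWalkCount S.card L := by
  classical
  set e := S.orderEmbOfFin rfl with he
  -- Walks inside `S` are relabelled by the increasing enumeration of `S`. Monotonicity matters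
  -- because edges are stored as ordered pairs.
  refine (Finset.card_le_card (t := (Finset.univ.filter fun w : Fin (L + 1) → Fin S.card =>
    IsGoodWalk w).image fun v t => e (v t)) fun w hw => ?_).trans Finset.card_image_le
  obtain ⟨-, ⟨hw1, hw2, hw3⟩, hS⟩ := Finset.mem_filter.mp hw
  have hex : ∀ t, ∃ a, e a = w t := by
    intro t
    have : w t ∈ Set.range e := by
      rw [he, Finset.range_orderEmbOfFin]
      exact hS (Finset.mem_image_of_mem w (Finset.mem_univ t))
    exact this
  choose v hv using hex
  refine Finset.mem_image.mpr ⟨v, Finset.mem_filter.mpr ⟨Finset.mem_univ _, ?_, ?_, ?_⟩,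
    funext hv⟩
  · exact e.injective (by rw [hv, hv, hw1])
  · intro t h
    exact hw2 t (by rw [← hv, ← hv, h])
  · intro p hp
    refine hw3 ⟨(e p.1.1, e p.1.2), e.strictMono p.2⟩ (Eq.trans ?_ hp)
    refine congrArg Finset.card (Finset.filter_congr fun t _ => ?_)
    simp only [Joins, ← hv, e.injective.eq_iff]

/-- Walks weighted by the number of their vertices, as an average over random vertex sets. -/
lemma sum_goodWalks_pow_card_le {p : ℝ} (hp0 : 0 ≤ p) (hp1 : p ≤ 1) {g : ℕ → ℝ}
    (hg : ∀ r, (goodWalkCount r L : ℝ) ≤ g r) :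
    ∑ w : Fin (L + 1) → Fin s with IsGoodWalk w, p ^ (Finset.univ.image w).card
      ≤ ∑ S : Finset (Fin s), p ^ S.card * (1 - p) ^ (s - S.card) * g S.card := by
  -- If every vertex is selected independently with probability `p`, then `p^{|V|}` is the
  -- probability that all of `V` is selected.
  have key : ∀ V : Finset (Fin s), p ^ V.card
      = ∑ S : Finset (Fin s), if V ⊆ S then p ^ S.card * (1 - p) ^ (s - S.card) else 0 := by
    intro V
    have h := Finset.prod_add (fun _ : Fin s => p) (fun i => if i ∈ V then 0 else 1 - p) Finset.univ
    have h1 : ∏ i : Fin s, (p + if i ∈ V then 0 else 1 - p) = p ^ V.card := by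
      have : ∀ i : Fin s, (p + if i ∈ V then 0 else 1 - p) = if i ∈ V then p else 1 := by
        intro i; split_ifs <;> ring
      simp only [this, Finset.prod_ite_mem, Finset.univ_inter, Finset.prod_const]
    rw [h1] at h
    rw [h, Finset.powerset_univ]
    refine Finset.sum_congr rfl fun S _ => ?_
    rw [Finset.prod_const]
    split_ifs with hVS
    · congr 1
      rw [Finset.prod_congr rfl (g := fun _ => 1 - p), Finset.prod_const, Finset.card_sdiff_of_subset
        (Finset.subset_univ _), Finset.card_univ, Fintype.card_fin]
      intro i hi
      rw [if_neg fun h => (Finset.mem_sdiff.mp hi).2 (hVS h)]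
    · obtain ⟨i, hi, hiS⟩ := Finset.not_subset.mp hVS
      rw [Finset.prod_eq_zero (i := i) (by simp [hiS]) (by simp [hi]), mul_zero]
  calc _ = ∑ S : Finset (Fin s), ∑ w : Fin (L + 1) → Fin s with IsGoodWalk w,
        if Finset.univ.image w ⊆ S then p ^ S.card * (1 - p) ^ (s - S.card) else 0 := by
        rw [Finset.sum_comm]
        exact Finset.sum_congr rfl fun w _ => key _
    _ ≤ _ := by
        refine Finset.sum_le_sum fun S _ => ?_
        rw [← Finset.sum_filter, Finset.filter_filter, Finset.sum_const, nsmul_eq_mul, mul_comm]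
        refine mul_le_mul_of_nonneg_left ?_
          (mul_nonneg (pow_nonneg hp0 _) (pow_nonneg (sub_nonneg.mpr hp1) _))
        exact le_trans (by exact_mod_cast card_goodWalks_subset_le S) (hg _)

/-! ### Comparison with a random matrix of bounded entries -/

/-- The values `2`, `-1`, `-1` of a random variable of mean zero with moments at least one. -/
def ternary (c : Fin 3) : ℝ := if c = 0 then 2 else -1

/-- The symmetric matrix with zero diagonal and entries `2`, `-1` given by `Y`. -/
def ternaryMatrix (Y : Pair s → Fin 3) : Matrix (Fin s) (Fin s) ℝ :=
  Matrix.of fun a b => if h : a < b then ternary (Y ⟨(a, b), h⟩)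
    else if h : b < a then ternary (Y ⟨(b, a), h⟩) else 0

lemma ternaryMatrix_isSymm (Y : Pair s → Fin 3) : (ternaryMatrix Y).IsSymm := by
  ext a b
  simp only [ternaryMatrix, Matrix.transpose_apply, Matrix.of_apply]
  rcases lt_trichotomy a b with h | rfl | h
  · rw [dif_neg h.not_gt, dif_pos h, dif_pos h]
  · rfl
  · rw [dif_pos h, dif_neg h.not_gt, dif_pos h]

lemma ternaryMatrix_self (Y : Pair s → Fin 3) (a : Fin s) : ternaryMatrix Y a a = 0 := by
  simp [ternaryMatrix]

lemma ternaryMatrix_pair (Y : Pair s → Fin 3) (p : Pair s) :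
    ternaryMatrix Y p.1.1 p.1.2 = ternary (Y p) := by
  simp [ternaryMatrix, p.2]

lemma sum_ternary_pow (l : ℕ) : ∑ c, ternary c ^ l = 2 ^ l + 2 * (-1) ^ l := by
  simp [Fin.sum_univ_three, ternary]
  ring

/-- This explains the skewed values. Random signs have vanishing odd moments and would miss walks
that use an edge three times; here only the first moment vanishes. -/
lemma three_le_sum_ternary_pow {l : ℕ} (hl : l ≠ 1) : 3 ≤ ∑ c, ternary c ^ l := by
  rw [sum_ternary_pow]
  rcases l with - | - | l
  · norm_num
  · exact absurd rfl hl
  · rcases neg_one_pow_eq_or ℝ (l + 2) with h | h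
    · rw [h]
      have : (1 : ℝ) ≤ 2 ^ (l + 2) := one_le_pow₀ (by norm_num)
      linarith
    · rw [h]
      rcases l with - | l
      · norm_num at h
      · have : (1 : ℝ) ≤ 2 ^ l := one_le_pow₀ (by norm_num)
        rw [show l + 1 + 2 = l + 3 by rfl, pow_add]
        linarith

lemma sum_ternary_pow_nonneg (l : ℕ) : 0 ≤ ∑ c, ternary c ^ l := by
  by_cases hl : l = 1
  · rw [sum_ternary_pow, hl]; norm_num
  · linarith [three_le_sum_ternary_pow hl]

/-- Up to the factor `3^{pairs}` the right side is an expected trace. A closed walk without loops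
contributes a product over edges of normalized moments: at least 1 if the walk is good, 0 if some
edge is used exactly once. A loop gives 0 because the diagonal vanishes. -/
lemma goodWalkCount_le (s L : ℕ) :
    3 ^ Fintype.card (Pair s) * (goodWalkCount s L : ℝ)
      ≤ ∑ Y : Pair s → Fin 3, (ternaryMatrix Y ^ L).trace := by
  simp only [trace_pow_eq_sum_walks]
  rw [Finset.sum_comm, goodWalkCount, Finset.card_filter, Nat.cast_sum, Finset.mul_sum]
  refine Finset.sum_le_sum fun w _ => ?_
  by_cases hw0 : w 0 = w (Fin.last L)
  · simp only [hw0, if_true]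
    by_cases hw1 : ∀ t : Fin L, w t.castSucc ≠ w t.succ
    · have h : ∑ Y : Pair s → Fin 3, ∏ t : Fin L, ternaryMatrix Y (w t.castSucc) (w t.succ)
          = ∏ p : Pair s, ∑ c, ternary c ^ edgeCount w p := by
        rw [Finset.prod_univ_sum, Fintype.piFinset_univ]
        refine Finset.sum_congr rfl fun Y _ => ?_
        rw [prod_walk_eq (ternaryMatrix_isSymm Y) hw1]
        simp only [ternaryMatrix_pair]
      rw [h]
      split_ifs with hgood
      · rw [Nat.cast_one, mul_one, ← Finset.card_univ, ← Finset.prod_const]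
        exact Finset.prod_le_prod (fun _ _ => by norm_num)
          fun p _ => three_le_sum_ternary_pow (hgood.2.2 p)
      · rw [Nat.cast_zero, mul_zero]
        exact Finset.prod_nonneg fun p _ => sum_ternary_pow_nonneg _
    · rw [if_neg fun h => hw1 h.2.1, Nat.cast_zero, mul_zero]
      push Not at hw1
      obtain ⟨t, ht⟩ := hw1
      refine (Finset.sum_eq_zero fun Y _ => Finset.prod_eq_zero (Finset.mem_univ t) ?_).ge
      rw [ht, ternaryMatrix_self]
  · rw [if_neg fun h => hw0 h.1]
    simp [hw0]

end Walks

end LatentSpace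

namespace LatentSpace

/-! ### Norms and traces of symmetric matrices -/

section Symmetric

variable {s : ℕ}

lemma opNorm_pow_le (B : Matrix (Fin s) (Fin s) ℝ) (m : ℕ) : opNorm (B ^ m) ≤ opNorm B ^ m := by
  induction m with
  | zero =>
    rw [pow_zero, pow_zero]
    refine opNorm_le_of_mulVec zero_le_one fun v => ?_
    rw [Matrix.one_mulVec, one_mul]
  | succ m ih =>
    rw [pow_succ, pow_succ]
    exact (opNorm_mul_le _ _).trans (mul_le_mul_of_nonneg_right ih (opNorm_nonneg _))

lemma frobNorm_pow_sq_eq_trace {B : Matrix (Fin s) (Fin s) ℝ} (hB : B.IsSymm) (m : ℕ) :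
    frobNorm (B ^ m) ^ 2 = (B ^ (2 * m)).trace := by
  rw [← frobInner_self, frobInner, Matrix.transpose_pow, hB, ← pow_add, two_mul]

lemma trace_pow_le {B : Matrix (Fin s) (Fin s) ℝ} (hB : B.IsSymm) (m : ℕ) :
    (B ^ (2 * m)).trace ≤ s * opNorm B ^ (2 * m) := by
  rw [← frobNorm_pow_sq_eq_trace hB]
  have h := (frobNorm_le_sqrt_mul_opNorm (B ^ m)).trans
    (mul_le_mul_of_nonneg_left (opNorm_pow_le B m) (Real.sqrt_nonneg _))
  have h2 := pow_le_pow_left₀ (frobNorm_nonneg _) h 2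
  rwa [mul_pow, Real.sq_sqrt (Nat.cast_nonneg _), ← pow_mul, mul_comm m] at h2

open scoped Matrix.Norms.L2Operator in
lemma opNorm_mul_self {B : Matrix (Fin s) (Fin s) ℝ} (hB : B.IsSymm) :
    opNorm (B * B) = opNorm B ^ 2 := by
  have h := Matrix.l2_opNorm_conjTranspose_mul_self B
  rw [Matrix.conjTranspose_eq_transpose_of_trivial, hB] at h
  rw [sq]
  exact h

/-- Powers of two come from iterating `‖B²‖ = ‖B‖²`, and they are all that the trace method needs;
no diagonalization is involved. -/
lemma opNorm_pow_two_pow {B : Matrix (Fin s) (Fin s) ℝ} (hB : B.IsSymm) (j : ℕ) :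
    opNorm (B ^ 2 ^ j) = opNorm B ^ 2 ^ j := by
  induction j with
  | zero => simp
  | succ j ih =>
    have h : (B ^ 2 ^ j).IsSymm := by rw [Matrix.IsSymm, Matrix.transpose_pow, hB]
    rw [pow_succ 2 j, pow_mul, pow_mul, sq (B ^ 2 ^ j), opNorm_mul_self h, ih]

lemma opNorm_pow_le_trace {B : Matrix (Fin s) (Fin s) ℝ} (hB : B.IsSymm) (j : ℕ) :
    opNorm B ^ 2 ^ (j + 1) ≤ (B ^ 2 ^ (j + 1)).trace := by
  rw [pow_succ' 2 j, ← frobNorm_pow_sq_eq_trace hB, mul_comm, pow_mul, ← opNorm_pow_two_pow hB]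
  exact pow_le_pow_left₀ (opNorm_nonneg _) (opNorm_le_frobNorm _) 2

lemma dotProduct_mulVec_comm {B : Matrix (Fin s) (Fin s) ℝ} (hB : B.IsSymm) (v w : Fin s → ℝ) :
    v ⬝ᵥ (B *ᵥ w) = w ⬝ᵥ (B *ᵥ v) := by
  rw [Matrix.dotProduct_mulVec, ← Matrix.mulVec_transpose, hB, dotProduct_comm]

lemma opNorm_le_of_quadForm {B : Matrix (Fin s) (Fin s) ℝ} (hB : B.IsSymm) {c : ℝ} (hc : 0 ≤ c)
    (h : ∀ v, |v ⬝ᵥ (B *ᵥ v)| ≤ c * (v ⬝ᵥ v)) : opNorm B ≤ c := by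
  refine opNorm_le_of_mulVec hc fun v => ?_
  set w := B *ᵥ v with hw
  -- polarization with the vectors `‖w‖ v ± ‖v‖ w`
  set p := vecNorm v
  set q := vecNorm w
  have hp2 : p ^ 2 = v ⬝ᵥ v := vecNorm_sq_eq_dotProduct v
  have hq2 : q ^ 2 = w ⬝ᵥ w := vecNorm_sq_eq_dotProduct w
  have hp0 : 0 ≤ p := vecNorm_nonneg _
  have hq0 : 0 ≤ q := vecNorm_nonneg _
  have h1 := (abs_le.mp (h (q • v + p • w))).2
  have h2 := (abs_le.mp (h (q • v - p • w))).1
  have hc1 : v ⬝ᵥ (B *ᵥ w) = w ⬝ᵥ w := by rw [dotProduct_mulVec_comm hB]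
  simp only [Matrix.mulVec_add, Matrix.mulVec_sub, Matrix.mulVec_smul, add_dotProduct,
    sub_dotProduct, dotProduct_add, dotProduct_sub, smul_dotProduct, dotProduct_smul, smul_eq_mul,
    hc1, ← hw, ← hp2, ← hq2] at h1 h2
  have h3 : p * q * q ^ 2 ≤ p * q * (c * (p * q)) := by nlinarith
  rcases hq0.eq_or_lt with h0 | h0
  · rw [← h0]; positivity
  rcases hp0.eq_or_lt with h00 | h00
  · have := vecNorm_mulVec_le B v
    change q ≤ opNorm B * p at this
    rw [← h00] at this ⊢
    linarith
  · have h4 := le_of_mul_le_mul_left h3 (by positivity)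
    nlinarith

/-- The quadratic form of a symmetric matrix is large on a ball of radius `1 / 8`. -/
lemma exists_ball_quadForm_ge {B : Matrix (Fin s) (Fin s) ℝ} (hB : B.IsSymm) :
    ∃ v : Fin s → ℝ, vecNorm v ≤ 1 ∧
      ∀ u, vecNorm u ≤ 1 / 8 → opNorm B / 2 ≤ |(v + u) ⬝ᵥ (B *ᵥ (v + u))| := by
  rcases (opNorm_nonneg B).eq_or_lt with h0 | h0
  · refine ⟨0, by simp [vecNorm], fun u _ => ?_⟩
    rw [← h0, zero_div]
    exact abs_nonneg _
  -- A unit vector reaching 7/8 of the norm loses at most `2/8 + 1/64` under a perturbation of size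
  -- 1/8, so more than one half remains.
  · have h1 : ¬ ∀ v, |v ⬝ᵥ (B *ᵥ v)| ≤ 7 / 8 * opNorm B * (v ⬝ᵥ v) := fun h => by
      have := opNorm_le_of_quadForm hB (by positivity) h
      linarith
    push Not at h1
    obtain ⟨w, hw⟩ := h1
    have hw0 : 0 < vecNorm w := by
      refine lt_of_le_of_ne (vecNorm_nonneg _) fun h => ?_
      rw [vecNorm_eq_zero.mp h.symm] at hw
      simp at hw
    have hww : w ⬝ᵥ w = vecNorm w ^ 2 := (vecNorm_sq_eq_dotProduct w).symm
    have hv1 : vecNorm ((vecNorm w)⁻¹ • w) = 1 := by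
      rw [← sq_eq_sq₀ (vecNorm_nonneg _) zero_le_one, vecNorm_sq_eq_dotProduct, smul_dotProduct,
        dotProduct_smul, hww, smul_eq_mul, smul_eq_mul]
      field_simp
    refine ⟨(vecNorm w)⁻¹ • w, hv1.le, fun u hu => ?_⟩
    have hv2 : 7 / 8 * opNorm B ≤ |((vecNorm w)⁻¹ • w) ⬝ᵥ (B *ᵥ ((vecNorm w)⁻¹ • w))| := by
      rw [Matrix.mulVec_smul, smul_dotProduct, dotProduct_smul, smul_eq_mul, smul_eq_mul, abs_mul,
        abs_mul, abs_of_pos (inv_pos.mpr hw0), ← mul_assoc, ← mul_inv,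
        le_inv_mul_iff₀ (by positivity), ← sq, ← hww, mul_comm]
      exact hw.le
    set v := (vecNorm w)⁻¹ • w
    have e : (v + u) ⬝ᵥ (B *ᵥ (v + u)) = v ⬝ᵥ (B *ᵥ v) + (2 * (u ⬝ᵥ (B *ᵥ v)) + u ⬝ᵥ (B *ᵥ u)) := by
      rw [Matrix.mulVec_add, add_dotProduct, dotProduct_add, dotProduct_add,
        dotProduct_mulVec_comm hB v u]
      ring
    have hu0 := vecNorm_nonneg u
    have e1 : |u ⬝ᵥ (B *ᵥ v)| ≤ 1 / 8 * opNorm B := by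
      refine (abs_dotProduct_le _ _).trans ?_
      have := vecNorm_mulVec_le B v
      rw [hv1, mul_one] at this
      exact mul_le_mul hu this (vecNorm_nonneg _) (by norm_num)
    have e2 : |u ⬝ᵥ (B *ᵥ u)| ≤ 1 / 8 * (opNorm B * (1 / 8)) := by
      refine (abs_dotProduct_le _ _).trans ?_
      refine mul_le_mul hu ((vecNorm_mulVec_le B u).trans ?_) (vecNorm_nonneg _) (by norm_num)
      exact mul_le_mul_of_nonneg_left hu (opNorm_nonneg _)
    have e3 := abs_sub_abs_le_abs_sub (v ⬝ᵥ (B *ᵥ v)) (-(2 * (u ⬝ᵥ (B *ᵥ v)) + u ⬝ᵥ (B *ᵥ u)))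
    rw [abs_neg, sub_neg_eq_add, ← e] at e3
    have e4 : |2 * (u ⬝ᵥ (B *ᵥ v)) + u ⬝ᵥ (B *ᵥ u)| ≤ 2 * |u ⬝ᵥ (B *ᵥ v)| + |u ⬝ᵥ (B *ᵥ u)| := by
      refine (abs_add_le _ _).trans ?_
      rw [abs_mul, abs_two]
    linarith

/-- The quadratic form as a function on Euclidean space. -/
def quadForm (B : Matrix (Fin s) (Fin s) ℝ) (y : EuclideanSpace ℝ (Fin s)) : ℝ :=
  y.ofLp ⬝ᵥ (B *ᵥ y.ofLp)

lemma continuous_quadForm (B : Matrix (Fin s) (Fin s) ℝ) : Continuous (quadForm B) := by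
  unfold quadForm dotProduct Matrix.mulVec dotProduct
  fun_prop

/-- The exponential moments of the quadratic form control the operator norm. -/
lemma exp_opNorm_le_integral {B : Matrix (Fin s) (Fin s) ℝ} (hB : B.IsSymm) {c : ℝ} (hc : 0 ≤ c) :
    Real.exp (c * opNorm B / 2)
        * volume.real (Metric.closedBall (0 : EuclideanSpace ℝ (Fin s)) 2)
      ≤ 16 ^ s * ∫ y in Metric.closedBall (0 : EuclideanSpace ℝ (Fin s)) 2,
        (Real.exp (c * quadForm B y) + Real.exp (-(c * quadForm B y))) := by
  obtain ⟨v, hv, hvu⟩ := exists_ball_quadForm_ge hB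
  set f : EuclideanSpace ℝ (Fin s) → ℝ := fun y =>
    Real.exp (c * quadForm B y) + Real.exp (-(c * quadForm B y)) with hf
  have hfc : Continuous f := by
    have := continuous_quadForm B
    fun_prop
  have hint : IntegrableOn f (Metric.closedBall (0 : EuclideanSpace ℝ (Fin s)) 2) :=
    hfc.continuousOn.integrableOn_compact (isCompact_closedBall _ _)
  have hsub : Metric.closedBall (WithLp.toLp 2 v) (1 / 16 * 2)
      ⊆ Metric.closedBall (0 : EuclideanSpace ℝ (Fin s)) 2 := by
    refine Metric.closedBall_subset_closedBall' ?_
    have : dist (WithLp.toLp 2 v) 0 ≤ 1 := by rw [dist_zero_right]; exact hv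
    linarith
  have hlow : ∀ y ∈ Metric.closedBall (WithLp.toLp 2 v) (1 / 16 * 2),
      Real.exp (c * opNorm B / 2) ≤ f y := by
    intro y hy
    have h1 := hvu (y - WithLp.toLp 2 v).ofLp (by
      rw [Metric.mem_closedBall, dist_eq_norm] at hy
      have : vecNorm (y - WithLp.toLp 2 v).ofLp = ‖y - WithLp.toLp 2 v‖ := rfl
      rw [this]
      linarith)
    have h2 : v + (y - WithLp.toLp 2 v).ofLp = y.ofLp := by
      ext i; simp
    rw [h2] at h1
    change _ ≤ |quadForm B y| at h1
    have h3 : c * opNorm B / 2 ≤ c * |quadForm B y| := by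
      have := mul_le_mul_of_nonneg_left h1 hc
      linarith
    refine (Real.exp_le_exp.mpr h3).trans ?_
    simp only [hf]
    rcases abs_cases (quadForm B y) with ⟨h, -⟩ | ⟨h, -⟩
    · rw [h]; linarith [Real.exp_pos (-(c * quadForm B y))]
    · rw [h, mul_neg]; linarith [Real.exp_pos (c * quadForm B y)]
  -- A small ball takes the place of a net: it is the fraction `16^{-s}` of the ball of radius 2,
  -- and on all of it the integrand is large.
  have hvol : volume.real (Metric.closedBall (WithLp.toLp 2 v) (1 / 16 * 2))
      = (1 / 16) ^ s * volume.real (Metric.closedBall (0 : EuclideanSpace ℝ (Fin s)) 2) := by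
    rw [Measure.real, Measure.addHaar_closedBall_mul_of_pos _ _ (by norm_num), ENNReal.toReal_mul,
      ENNReal.toReal_ofReal (by positivity), finrank_euclideanSpace_fin]
    rfl
  have h1 := setIntegral_ge_of_const_le measurableSet_closedBall
    (measure_closedBall_lt_top).ne hlow (hint.mono_set hsub)
  have h2 := setIntegral_mono_set hint (ae_of_all _ fun y => by simp only [hf, Pi.zero_apply]; positivity)
    hsub.eventuallyLE
  have h3 := h1.trans h2
  rw [hvol, smul_eq_mul] at h3
  have h4 := mul_le_mul_of_nonneg_left h3 (show (0 : ℝ) ≤ 16 ^ s by positivity)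
  refine le_trans (le_of_eq ?_) h4
  rw [one_div, inv_pow]
  field_simp

end Symmetric

/-! ### Sums over pairs -/

section Pairs

variable {s : ℕ}

lemma sum_sum_eq_two_mul_sum_pair {F : Fin s → Fin s → ℝ} (hF : ∀ a b, F a b = F b a)
    (h0 : ∀ a, F a a = 0) : ∑ a, ∑ b, F a b = 2 * ∑ p : Pair s, F p.1.1 p.1.2 := by
  have h1 : ∑ p : Pair s, F p.1.1 p.1.2
      = ∑ x : Fin s × Fin s, if x.1 < x.2 then F x.1 x.2 else 0 := by
    rw [← Finset.sum_filter]
    exact (Finset.sum_subtype (Finset.univ.filter fun x : Fin s × Fin s => x.1 < x.2)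
      (fun x => by simp) (fun x => F x.1 x.2)).symm
  have h2 : ∑ a, ∑ b, F a b = ∑ x : Fin s × Fin s, ((if x.1 < x.2 then F x.1 x.2 else 0)
      + if x.2 < x.1 then F x.1 x.2 else 0) := by
    rw [← Fintype.sum_prod_type']
    refine Finset.sum_congr rfl fun x _ => ?_
    rcases lt_trichotomy x.1 x.2 with h | h | h
    · simp [h, h.not_gt]
    · simp [h, h0]
    · simp [h, h.not_gt]
  have h3 : ∑ x : Fin s × Fin s, (if x.2 < x.1 then F x.1 x.2 else 0)
      = ∑ x : Fin s × Fin s, if x.1 < x.2 then F x.1 x.2 else 0 := by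
    refine Fintype.sum_equiv (Equiv.prodComm (Fin s) (Fin s)) _ _ fun ⟨a, b⟩ => ?_
    change (if b < a then F a b else 0) = if b < a then F b a else 0
    rw [hF]
  rw [h2, Finset.sum_add_distrib, h3, ← h1, two_mul]

/-- For a mean zero variable the linear term disappears after averaging, which leaves a subgaussian
bound. -/
lemma exp_le_add_exp_sq (x : ℝ) : Real.exp x ≤ x + Real.exp (x ^ 2) := by
  have h0 := Real.add_one_le_exp (x ^ 2)
  rcases le_or_gt |x| 1 with h | h
  · have := (abs_le.mp (Real.abs_exp_sub_one_sub_id_le h)).2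
    linarith
  · rcases lt_abs.mp h with h | h
    · have : Real.exp x ≤ Real.exp (x ^ 2) := Real.exp_le_exp.mpr (by nlinarith)
      linarith
    · have : Real.exp x ≤ 1 := Real.exp_le_one_iff.mpr (by linarith)
      nlinarith

lemma sum_exp_ternary_le (t : ℝ) : ∑ c, Real.exp (t * ternary c) ≤ 3 * Real.exp (4 * t ^ 2) := by
  have h1 := exp_le_add_exp_sq (t * 2)
  have h2 := exp_le_add_exp_sq (t * -1)
  have h3 : Real.exp ((t * -1) ^ 2) ≤ Real.exp (4 * t ^ 2) :=
    Real.exp_le_exp.mpr (by nlinarith [sq_nonneg t])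
  have h4 : Real.exp ((t * 2) ^ 2) = Real.exp (4 * t ^ 2) := by ring_nf
  simp only [Fin.sum_univ_three, ternary, Fin.isValue, if_true, one_ne_zero, if_false,
    show (2 : Fin 3) ≠ 0 by decide]
  linarith

lemma quadForm_ternaryMatrix (Y : Pair s → Fin 3) (y : EuclideanSpace ℝ (Fin s)) :
    quadForm (ternaryMatrix Y) y
      = ∑ p : Pair s, 2 * (y p.1.1 * y p.1.2) * ternary (Y p) := by
  have h := sum_sum_eq_two_mul_sum_pair (F := fun a b => y a * (ternaryMatrix Y a b * y b))
    (fun a b => by rw [(ternaryMatrix_isSymm Y).apply]; ring)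
    (fun a => by rw [ternaryMatrix_self]; ring)
  have h1 : quadForm (ternaryMatrix Y) y = ∑ a, ∑ b, y a * (ternaryMatrix Y a b * y b) := by
    simp only [quadForm, dotProduct, Matrix.mulVec, Finset.mul_sum]
  rw [h1, h, Finset.mul_sum]
  refine Finset.sum_congr rfl fun p _ => ?_
  rw [ternaryMatrix_pair]
  ring

lemma sum_pair_sq_le (y : EuclideanSpace ℝ (Fin s)) :
    2 * ∑ p : Pair s, (y p.1.1 * y p.1.2) ^ 2 ≤ ‖y‖ ^ 4 := by
  have h := sum_sum_eq_two_mul_sum_pair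
    (F := fun a b : Fin s => if a = b then 0 else (y a * y b) ^ 2)
    (fun a b => by simp only [eq_comm, mul_comm]) (fun a => by simp)
  have h1 : ∑ p : Pair s, (y p.1.1 * y p.1.2) ^ 2
      = ∑ p : Pair s, if p.1.1 = p.1.2 then 0 else (y p.1.1 * y p.1.2) ^ 2 :=
    Finset.sum_congr rfl fun p _ => (if_neg p.2.ne).symm
  rw [h1, ← h]
  have h2 : ‖y‖ ^ 4 = ∑ a, ∑ b, (y a * y b) ^ 2 := by
    rw [show (4 : ℕ) = 2 * 2 by norm_num, pow_mul, EuclideanSpace.norm_sq_eq, sq,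
      Finset.sum_mul_sum]
    simp only [Real.norm_eq_abs, sq_abs, mul_pow]
  rw [h2]
  refine Finset.sum_le_sum fun a _ => Finset.sum_le_sum fun b _ => ?_
  split_ifs
  · positivity
  · exact le_rfl

/-- For fixed `y` the form is linear in the independent entries, so the sum over all `Y` factors
over pairs. The exponents add up to `8c²‖y‖⁴`, and `8 · 2⁴ = 128`. -/
lemma sum_exp_quadForm_le (c : ℝ) {y : EuclideanSpace ℝ (Fin s)} (hy : ‖y‖ ≤ 2) :
    ∑ Y : Pair s → Fin 3, Real.exp (c * quadForm (ternaryMatrix Y) y)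
      ≤ 3 ^ Fintype.card (Pair s) * Real.exp (128 * c ^ 2) := by
  have h1 : ∀ Y : Pair s → Fin 3, Real.exp (c * quadForm (ternaryMatrix Y) y)
      = ∏ p : Pair s, Real.exp (2 * c * (y p.1.1 * y p.1.2) * ternary (Y p)) := by
    intro Y
    rw [quadForm_ternaryMatrix, ← Real.exp_sum, Finset.mul_sum]
    congr 1
    exact Finset.sum_congr rfl fun p _ => by ring
  have h2 := Finset.prod_univ_sum (fun _ : Pair s => (Finset.univ : Finset (Fin 3)))
    (fun p d => Real.exp (2 * c * (y p.1.1 * y p.1.2) * ternary d))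
  rw [Fintype.piFinset_univ] at h2
  simp only [h1]
  rw [← h2]
  refine (Finset.prod_le_prod (fun p _ => Finset.sum_nonneg fun d _ => (Real.exp_pos _).le)
    fun p _ => sum_exp_ternary_le _).trans ?_
  rw [Finset.prod_mul_distrib, Finset.prod_const, Finset.card_univ, ← Real.exp_sum]
  refine mul_le_mul_of_nonneg_left (Real.exp_le_exp.mpr ?_) (by positivity)
  have h3 := sum_pair_sq_le y
  have h4 := pow_le_pow_left₀ (norm_nonneg y) hy 4
  have h5 : ∑ p : Pair s, 4 * (2 * c * (y p.1.1 * y p.1.2)) ^ 2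
      = 8 * c ^ 2 * (2 * ∑ p : Pair s, (y p.1.1 * y p.1.2) ^ 2) := by
    simp only [Finset.mul_sum]
    exact Finset.sum_congr rfl fun p _ => by ring
  rw [h5]
  have := mul_le_mul_of_nonneg_left (h3.trans h4) (show 0 ≤ 8 * c ^ 2 by positivity)
  linarith

/-- The maximum over directions is replaced by an integral over the ball, which commutes with the
sum over `Y`. The cost is `16^s`, and the 2 accounts for both signs of the form. -/
lemma sum_exp_opNorm_le (s : ℕ) {c : ℝ} (hc : 0 ≤ c) :
    ∑ Y : Pair s → Fin 3, Real.exp (c * opNorm (ternaryMatrix Y) / 2)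
      ≤ 2 * 16 ^ s * (3 ^ Fintype.card (Pair s) * Real.exp (128 * c ^ 2)) := by
  set K := Metric.closedBall (0 : EuclideanSpace ℝ (Fin s)) 2 with hK
  have hKc : IsCompact K := isCompact_closedBall _ _
  have hv : 0 < volume.real K :=
    ENNReal.toReal_pos (Metric.measure_closedBall_pos _ _ (by norm_num)).ne'
      (measure_closedBall_lt_top).ne
  have hcont : ∀ Y : Pair s → Fin 3, Continuous fun y : EuclideanSpace ℝ (Fin s) =>
      Real.exp (c * quadForm (ternaryMatrix Y) y)
        + Real.exp (-(c * quadForm (ternaryMatrix Y) y)) := by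
    intro Y
    have := continuous_quadForm (ternaryMatrix Y)
    fun_prop
  refine le_of_mul_le_mul_right ?_ hv
  calc (∑ Y : Pair s → Fin 3, Real.exp (c * opNorm (ternaryMatrix Y) / 2)) * volume.real K
      ≤ ∑ Y : Pair s → Fin 3, 16 ^ s * ∫ y in K, (Real.exp (c * quadForm (ternaryMatrix Y) y)
        + Real.exp (-(c * quadForm (ternaryMatrix Y) y))) := by
        rw [Finset.sum_mul]
        exact Finset.sum_le_sum fun Y _ => exp_opNorm_le_integral (ternaryMatrix_isSymm Y) hc
    _ = 16 ^ s * ∫ y in K, ∑ Y : Pair s → Fin 3, (Real.exp (c * quadForm (ternaryMatrix Y) y)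
        + Real.exp (-(c * quadForm (ternaryMatrix Y) y))) := by
        rw [← Finset.mul_sum, integral_finsetSum]
        exact fun Y _ => (hcont Y).continuousOn.integrableOn_compact hKc
    _ ≤ 16 ^ s * ∫ y in K, 2 * (3 ^ Fintype.card (Pair s) * Real.exp (128 * c ^ 2)) := by
        refine mul_le_mul_of_nonneg_left ?_ (by positivity)
        refine setIntegral_mono_on ?_ ?_ measurableSet_closedBall fun y hy => ?_
        · exact (continuous_finsetSum _ fun Y _ => hcont Y).continuousOn.integrableOn_compact hKc
        · exact continuous_const.continuousOn.integrableOn_compact hKc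
        · have hy' : ‖y‖ ≤ 2 := by simpa [hK] using hy
          have h1 := sum_exp_quadForm_le c hy'
          have h2 := sum_exp_quadForm_le (-c) hy'
          simp only [neg_mul, neg_sq] at h2
          rw [Finset.sum_add_distrib]
          linarith
    _ = _ := by
        rw [setIntegral_const, smul_eq_mul]
        ring

/-- The number of good walks. -/
lemma goodWalkCount_le_exp (s m : ℕ) {c : ℝ} (hc : 0 < c) :
    (goodWalkCount s (2 * m) : ℝ)
      ≤ 2 * 32 ^ s * ((2 * m).factorial * (2 / c) ^ (2 * m) * Real.exp (128 * c ^ 2)) := by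
  have h1 := goodWalkCount_le s (2 * m)
  have h2 : ∀ Y : Pair s → Fin 3, (ternaryMatrix Y ^ (2 * m)).trace
      ≤ s * ((2 * m).factorial * (2 / c) ^ (2 * m))
        * Real.exp (c * opNorm (ternaryMatrix Y) / 2) := by
    intro Y
    refine (trace_pow_le (ternaryMatrix_isSymm Y) m).trans ?_
    rw [mul_assoc]
    refine mul_le_mul_of_nonneg_left ?_ (Nat.cast_nonneg _)
    -- The trace is at most `s‖Y‖^{2m}`, and `x^{2m} ≤ (2m)! e^x` converts this to an exponential
    -- moment with the free parameter `c`.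
    have h3 := Real.pow_div_factorial_le_exp (c * opNorm (ternaryMatrix Y) / 2)
      (by have := opNorm_nonneg (ternaryMatrix Y); positivity) (2 * m)
    rw [div_le_iff₀ (by positivity)] at h3
    have h4 := mul_le_mul_of_nonneg_left h3 (show 0 ≤ (2 / c) ^ (2 * m) by positivity)
    rw [← mul_pow] at h4
    have h5 : 2 / c * (c * opNorm (ternaryMatrix Y) / 2) = opNorm (ternaryMatrix Y) := by
      field_simp
    rw [h5] at h4
    linarith
  have h3 := h1.trans (Finset.sum_le_sum fun Y _ => h2 Y)
  rw [← Finset.mul_sum] at h3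
  have h4 := h3.trans (mul_le_mul_of_nonneg_left (sum_exp_opNorm_le s hc.le) (by positivity))
  have h5 : (s : ℝ) * 16 ^ s ≤ 32 ^ s := by
    have : (s : ℝ) ≤ 2 ^ s := by exact_mod_cast (Nat.lt_two_pow_self (n := s)).le
    calc (s : ℝ) * 16 ^ s ≤ 2 ^ s * 16 ^ s := by gcongr
      _ = 32 ^ s := by rw [← mul_pow]; norm_num
  have hP : (0 : ℝ) < 3 ^ Fintype.card (Pair s) := by positivity
  refine le_of_mul_le_mul_left (h4.trans ?_) hP
  have h6 := mul_le_mul_of_nonneg_right h5 (show 0 ≤ 2 * 3 ^ Fintype.card (Pair s)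
    * ((2 * m).factorial * (2 / c) ^ (2 * m) * Real.exp (128 * c ^ 2)) by positivity)
  linarith

/-- The sum over good walks that dominates the moments of a sparse random matrix. -/
lemma sum_goodWalks_le_exp (s m : ℕ) {p c : ℝ} (hp0 : 0 ≤ p) (hp1 : p ≤ 1) (hc : 0 < c) :
    ∑ w : Fin (2 * m + 1) → Fin s with IsGoodWalk w, p ^ (Finset.univ.image w).card
      ≤ 2 * Real.exp (31 * (s * p))
        * ((2 * m).factorial * (2 / c) ^ (2 * m) * Real.exp (128 * c ^ 2)) := by
  refine (sum_goodWalks_pow_card_le hp0 hp1 fun r => goodWalkCount_le_exp r m hc).trans ?_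
  set Q : ℝ := (2 * m).factorial * (2 / c) ^ (2 * m) * Real.exp (128 * c ^ 2)
  have hQ : 0 ≤ Q := by positivity
  have h1 : ∑ S : Finset (Fin s), p ^ S.card * (1 - p) ^ (s - S.card) * (2 * 32 ^ S.card * Q)
      = 2 * Q * ∑ S : Finset (Fin s), (32 * p) ^ S.card * (1 - p) ^ (s - S.card) := by
    rw [Finset.mul_sum]
    refine Finset.sum_congr rfl fun S _ => ?_
    rw [mul_pow]; ring
  -- The count grows like `32^{|S|}`, and its average over the random set is `(1 + 31p)^s`: the
  -- dense bound on a set of about `sp` vertices becomes the sparse bound.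
  have h2 : ∑ S : Finset (Fin s), (32 * p) ^ S.card * (1 - p) ^ (s - S.card)
      = (32 * p + (1 - p)) ^ s := by
    have := Fin.sum_pow_mul_eq_add_pow (n := s) (32 * p) (1 - p)
    exact this
  have h3 : (32 * p + (1 - p)) ^ s ≤ Real.exp (31 * (s * p)) := by
    have : 32 * p + (1 - p) ≤ Real.exp (31 * p) := by
      have := Real.add_one_le_exp (31 * p); linarith
    calc (32 * p + (1 - p)) ^ s ≤ Real.exp (31 * p) ^ s := pow_le_pow_left₀ (by linarith) this s
      _ = _ := by rw [← Real.exp_nat_mul]; ring_nf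
  rw [h1, h2]
  have := mul_le_mul_of_nonneg_left h3 (show 0 ≤ 2 * Q by positivity)
  linarith

end Pairs

end LatentSpace

namespace LatentSpace

/-! ### The noise of a random network -/

section Noise

variable {n L : ℕ} {Ω : Type*} [MeasurableSpace Ω] {μ : Measure Ω}
  {Θ : Matrix (Fin n) (Fin n) ℝ} {A : Ω → Matrix (Fin n) (Fin n) ℝ}

/-- The off-diagonal part of `A - σ(Θ)`. -/
noncomputable def offNoise (Θ A : Matrix (Fin n) (Fin n) ℝ) : Matrix (Fin n) (Fin n) ℝ :=
  Matrix.of fun i j => if i = j then 0 else A i j - sigmoidMat Θ i j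

lemma offNoise_self (Θ A : Matrix (Fin n) (Fin n) ℝ) (i : Fin n) : offNoise Θ A i i = 0 := by
  simp [offNoise]

lemma offNoise_of_ne (Θ A : Matrix (Fin n) (Fin n) ℝ) {i j : Fin n} (h : i ≠ j) :
    offNoise Θ A i j = A i j - Real.sigmoid (Θ i j) := by
  simp [offNoise, h, sigmoidMat]

lemma offNoise_isSymm {Θ A : Matrix (Fin n) (Fin n) ℝ} (hΘ : Θ.IsSymm) (hA : A.IsSymm) :
    (offNoise Θ A).IsSymm := by
  ext i j
  simp only [offNoise, sigmoidMat, Matrix.transpose_apply, Matrix.of_apply, Matrix.map_apply]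
  rw [hΘ.apply, hA.apply]
  simp only [eq_comm]

/-- The diagonal of `A` vanishes but that of `σ(Θ)` does not; as a diagonal matrix with entries in
[-1, 0] it costs at most 1. -/
lemma opNorm_sub_le_offNoise (Θ : Matrix (Fin n) (Fin n) ℝ) {A : Matrix (Fin n) (Fin n) ℝ}
    (hA : ∀ i, A i i = 0) : opNorm (A - sigmoidMat Θ) ≤ opNorm (offNoise Θ A) + 1 := by
  have e : A - sigmoidMat Θ = offNoise Θ A
      + Matrix.diagonal fun i => -Real.sigmoid (Θ i i) := by
    ext i j
    by_cases h : i = j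
    · subst h
      simp [offNoise, sigmoidMat, hA]
    · simp [offNoise, sigmoidMat, h]
  rw [e]
  refine (opNorm_add_le _ _).trans (add_le_add le_rfl (opNorm_le_of_mulVec zero_le_one fun v => ?_))
  rw [one_mul, ← sq_le_sq₀ (vecNorm_nonneg _) (vecNorm_nonneg _), vecNorm_sq, vecNorm_sq]
  refine Finset.sum_le_sum fun i _ => ?_
  rw [Matrix.mulVec_diagonal, mul_pow, neg_sq]
  exact mul_le_of_le_one_left (sq_nonneg _)
    (pow_le_one₀ (Real.sigmoid_nonneg _) (Real.sigmoid_le_one _))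

/-- The centered indicator of an edge. -/
noncomputable def edgeNoise (Θ : Matrix (Fin n) (Fin n) ℝ) (A : Ω → Matrix (Fin n) (Fin n) ℝ) (e : Pair n)
    (ω : Ω) : ℝ := A ω e.1.1 e.1.2 - Real.sigmoid (Θ e.1.1 e.1.2)

namespace IsRandomNetwork

lemma integral_entry (h : IsRandomNetwork μ Θ A) (e : Pair n) :
    ∫ ω, A ω e.1.1 e.1.2 ∂μ = Real.sigmoid (Θ e.1.1 e.1.2) := by
  have h1 : (fun ω => A ω e.1.1 e.1.2) = {ω | A ω e.1.1 e.1.2 = 1}.indicator 1 := by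
    ext ω
    rcases (h.adjacency ω).2.2 e.1.1 e.1.2 with h0 | h0 <;> simp [Set.indicator, h0]
  have hm : MeasurableSet {ω | A ω e.1.1 e.1.2 = 1} :=
    h.measurable _ _ (measurableSet_singleton 1)
  rw [h1, integral_indicator_one hm, Measure.real, h.prob _ _ e.2,
    ENNReal.toReal_ofReal (Real.sigmoid_nonneg _)]

lemma measurable_edgeNoise (h : IsRandomNetwork μ Θ A) (e : Pair n) :
    Measurable (edgeNoise Θ A e) :=
  (h.measurable _ _).sub_const _

lemma abs_edgeNoise_le (h : IsRandomNetwork μ Θ A) (e : Pair n) (ω : Ω) :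
    |edgeNoise Θ A e ω| ≤ 1 := by
  have h1 := Real.sigmoid_nonneg (Θ e.1.1 e.1.2)
  have h2 := Real.sigmoid_le_one (Θ e.1.1 e.1.2)
  unfold edgeNoise
  rcases (h.adjacency ω).2.2 e.1.1 e.1.2 with h0 | h0 <;> rw [h0, abs_le] <;>
    constructor <;> linarith

lemma iIndepFun_edgeNoise (h : IsRandomNetwork μ Θ A) : iIndepFun (edgeNoise Θ A) μ :=
  h.indep.comp (fun e x => x - Real.sigmoid (Θ e.1.1 e.1.2)) fun _ => measurable_id.sub_const _

lemma abs_offNoise_le (h : IsRandomNetwork μ Θ A) (ω : Ω) (i j : Fin n) :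
    |offNoise Θ (A ω) i j| ≤ 1 := by
  by_cases hij : i = j
  · simp [hij, offNoise_self]
  · rw [offNoise_of_ne _ _ hij]
    have h1 := Real.sigmoid_nonneg (Θ i j)
    have h2 := Real.sigmoid_le_one (Θ i j)
    rcases (h.adjacency ω).2.2 i j with h0 | h0 <;> rw [h0, abs_le] <;> constructor <;> linarith

lemma measurable_offNoise (h : IsRandomNetwork μ Θ A) (i j : Fin n) :
    Measurable fun ω => offNoise Θ (A ω) i j := by
  by_cases hij : i = j
  · simp only [hij, offNoise_self]; exact measurable_const
  · simp only [offNoise_of_ne _ _ hij]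
    exact (h.measurable i j).sub_const _

lemma hasSubgaussianMGF_mul_of_sq_eq_one {Y : Ω → ℝ} {v : NNReal} (hY : HasSubgaussianMGF Y v μ)
    {c : ℝ} (hc : c ^ 2 = 1) (x : ℝ) :
    HasSubgaussianMGF (fun ω => c * x * Y ω) (‖x‖₊ ^ 2 * v) μ := by
  have hc' : NNReal.mk ((c * x) ^ 2) (sq_nonneg _) = ‖x‖₊ ^ 2 := by
    refine NNReal.eq ?_
    rw [NNReal.coe_mk, NNReal.coe_pow, coe_nnnorm, Real.norm_eq_abs, sq_abs, mul_pow, hc, one_mul]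
  rw [← hc']
  exact hY.const_mul (c * x)

variable [IsProbabilityMeasure μ]

lemma integrable_entry (h : IsRandomNetwork μ Θ A) (i j : Fin n) :
    Integrable (fun ω => A ω i j) μ := by
  refine Integrable.of_bound (h.measurable i j).aestronglyMeasurable 1 (ae_of_all _ fun ω => ?_)
  rcases (h.adjacency ω).2.2 i j with h0 | h0 <;> simp [h0]

lemma integrable_edgeNoise_pow (h : IsRandomNetwork μ Θ A) (e : Pair n) (l : ℕ) :
    Integrable (fun ω => edgeNoise Θ A e ω ^ l) μ := by
  refine Integrable.of_bound ((h.measurable_edgeNoise e).pow_const l).aestronglyMeasurable 1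
    (ae_of_all _ fun ω => ?_)
  rw [norm_pow, Real.norm_eq_abs]
  exact pow_le_one₀ (abs_nonneg _) (h.abs_edgeNoise_le e ω)

lemma integral_edgeNoise (h : IsRandomNetwork μ Θ A) (e : Pair n) :
    ∫ ω, edgeNoise Θ A e ω ∂μ = 0 := by
  unfold edgeNoise
  rw [integral_sub (h.integrable_entry _ _) (integrable_const _), h.integral_entry]
  simp

lemma integral_edgeNoise_sq_le (h : IsRandomNetwork μ Θ A) (e : Pair n) :
    ∫ ω, edgeNoise Θ A e ω ^ 2 ∂μ ≤ Real.sigmoid (Θ e.1.1 e.1.2) := by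
  set q := Real.sigmoid (Θ e.1.1 e.1.2) with hq
  have h1 : ∀ ω, edgeNoise Θ A e ω ^ 2 = (1 - 2 * q) * A ω e.1.1 e.1.2 + q ^ 2 := by
    intro ω
    unfold edgeNoise
    rw [← hq]
    rcases (h.adjacency ω).2.2 e.1.1 e.1.2 with h0 | h0 <;> rw [h0] <;> ring
  simp only [h1]
  rw [integral_add ((h.integrable_entry _ _).const_mul _) (integrable_const _), integral_const_mul,
    h.integral_entry, ← hq]
  simp only [integral_const, probReal_univ, smul_eq_mul, one_mul]
  nlinarith [sq_nonneg q]

/-- The variable is bounded by 1, so higher moments are dominated by the variance, which is at most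
the edge probability. -/
lemma abs_integral_edgeNoise_pow_le (h : IsRandomNetwork μ Θ A) {p : ℝ} {e : Pair n}
    (hp : Real.sigmoid (Θ e.1.1 e.1.2) ≤ p) {l : ℕ} (hl : 2 ≤ l) :
    |∫ ω, edgeNoise Θ A e ω ^ l ∂μ| ≤ p := by
  refine (abs_integral_le_integral_abs).trans (le_trans ?_ ((h.integral_edgeNoise_sq_le e).trans hp))
  refine integral_mono (h.integrable_edgeNoise_pow e l).abs (h.integrable_edgeNoise_pow e 2)
    fun ω => ?_
  simp only [abs_pow]
  rw [← sq_abs (edgeNoise Θ A e ω)]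
  exact pow_le_pow_of_le_one (abs_nonneg _) (h.abs_edgeNoise_le e ω) hl

/-- By independence the expectation factors over edges. An edge used once contributes its mean,
zero; an edge used more often contributes at most `p`, whatever its multiplicity. -/
lemma integral_prod_walk_le (h : IsRandomNetwork μ Θ A) (hΘ : Θ.IsSymm) {p : ℝ} (hp0 : 0 ≤ p)
    (hp : ∀ i j, i ≠ j → Real.sigmoid (Θ i j) ≤ p) {w : Fin (L + 1) → Fin n}
    (hw : w 0 = w (Fin.last L)) :
    ∫ ω, ∏ t : Fin L, offNoise Θ (A ω) (w t.castSucc) (w t.succ) ∂μ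
      ≤ if IsGoodWalk w then p ^ (walkEdges w).card else 0 := by
  by_cases hl : ∀ t : Fin L, w t.castSucc ≠ w t.succ
  · have h1 : ∀ ω, ∏ t : Fin L, offNoise Θ (A ω) (w t.castSucc) (w t.succ)
        = ∏ e : Pair n, edgeNoise Θ A e ω ^ edgeCount w e := by
      intro ω
      rw [prod_walk_eq (offNoise_isSymm hΘ (h.adjacency ω).1) hl]
      refine Finset.prod_congr rfl fun e _ => ?_
      rw [offNoise_of_ne _ _ e.2.ne, edgeNoise]
    have h2 := (h.iIndepFun_edgeNoise.comp (fun e x => x ^ edgeCount w e)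
      fun _ => measurable_id.pow_const _).integral_fun_prod_eq_prod_integral
      fun e => ((h.measurable_edgeNoise e).pow_const _).aestronglyMeasurable
    simp only [h1]
    simp only [Function.comp_apply] at h2
    rw [h2]
    split_ifs with hg
    · refine (le_abs_self _).trans ?_
      rw [Finset.abs_prod, walkEdges, ← Finset.prod_const, Finset.prod_filter]
      refine Finset.prod_le_prod (fun _ _ => abs_nonneg _) fun e _ => ?_
      split_ifs with h0
      · refine h.abs_integral_edgeNoise_pow_le (hp _ _ e.2.ne) ?_
        have := hg.2.2 e
        omega
      · rw [not_not] at h0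
        simp [h0]
    · have : ∃ e, edgeCount w e = 1 := by
        by_contra! hcon
        exact hg ⟨hw, hl, hcon⟩
      obtain ⟨e, he⟩ := this
      refine (Finset.prod_eq_zero (Finset.mem_univ e) ?_).le
      simp only [he, pow_one]
      exact h.integral_edgeNoise e
  · push Not at hl
    obtain ⟨t, ht⟩ := hl
    have h1 : ∀ ω, ∏ t : Fin L, offNoise Θ (A ω) (w t.castSucc) (w t.succ) = 0 := fun ω =>
      Finset.prod_eq_zero (Finset.mem_univ t) (by rw [ht, offNoise_self])
    simp only [h1, integral_zero]
    split_ifs <;> positivity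

lemma integrable_prod_walk (h : IsRandomNetwork μ Θ A) (w : Fin (L + 1) → Fin n) :
    Integrable (fun ω => ∏ t : Fin L, offNoise Θ (A ω) (w t.castSucc) (w t.succ)) μ := by
  refine Integrable.of_bound (Finset.measurable_prod _ fun t _ =>
    h.measurable_offNoise _ _).aestronglyMeasurable 1 (ae_of_all _ fun ω => ?_)
  rw [Real.norm_eq_abs, Finset.abs_prod]
  exact Finset.prod_le_one (fun _ _ => abs_nonneg _) fun t _ => h.abs_offNoise_le _ _ _

lemma integrable_walk (h : IsRandomNetwork μ Θ A) (w : Fin (L + 1) → Fin n) :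
    Integrable (fun ω => if w 0 = w (Fin.last L) then
      ∏ t : Fin L, offNoise Θ (A ω) (w t.castSucc) (w t.succ) else 0) μ := by
  split_ifs
  · exact h.integrable_prod_walk w
  · exact integrable_zero _ _ _

lemma integrable_trace (h : IsRandomNetwork μ Θ A) (L : ℕ) :
    Integrable (fun ω => (offNoise Θ (A ω) ^ L).trace) μ := by
  simp only [trace_pow_eq_sum_walks]
  exact integrable_finsetSum _ fun w _ => h.integrable_walk w

/-- The moment bound. -/
lemma integral_trace_le (h : IsRandomNetwork μ Θ A) (hΘ : Θ.IsSymm) {p c : ℝ} (hp0 : 0 < p)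
    (hp1 : p ≤ 1) (hp : ∀ i j, i ≠ j → Real.sigmoid (Θ i j) ≤ p) (hc : 0 < c) (m : ℕ) :
    p * ∫ ω, (offNoise Θ (A ω) ^ (2 * m)).trace ∂μ
      ≤ 2 * Real.exp (31 * (n * p))
        * ((2 * m).factorial * (2 / c) ^ (2 * m) * Real.exp (128 * c ^ 2)) := by
  refine le_trans ?_ (sum_goodWalks_le_exp n m hp0.le hp1 hc)
  simp only [trace_pow_eq_sum_walks]
  rw [integral_finsetSum _ fun w _ => h.integrable_walk w, Finset.mul_sum, Finset.sum_filter]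
  refine Finset.sum_le_sum fun w _ => ?_
  by_cases hw : w 0 = w (Fin.last (2 * m))
  · simp only [hw, if_true]
    have h1 := mul_le_mul_of_nonneg_left (h.integral_prod_walk_le hΘ hp0.le hp hw) hp0.le
    refine h1.trans ?_
    split_ifs
    -- The extra factor `p` in the statement turns the count of edges into an upper bound for the
    -- count of vertices.
    · rw [← pow_succ']
      exact pow_le_pow_of_le_one hp0.le hp1 (card_image_walk_le w)
    · rw [mul_zero]
  · simp only [hw, if_false, integral_zero, mul_zero]
    split_ifs <;> positivity

/-- The operator norm of the noise is of order `√(n p)`. -/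
lemma measureReal_opNorm_offNoise_le (h : IsRandomNetwork μ Θ A) (hΘ : Θ.IsSymm) {p : ℝ}
    (hn : 2 ≤ n) (hp1 : p ≤ 1) (hpn : Real.log n ≤ n * p)
    (hp : ∀ i j, i ≠ j → Real.sigmoid (Θ i j) ≤ p) :
    μ.real {ω | 10 * Real.exp 170 * √(n * p) ≤ opNorm (offNoise Θ (A ω))} ≤ 1 / (2 * n) := by
  have hn0 : (2 : ℝ) ≤ n := by exact_mod_cast hn
  have hlog : (69 : ℝ) / 100 ≤ Real.log n := by
    have := Real.log_two_gt_d9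
    have h2 := Real.log_le_log (by norm_num) hn0
    linarith
  have hp0 : 0 < p := by
    by_contra! hcon
    have : n * p ≤ 0 := mul_nonpos_of_nonneg_of_nonpos (by linarith) hcon
    linarith
  set ν := (n : ℝ) * p with hν
  have hν0 : 69 / 100 ≤ ν := hlog.trans hpn
  have hνpos : 0 < ν := by linarith
  -- The exponent `L` is the power of two with `ν ≤ L ≤ 5ν`; the upper bound uses `ν ≥ log 2 > 2/3`.
  obtain ⟨j, hj1, hj2⟩ := exists_nat_pow_near (show (1 : ℝ) ≤ ν + 1 by linarith)
    (show (1 : ℝ) < 2 by norm_num)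
  set L := 2 ^ (j + 1) with hL
  have hL2 : L = 2 * 2 ^ j := by rw [hL, pow_succ']
  have hLr : (L : ℝ) = 2 * 2 ^ j := by rw [hL2]; push_cast; ring
  have hL3 : (L : ℝ) ≤ 5 * ν := by rw [hLr]; linarith
  have hL4 : ν ≤ L := by rw [hLr]; rw [pow_succ'] at hj2; linarith
  set q := √ν with hq
  have hq0 : 0 < q := Real.sqrt_pos.mpr hνpos
  have hq2 : q ^ 2 = ν := Real.sq_sqrt hνpos.le
  set T := 10 * Real.exp 170 * q with hT
  have hT0 : 0 < T := by positivity
  -- The choice `c = √ν` makes both exponential factors of order `e^{O(ν)}`, and `L!(2/√ν)^L ≤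
  -- (10√ν)^L`. All other losses are exponential in `L` and go into the constant `e^{170}`.
  have h1 := h.integral_trace_le hΘ hp0 hp1 hp hq0 (2 ^ j)
  rw [← hL2, hq2] at h1
  have h2 := mul_meas_ge_le_integral_of_nonneg (μ := μ) (f := fun ω => (offNoise Θ (A ω) ^ L).trace)
    (ae_of_all _ fun ω => (pow_nonneg (opNorm_nonneg _) _).trans
      (opNorm_pow_le_trace (offNoise_isSymm hΘ (h.adjacency ω).1) j)) (h.integrable_trace L) (T ^ L)
  have h3 : μ.real {ω | T ≤ opNorm (offNoise Θ (A ω))}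
      ≤ μ.real {ω | T ^ L ≤ (offNoise Θ (A ω) ^ L).trace} := by
    refine measureReal_mono fun ω hω => ?_
    exact (pow_le_pow_left₀ hT0.le hω L).trans
      (opNorm_pow_le_trace (offNoise_isSymm hΘ (h.adjacency ω).1) j)
  refine h3.trans ?_
  set x := μ.real {ω | T ^ L ≤ (offNoise Θ (A ω) ^ L).trace}
  have hx0 : 0 ≤ x := measureReal_nonneg
  have h4 : p * (T ^ L * x) ≤ 2 * Real.exp (159 * ν) * (10 * q) ^ L := by
    refine (mul_le_mul_of_nonneg_left h2 hp0.le).trans (h1.trans ?_)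
    have e1 : (L.factorial : ℝ) * (2 / q) ^ L ≤ (10 * q) ^ L := by
      have : (L.factorial : ℝ) ≤ (L : ℝ) ^ L := by exact_mod_cast Nat.factorial_le_pow L
      calc (L.factorial : ℝ) * (2 / q) ^ L ≤ (L : ℝ) ^ L * (2 / q) ^ L := by gcongr
        _ = (L * (2 / q)) ^ L := (mul_pow _ _ _).symm
        _ ≤ (10 * q) ^ L := by
          refine pow_le_pow_left₀ (by positivity) ?_ L
          rw [mul_div_assoc', div_le_iff₀ hq0]
          nlinarith
    have e2 : Real.exp (159 * ν) = Real.exp (31 * ν) * Real.exp (128 * ν) := by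
      rw [← Real.exp_add]; ring_nf
    rw [e2]
    calc _ = 2 * (Real.exp (31 * ν) * Real.exp (128 * ν)) * (L.factorial * (2 / q) ^ L) := by ring
      _ ≤ _ := by gcongr
  have h5 : T ^ L = (10 * q) ^ L * Real.exp (170 * L) := by
    rw [hT, mul_right_comm, mul_pow, ← Real.exp_nat_mul]; ring_nf
  rw [h5] at h4
  have h6 : Real.exp (170 * ν) ≤ Real.exp (170 * L) := Real.exp_le_exp.mpr (by linarith)
  have hQ : 0 < (10 * q) ^ L := by positivity
  have h7 : (10 * q) ^ L * (p * x * Real.exp (170 * ν))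
      ≤ (10 * q) ^ L * (2 * Real.exp (159 * ν)) := by
    have : p * x * Real.exp (170 * ν) ≤ p * x * Real.exp (170 * L) := by gcongr
    calc _ ≤ (10 * q) ^ L * (p * x * Real.exp (170 * L)) := by gcongr
      _ = p * ((10 * q) ^ L * Real.exp (170 * L) * x) := by ring
      _ ≤ _ := by linarith
  have h8 := le_of_mul_le_mul_left h7 hQ
  -- Of the exponent, `159 = 31 + 128` cancels the moment bound, `e^{2ν} ≥ n²` provides the small
  -- probability, and `e^{9ν} ≥ 1 + 9ν` compensates the factor `1/p = n/ν`.
  have e3 : Real.exp (170 * ν) = Real.exp (159 * ν) * (Real.exp (9 * ν) * Real.exp ν ^ 2) := by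
    rw [← Real.exp_nat_mul, ← Real.exp_add, ← Real.exp_add]; push_cast; ring_nf
  have h9 : p * x * (Real.exp (9 * ν) * Real.exp ν ^ 2) ≤ 2 := by
    refine le_of_mul_le_mul_left ?_ (Real.exp_pos (159 * ν))
    rw [e3] at h8
    linarith
  have h10 : (n : ℝ) ≤ Real.exp ν := by
    rw [← Real.log_le_iff_le_exp (by linarith)]; exact hpn
  have h11 : 1 + 9 * ν ≤ Real.exp (9 * ν) := by have := Real.add_one_le_exp (9 * ν); linarith
  have h12 : p * x * ((1 + 9 * ν) * (n : ℝ) ^ 2) ≤ 2 := by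
    refine le_trans ?_ h9
    gcongr
  have h13 : x * n * (ν * (1 + 9 * ν)) ≤ 2 := by
    rw [hν] at h12 ⊢; linarith
  have h14 : (4 : ℝ) ≤ ν * (1 + 9 * ν) := by nlinarith
  rw [le_div_iff₀ (by positivity)]
  have h15 : 0 ≤ x * n := by positivity
  nlinarith

lemma hasSubgaussianMGF_edgeNoise (h : IsRandomNetwork μ Θ A) (e : Pair n) :
    HasSubgaussianMGF (edgeNoise Θ A e) ((1 / 2) ^ 2) μ := by
  have h1 := hasSubgaussianMGF_of_mem_Icc_of_integral_eq_zero (μ := μ) (X := edgeNoise Θ A e)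
    (a := -Real.sigmoid (Θ e.1.1 e.1.2)) (b := 1 - Real.sigmoid (Θ e.1.1 e.1.2))
    (h.measurable_edgeNoise e).aemeasurable (ae_of_all _ fun ω => ?_) (h.integral_edgeNoise e)
  · rw [sub_neg_eq_add, sub_add_cancel, nnnorm_one] at h1
    exact h1
  · unfold edgeNoise
    rcases (h.adjacency ω).2.2 e.1.1 e.1.2 with h0 | h0 <;> rw [h0] <;>
      constructor <;> linarith

/-- The noise in the direction of the covariate. -/
lemma measureReal_inner_le (h : IsRandomNetwork μ Θ A) (hΘ : Θ.IsSymm)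
    {X : Matrix (Fin n) (Fin n) ℝ} (hX : IsCovariate X) (hX0 : X ≠ 0) {ν : ℝ} (hν : 0 ≤ ν) :
    μ.real {ω | √ν * frobNorm X ≤ |frobInner (A ω - sigmoidMat Θ) X|} ≤ 2 * Real.exp (-ν) := by
  have hXpos : 0 < frobNorm X :=
    lt_of_le_of_ne (frobNorm_nonneg X) fun h0 => hX0 (frobNorm_eq_zero.mp h0.symm)
  have e1 : ∀ ω, frobInner (A ω - sigmoidMat Θ) X
      = 2 * ∑ e : Pair n, edgeNoise Θ A e ω * X e.1.1 e.1.2 := by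
    intro ω
    rw [frobInner_eq_sum]
    exact sum_sum_eq_two_mul_sum_pair
      (F := fun i j => (A ω - sigmoidMat Θ) i j * X i j)
      (fun i j => by
        rw [((h.adjacency ω).1.sub (sigmoidMat_isSymm hΘ)).apply, hX.1.apply])
      (fun i => by rw [hX.2, mul_zero])
  have e2 : frobNorm X ^ 2 = 2 * ∑ e : Pair n, X e.1.1 e.1.2 ^ 2 := by
    rw [frobNorm_sq]
    exact sum_sum_eq_two_mul_sum_pair (F := fun i j => X i j ^ 2)
      (fun i j => by rw [hX.1.apply]) (fun i => by rw [hX.2]; norm_num)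
  -- Hoeffding's inequality is one-sided, so it is applied with both signs `c = ±1`. The variance
  -- proxy is `‖X‖_F²/8`, because each unordered pair is counted once here and twice in the norm.
  have key : ∀ c : ℝ, c ^ 2 = 1 →
      μ.real {ω | √ν * frobNorm X / 2 ≤ ∑ e : Pair n, edgeNoise Θ A e ω * (c * X e.1.1 e.1.2)}
        ≤ Real.exp (-ν) := by
    intro c hc
    have hind : iIndepFun (fun (e : Pair n) ω => c * X e.1.1 e.1.2 * edgeNoise Θ A e ω) μ :=
      h.iIndepFun_edgeNoise.comp (fun e x => c * X e.1.1 e.1.2 * x)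
        fun _ => measurable_id.const_mul _
    have hsub : ∀ e ∈ (Finset.univ : Finset (Pair n)),
        HasSubgaussianMGF (fun ω => c * X e.1.1 e.1.2 * edgeNoise Θ A e ω)
          (‖X e.1.1 e.1.2‖₊ ^ 2 * (1 / 2) ^ 2) μ := by
      intro e _
      exact hasSubgaussianMGF_mul_of_sq_eq_one (h.hasSubgaussianMGF_edgeNoise e) hc _
    have h1 := HasSubgaussianMGF.measure_sum_ge_le_of_iIndepFun hind hsub
      (ε := √ν * frobNorm X / 2) (by positivity)
    have h2 : ∀ ω, ∑ e : Pair n, edgeNoise Θ A e ω * (c * X e.1.1 e.1.2)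
        = ∑ e : Pair n, c * X e.1.1 e.1.2 * edgeNoise Θ A e ω := fun ω =>
      Finset.sum_congr rfl fun e _ => mul_comm _ _
    simp only [h2]
    refine h1.trans (Real.exp_le_exp.mpr (le_of_eq ?_))
    have h3 : ((∑ e : Pair n, ‖X e.1.1 e.1.2‖₊ ^ 2 * (1 / 2) ^ 2 : NNReal) : ℝ)
        = frobNorm X ^ 2 / 8 := by
      rw [e2, NNReal.coe_sum, Finset.mul_sum, Finset.sum_div]
      refine Finset.sum_congr rfl fun e _ => ?_
      rw [NNReal.coe_mul, NNReal.coe_pow, coe_nnnorm, Real.norm_eq_abs, sq_abs]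
      norm_num
      ring
    rw [h3, div_pow, mul_pow, Real.sq_sqrt hν]
    field_simp
    norm_num
  have h1 := key 1 (by norm_num)
  have h2 := key (-1) (by norm_num)
  refine (measureReal_mono (s₂ := {ω | √ν * frobNorm X / 2
      ≤ ∑ e : Pair n, edgeNoise Θ A e ω * (1 * X e.1.1 e.1.2)} ∪ {ω | √ν * frobNorm X / 2
      ≤ ∑ e : Pair n, edgeNoise Θ A e ω * (-1 * X e.1.1 e.1.2)}) ?_).trans
    ((measureReal_union_le _ _).trans (by linarith))
  intro ω hω
  rw [Set.mem_ofPred_eq, e1] at hω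
  simp only [one_mul, neg_mul, mul_neg, Finset.sum_neg_distrib, Set.mem_union, Set.mem_ofPred_eq]
  rcases le_abs.mp hω with hω | hω
  · left; linarith
  · right; linarith

end IsRandomNetwork

end Noise

end LatentSpace

namespace LatentSpace

/-! ### The noise level of a random network -/

section NoiseLevel

variable {n k : ℕ} {Ω : Type*} [MeasurableSpace Ω] {μ : Measure Ω} [IsProbabilityMeasure μ]
  {Θ : Matrix (Fin n) (Fin n) ℝ} {A : Ω → Matrix (Fin n) (Fin n) ℝ}

/-- The constant in the bound of the noise level by `√(n p)`. -/
noncomputable def noiseConst : ℝ := 30 * Real.exp 170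

lemma le_noiseConst : 30 ≤ noiseConst := by
  have : 1 ≤ Real.exp 170 := Real.one_le_exp (by norm_num)
  unfold noiseConst
  linarith

lemma log_two_lower {n : ℕ} (hn : 2 ≤ n) : (69 : ℝ) / 100 ≤ Real.log n := by
  have hn0 : (2 : ℝ) ≤ n := by exact_mod_cast hn
  have := Real.log_two_gt_d9
  have h2 := Real.log_le_log (by norm_num) hn0
  linarith

/-- The bound `x ≥ 4/5`, valid for `√(np)` because `log 2 > 16/25`, lets the diagonal correction and
the term 1 of `zeta` be absorbed into a multiple of `x`. -/
lemma zeta_le_of_offNoise_le (hk : 1 ≤ k) {B X : Matrix (Fin n) (Fin n) ℝ} (hB : ∀ i, B i i = 0)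
    {x : ℝ} (hx : 4 / 5 ≤ x) (h1 : opNorm (offNoise Θ B) ≤ 10 * Real.exp 170 * x)
    (h2 : X ≠ 0 → |frobInner (B - sigmoidMat Θ) X| ≤ 2 * x * frobNorm X) :
    zeta k B (sigmoidMat Θ) X ≤ noiseConst * x := by
  have hE : 1 ≤ Real.exp 170 := Real.one_le_exp (by norm_num)
  have hx0 : 0 < x := by linarith
  have hEx : x ≤ Real.exp 170 * x := le_mul_of_one_le_left hx0.le hE
  have hk' : 1 ≤ √(k : ℝ) := Real.one_le_sqrt.mpr (by exact_mod_cast hk)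
  unfold zeta noiseConst
  refine max_le (max_le ?_ ?_) ?_
  · have := opNorm_sub_le_offNoise Θ hB
    linarith
  · refine (div_le_self (abs_nonneg _) hk').trans ?_
    rw [frobInner_smul_right, abs_mul, abs_of_nonneg (inv_nonneg.mpr (frobNorm_nonneg X))]
    rcases eq_or_ne X 0 with rfl | hX
    · rw [frobNorm_zero, _root_.inv_zero, zero_mul]
      positivity
    · have h0 : 0 < frobNorm X :=
        lt_of_le_of_ne (frobNorm_nonneg X) fun h0 => hX (frobNorm_eq_zero.mp h0.symm)
      rw [inv_mul_le_iff₀ h0]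
      have h3 := h2 hX
      have h4 : 2 * x * frobNorm X ≤ 30 * Real.exp 170 * x * frobNorm X := by
        gcongr
        linarith
      linarith
  · linarith

/-- With high probability, the noise level is of order `√(n p)`. -/
lemma IsRandomNetwork.le_measureReal_zeta_le (h : IsRandomNetwork μ Θ A) (hΘ : Θ.IsSymm)
    {X : Matrix (Fin n) (Fin n) ℝ} (hX : IsCovariate X) (hk : 1 ≤ k) {p : ℝ} (hn : 2 ≤ n)
    (hp1 : p ≤ 1) (hpn : Real.log n ≤ n * p) (hp : ∀ i j, i ≠ j → Real.sigmoid (Θ i j) ≤ p) :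
    1 - (n : ℝ)⁻¹ ≤ μ.real {ω | zeta k (A ω) (sigmoidMat Θ) X ≤ noiseConst * √(n * p)} := by
  have hn0 : (2 : ℝ) ≤ n := by exact_mod_cast hn
  have hlog := log_two_lower hn
  have hx : 4 / 5 ≤ √(n * p) := Real.le_sqrt_of_sq_le (by norm_num; linarith)
  have e1 := h.measureReal_opNorm_offNoise_le hΘ hn hp1 hpn hp
  have e2 : μ.real {ω | X ≠ 0 ∧
      √(4 * (n * p)) * frobNorm X ≤ |frobInner (A ω - sigmoidMat Θ) X|} ≤ 1 / (2 * n) := by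
    by_cases hX0 : X = 0
    · simp only [hX0, ne_eq, not_true_eq_false, false_and, Set.ofPred_false, measureReal_empty]
      positivity
    · refine (measureReal_mono fun ω hω => hω.2).trans
        ((h.measureReal_inner_le hΘ hX hX0 (ν := 4 * (n * p)) (by linarith)).trans ?_)
      have e3 : Real.exp (-(4 * (n * p))) ≤ ((n : ℝ) ^ 4)⁻¹ := by
        rw [← Real.exp_log (by positivity : (0 : ℝ) < ((n : ℝ) ^ 4)⁻¹)]
        refine Real.exp_le_exp.mpr ?_
        rw [Real.log_inv, Real.log_pow]
        push_cast
        linarith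
      have e4 : 2 * ((n : ℝ) ^ 4)⁻¹ ≤ 1 / (2 * n) := by
        rw [← div_eq_mul_inv, div_le_div_iff₀ (by positivity) (by positivity)]
        have : (2 : ℝ) ^ 3 ≤ (n : ℝ) ^ 3 := pow_le_pow_left₀ (by norm_num) hn0 3
        nlinarith
      linarith
  -- The good event and the two bad events cover the space. Subadditivity then bounds the good event
  -- from below without any measurability.
  have e5 : (1 : ℝ) ≤ μ.real ({ω | zeta k (A ω) (sigmoidMat Θ) X ≤ noiseConst * √(n * p)} ∪
      ({ω | 10 * Real.exp 170 * √(n * p) ≤ opNorm (offNoise Θ (A ω))} ∪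
        {ω | X ≠ 0 ∧ √(4 * (n * p)) * frobNorm X ≤ |frobInner (A ω - sigmoidMat Θ) X|})) := by
    rw [← probReal_univ (μ := μ)]
    refine measureReal_mono fun ω _ => ?_
    by_contra hcon
    simp only [Set.mem_union, Set.mem_ofPred_eq, not_or, not_and, not_le] at hcon
    obtain ⟨c1, c2, c3⟩ := hcon
    refine c1.not_ge (zeta_le_of_offNoise_le hk (h.adjacency ω).2.1 hx c2.le fun hX0 => ?_)
    have h4 : √(4 * (n * p)) = 2 * √(n * p) := by
      rw [Real.sqrt_mul (by norm_num), show (4 : ℝ) = 2 ^ 2 by norm_num, Real.sqrt_sq (by norm_num)]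
    rw [← h4]
    exact (c3 hX0).le
  have e6 := e5.trans ((measureReal_union_le _ _).trans
    (add_le_add_right (measureReal_union_le _ _) _))
  have e7 : 1 / (2 * (n : ℝ)) + 1 / (2 * n) = (n : ℝ)⁻¹ := by
    field_simp
    norm_num
  linarith

end NoiseLevel

end LatentSpace

namespace LatentSpace

/-! ### Random networks -/

section Network

variable {n k : ℕ} {M₁ M₂ η ϖ : ℝ} {X : Matrix (Fin n) (Fin n) ℝ} {αs : Fin n → ℝ} {βs : ℝ}
  {Gs : Matrix (Fin n) (Fin n) ℝ} {Zs : Matrix (Fin n) (Fin k) ℝ}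

/-- The condition is stated with `√n e^{M₁ - M₂/2}` in place of the noise. Since `M₂ ≤ M₁`, its
square is at least `n e^{M₁}`, which suffices because `ϖ² ≤ K²n` in every sparsity regime. -/
lemma isStrongSignal_of_signalFactor {K κ ζ g : ℝ} {Gbar : Matrix (Fin n) (Fin n) ℝ} (hK : 1 ≤ K)
    (hM₂ : M₂ ≤ M₁) (hη : 0 ≤ η) (hn : n ≠ 0) (hζ : 1 ≤ ζ) (hζϖ : ζ ≤ ϖ) (hϖ : ϖ ^ 2 ≤ K ^ 2 * n)
    (hsig : 10 ^ 4 * K * κ ^ 2 * √n * Real.exp (M₁ - M₂ / 2) * signalFactor k M₁ η ζ Gbar ≤ g) :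
    IsStrongSignal k M₁ η ϖ (frobNorm Gbar) κ g ∧
      10 ^ 4 * K * κ ^ 2 * √n * Real.exp (M₁ - M₂ / 2) ≤ g := by
  obtain ⟨h1, h2, h3⟩ := signalFactor_bounds hη (by positivity) hζ hsig
  have hn0 : (0 : ℝ) < n := by exact_mod_cast Nat.pos_of_ne_zero hn
  have e1 : (10 ^ 4 * K * κ ^ 2 * √n * Real.exp (M₁ - M₂ / 2)) ^ 2
      = 10 ^ 8 * K ^ 2 * κ ^ 4 * n * (Real.exp M₁ * Real.exp (M₁ - M₂)) := by
    have : Real.exp M₁ * Real.exp (M₁ - M₂) = Real.exp (M₁ - M₂ / 2) ^ 2 := by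
      rw [← Real.exp_add, ← Real.exp_nat_mul]
      congr 1
      push_cast
      ring
    rw [this]
    simp only [mul_pow, Real.sq_sqrt hn0.le]
    ring
  have hq : 1 ≤ Real.exp (M₁ - M₂) := Real.one_le_exp (by linarith)
  have e2 : 10 ^ 8 * K ^ 2 * κ ^ 4 * n * Real.exp M₁
      ≤ (10 ^ 4 * K * κ ^ 2 * √n * Real.exp (M₁ - M₂ / 2)) ^ 2 := by
    rw [e1, ← mul_assoc]
    exact le_mul_of_one_le_right (by positivity) hq
  refine ⟨⟨?_, ?_⟩, h1⟩
  · have e3 := (mul_le_mul_of_nonneg_right e2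
      (show 0 ≤ η * k * Real.exp M₁ by positivity)).trans h2
    have e4 := mul_le_mul_of_nonneg_left hϖ
      (show 0 ≤ η * κ ^ 4 * Real.exp M₁ ^ 2 * k by positivity)
    linarith
  · have e3 := (mul_le_mul_of_nonneg_right e2
      (show 0 ≤ η * frobNorm Gbar ^ 2 by positivity)).trans h3
    have e4 : g ^ 2 * ζ ^ 2 ≤ g ^ 2 * (K ^ 2 * n) :=
      mul_le_mul_of_nonneg_left ((pow_le_pow_left₀ (by linarith) hζϖ 2).trans hϖ) (sq_nonneg g)
    have e5 : K ^ 2 * n * (10 ^ 8 * (η * κ ^ 4 * Real.exp M₁ * frobNorm Gbar ^ 2))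
        ≤ K ^ 2 * n * g ^ 2 := by linarith
    have := le_of_mul_le_mul_left e5 (by positivity)
    linarith

lemma frobNorm_sq_le_of_inClass (hM : 0 ≤ M₁) (h : InClass M₁ M₂ X αs βs Gs)
    (hZ : IsTopEigenFactor Gs Zs) : frobNorm Zs ^ 2 ≤ n * M₁ / 3 := by
  have e : frobNorm Zs ^ 2 = ∑ i, (Zs * Zsᵀ) i i := by
    rw [frobNorm_sq]
    refine Finset.sum_congr rfl fun i _ => ?_
    rw [Matrix.mul_apply]
    exact Finset.sum_congr rfl fun j _ => by rw [Matrix.transpose_apply, sq]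
  rw [e]
  calc ∑ i, (Zs * Zsᵀ) i i ≤ ∑ _i : Fin n, M₁ / 3 := by
        refine Finset.sum_le_sum fun i _ => ?_
        rw [← vecNorm_row_sq]
        exact (hZ.vecNorm_row_sq_le h.posSemidef i).trans ((h.diag_le i).trans (radius_le hM X))
    _ = n * M₁ / 3 := by
        rw [Finset.sum_const, Finset.card_univ, Fintype.card_fin, nsmul_eq_mul]
        ring

/-- In sparse networks, the model parameters are so large that an initial state in the basin of
attraction is already at the noise level. -/
lemma le_exp_mul_log_of_sparse {N z e κ : ℝ} (hN : 2 ≤ N) (hM : 0 ≤ M₁) (hM₂ : M₂ ≤ M₁)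
    (hq : Real.exp (-M₂) < Real.log N / N) (hκ : 1 ≤ κ) (hz : z ^ 2 ≤ N * M₁ / 3)
    (h0 : e ≤ 2 / 10 ^ 10 * Real.exp (-2 * M₁) * z ^ 4 / κ ^ 4) :
    2 * e ≤ Real.exp M₁ * Real.log N := by
  -- Sparsity gives `N ≤ e^{M₁} log N = u²L`, whence `L ≤ 6u` from `L³ ≤ 27N`. Together with `M₁² ≤
  -- 16u` this bounds `z⁴ ≤ N²M₁²/9` by a multiple of `u⁶L`, and the factor `e^{-2M₁} = u⁻⁴` of the
  -- initialization leaves `e^{M₁} log N`.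
  set u := Real.exp (M₁ / 2) with hu
  set L := Real.log N with hLdef
  have hu0 : 0 < u := Real.exp_pos _
  have hL0 : 0 < L := Real.log_pos (by linarith)
  have hE : Real.exp M₁ = u ^ 2 := by
    rw [hu, ← Real.exp_nat_mul]; congr 1; push_cast; ring
  have hE' : Real.exp (-2 * M₁) = (u ^ 4)⁻¹ := by
    rw [hu, ← Real.exp_nat_mul, ← Real.exp_neg]; congr 1; push_cast; ring
  have hM1 : M₁ ^ 2 ≤ 16 * u := by
    have h1 : M₁ / 4 ≤ Real.exp (M₁ / 4) := by linarith [Real.add_one_le_exp (M₁ / 4)]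
    have h2 : u = Real.exp (M₁ / 4) ^ 2 := by
      rw [hu, ← Real.exp_nat_mul]; congr 1; push_cast; ring
    have h3 := pow_le_pow_left₀ (by positivity) h1 2
    linarith
  have hNu : N ≤ u ^ 2 * L := by
    have h1 : Real.exp (-M₁) ≤ L / N :=
      (Real.exp_le_exp.mpr (by linarith)).trans hq.le
    rw [Real.exp_neg, hE, le_div_iff₀ (by linarith), inv_mul_le_iff₀ (by positivity)] at h1
    exact h1
  have hLu : L ≤ 6 * u := by
    have h1 : L / 3 ≤ Real.exp (L / 3) := by linarith [Real.add_one_le_exp (L / 3)]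
    have h2 : Real.exp (L / 3) ^ 3 = N := by
      rw [← Real.exp_nat_mul]
      push_cast
      rw [mul_div_cancel₀ _ (by norm_num), hLdef, Real.exp_log (by linarith)]
    have h3 := pow_le_pow_left₀ (by positivity) h1 3
    rw [h2] at h3
    have h4 : L * L ^ 2 ≤ L * (27 * u ^ 2) := by linarith
    have h5 := le_of_mul_le_mul_left h4 hL0
    refine le_of_sq_le_sq ?_ (by positivity)
    nlinarith [sq_nonneg u]
  have hz4 : z ^ 4 ≤ N ^ 2 * M₁ ^ 2 / 9 := by
    have := pow_le_pow_left₀ (sq_nonneg z) hz 2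
    linarith
  have hN2 : N ^ 2 ≤ 6 * u ^ 5 * L := by
    have h1 := pow_le_pow_left₀ (by linarith) hNu 2
    have h2 : u ^ 4 * L * L ≤ u ^ 4 * L * (6 * u) := by gcongr
    linarith
  have h1 : z ^ 4 ≤ 96 / 9 * u ^ 6 * L := by
    have : N ^ 2 * M₁ ^ 2 ≤ (6 * u ^ 5 * L) * (16 * u) := by gcongr
    linarith
  have h2 : e ≤ 2 / 10 ^ 10 * Real.exp (-2 * M₁) * z ^ 4 :=
    h0.trans (div_le_self (by positivity) (one_le_pow₀ hκ))
  have h3 : Real.exp (-2 * M₁) * z ^ 4 ≤ 96 / 9 * (u ^ 2 * L) := by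
    rw [hE', inv_mul_le_iff₀ (by positivity)]
    linarith
  rw [hE]
  have : 0 ≤ u ^ 2 * L := by positivity
  linarith

/-- The definition of `iterCount` unwound: more iterations than this mean that the power of the rate
times the argument of its first logarithm is at most 1. -/
lemma rate_pow_mul_le {ρ κ : ℝ} {T : ℕ} (hr0 : 0 < rate M₁ η ρ κ) (hr1 : rate M₁ η ρ κ < 1)
    (hM : 0 < M₁) (hκ : 0 < κ) (hn : n ≠ 0) (hk : 1 ≤ k) (hT : iterCount n k M₁ M₂ η ρ κ < T) :
    rate M₁ η ρ κ ^ T * (M₁ ^ 2 * n / k ^ 2) ≤ κ ^ 2 * Real.exp (4 * M₁ - M₂) := by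
  have hn0 : (0 : ℝ) < n := by exact_mod_cast Nat.pos_of_ne_zero hn
  have hk0 : (0 : ℝ) < k := by exact_mod_cast hk
  set Q := M₁ ^ 2 / (κ ^ 2 * Real.exp (4 * M₁ - M₂)) * (n / (k : ℝ) ^ 2) with hQ
  have hQ0 : 0 < Q := by positivity
  have hl : 0 < Real.log (1 / rate M₁ η ρ κ) := by
    apply Real.log_pos
    rwa [lt_div_iff₀ hr0, one_mul]
  rw [iterCount, ← hQ, div_lt_iff₀ hl, one_div, Real.log_inv, mul_neg, ← Real.log_pow] at hT
  have h1 : Real.log (rate M₁ η ρ κ ^ T * Q) ≤ 0 := by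
    rw [Real.log_mul (pow_pos hr0 T).ne' hQ0.ne']
    linarith
  have h2 := (Real.log_nonpos_iff (by positivity)).mp h1
  have h3 : rate M₁ η ρ κ ^ T * (M₁ ^ 2 * n / k ^ 2)
      = rate M₁ η ρ κ ^ T * Q * (κ ^ 2 * Real.exp (4 * M₁ - M₂)) := by
    rw [hQ]; field_simp
  rw [h3]
  exact mul_le_of_le_one_left (by positivity) h2

lemma rate_mem_Ioo {κ : ℝ} (hM : 0 ≤ M₁) (hη : 0 < η) (hη1 : η ≤ 1 / 1024) (hκ : 1 ≤ κ) :
    0 < rate M₁ η (1 / 128) κ ∧ rate M₁ η (1 / 128) κ < 1 := by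
  have hE : 1 ≤ Real.exp M₁ * κ ^ 2 :=
    one_le_mul_of_one_le_of_one_le (Real.one_le_exp hM) (one_le_pow₀ hκ)
  have h1 : η / (Real.exp M₁ * κ ^ 2) ≤ η := div_le_self hη.le hE
  have h2 : 0 < η / (Real.exp M₁ * κ ^ 2) := by positivity
  unfold rate
  constructor <;> linarith

/-- After the burn-in period, the optimization error is below the statistical error. -/
lemma rate_pow_mul_err_le {e : ℝ} {T : ℕ} (hk : 1 ≤ k) (hM : 0 ≤ M₁) (hη : 0 < η)
    (hη1 : η ≤ 1 / 1024) (h : InClass M₁ M₂ X αs βs Gs) (hZ : IsTopEigenFactor Gs Zs)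
    (hsv : 0 < singVal Zs (k - 1))
    (h0 : e ≤ 2 / 10 ^ 10 * Real.exp (-2 * M₁) * opNorm Zs ^ 4 / condNum Zs ^ 4)
    (hT : iterCount n k M₁ M₂ η (1 / 128) (condNum Zs) < T) :
    rate M₁ η (1 / 128) (condNum Zs) ^ T * e ≤ condNum Zs ^ 2 * psiSq n k M₁ M₂ := by
  have hn := ne_zero_of_singVal_pos hsv
  have hn0 : (0 : ℝ) < n := by exact_mod_cast Nat.pos_of_ne_zero hn
  have hk1 : (1 : ℝ) ≤ k := by exact_mod_cast hk
  have hk0 : (0 : ℝ) < k := by linarith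
  have hκ : 1 ≤ condNum Zs := by
    rw [condNum, one_le_div hsv]
    exact singVal_antitone Zs (Nat.zero_le _)
  have hκ0 : 0 < condNum Zs := by linarith
  have hσ : k * singVal Zs (k - 1) ^ 2 ≤ n * M₁ / 3 :=
    (mul_sq_singVal_le Zs).trans (frobNorm_sq_le_of_inClass hM h hZ)
  have hM0 : 0 < M₁ := by
    by_contra! hcon
    have h1 : 0 < k * singVal Zs (k - 1) ^ 2 := by positivity
    have h2 : n * M₁ ≤ 0 := mul_nonpos_of_nonneg_of_nonpos hn0.le hcon
    linarith
  obtain ⟨hr0, hr1⟩ := rate_mem_Ioo (κ := condNum Zs) hM hη hη1 hκ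
  have hrT := rate_pow_mul_le hr0 hr1 hM0 hκ0 hn hk hT
  -- The initial error is bounded through the smallest singular value, and `kσ² ≤ ‖Z⋆‖_F² ≤ nM₁/3`.
  -- This is where the factor `1/k²` in `iterCount` comes from.
  have hz : opNorm Zs ^ 4 / condNum Zs ^ 4 = singVal Zs (k - 1) ^ 4 := by
    rw [div_eq_iff (by positivity), ← mul_pow, opNorm_eq_singVal_zero hk, condNum,
      mul_div_cancel₀ _ hsv.ne']
  rw [mul_div_assoc, hz] at h0
  set σ := singVal Zs (k - 1)
  set r := rate M₁ η (1 / 128) (condNum Zs)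
  have hσ4 : σ ^ 4 ≤ M₁ ^ 2 * n / k ^ 2 * n := by
    have h1 := pow_le_pow_left₀ (by positivity) hσ 2
    rw [div_mul_eq_mul_div, le_div_iff₀ (by positivity)]
    have : 0 ≤ M₁ ^ 2 * n * n := by positivity
    linarith
  have e1 : r ^ T * e ≤ r ^ T * (Real.exp (-2 * M₁) * (M₁ ^ 2 * n / k ^ 2 * n)) := by
    refine mul_le_mul_of_nonneg_left (h0.trans ?_) (pow_nonneg hr0.le T)
    have : Real.exp (-2 * M₁) * σ ^ 4 ≤ Real.exp (-2 * M₁) * (M₁ ^ 2 * n / k ^ 2 * n) := by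
      gcongr
    have h3 : 0 ≤ Real.exp (-2 * M₁) * σ ^ 4 := by positivity
    linarith
  have e2 := mul_le_mul_of_nonneg_left hrT (show 0 ≤ Real.exp (-2 * M₁) * n by positivity)
  have e3 : Real.exp (-2 * M₁) * Real.exp (4 * M₁ - M₂) = Real.exp (2 * M₁) * Real.exp (-M₂) := by
    rw [← Real.exp_add, ← Real.exp_add]; congr 1; ring
  have e4 : Real.exp (2 * M₁) * Real.exp (-M₂) * n ≤ psiSq n k M₁ M₂ := by
    unfold psiSq
    calc Real.exp (2 * M₁) * Real.exp (-M₂) * n = Real.exp (2 * M₁) * n * 1 * Real.exp (-M₂) := by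
          ring
      _ ≤ _ := by gcongr; exact le_max_left _ _
  calc r ^ T * e ≤ Real.exp (-2 * M₁) * n * (r ^ T * (M₁ ^ 2 * n / k ^ 2)) := by linarith
    _ ≤ Real.exp (-2 * M₁) * n * (condNum Zs ^ 2 * Real.exp (4 * M₁ - M₂)) := e2
    _ = condNum Zs ^ 2 * (Real.exp (-2 * M₁) * Real.exp (4 * M₁ - M₂) * n) := by ring
    _ ≤ _ := by rw [e3]; gcongr

/-- The largest edge probability, or the connectivity threshold if that is larger. -/
noncomputable def sparsity (n : ℕ) (M₂ : ℝ) : ℝ := max (Real.exp (-M₂)) (Real.log n / n)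

lemma sparsity_le_one (hM₂ : 0 ≤ M₂) : sparsity n M₂ ≤ 1 := by
  refine max_le (Real.exp_le_one_iff.mpr (by linarith)) (div_le_one_of_le₀ ?_ (Nat.cast_nonneg n))
  exact Real.log_le_self (Nat.cast_nonneg n)

lemma log_le_mul_sparsity (hn : n ≠ 0) : Real.log n ≤ n * sparsity n M₂ := by
  have hn0 : (0 : ℝ) < n := by exact_mod_cast Nat.pos_of_ne_zero hn
  have := le_max_right (Real.exp (-M₂)) (Real.log n / n)
  rwa [div_le_iff₀ hn0, mul_comm] at this

lemma InClass.sigmoid_theta_le (h : InClass M₁ M₂ X αs βs Gs) {i j : Fin n} (hij : i ≠ j) :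
    Real.sigmoid (theta X αs βs Gs i j) ≤ sparsity n M₂ := by
  have h1 : Real.sigmoid (theta X αs βs Gs i j) ≤ Real.exp (theta X αs βs Gs i j) := by
    rw [Real.sigmoid_def, inv_le_comm₀ (by positivity) (Real.exp_pos _), ← Real.exp_neg]
    linarith
  exact (h1.trans (Real.exp_le_exp.mpr (h.theta_le i j hij))).trans (le_max_left _ _)

/-- The error bounds for a network with noise level of order `√(n p)`, where `p` is the
sparsity. -/
theorem network_error_le {A : Matrix (Fin n) (Fin n) ℝ} {K : ℝ} (hK : 1 ≤ K) (hn : 2 ≤ n)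
    (hk : 1 ≤ k) (hM₂ : 0 ≤ M₂) (hM : M₂ ≤ M₁) (hη : 0 < η) (hη1 : η ≤ 1 / 1024)
    (hX : IsCovariate X) (hXs : X ≠ 0 → 128 * k ≤ stableRank X) (h : InClass M₁ M₂ X αs βs Gs)
    (hZ : IsTopEigenFactor Gs Zs) (hsv : 0 < singVal Zs (k - 1)) (hA : A.IsSymm)
    (hζ : zeta k A (sigmoidMat (theta X αs βs Gs)) X ≤ K * √(n * sparsity n M₂))
    (hsig : 10 ^ 4 * K * condNum Zs ^ 2 * √n * Real.exp (M₁ - M₂ / 2)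
      * signalFactor k M₁ η (zeta k A (sigmoidMat (theta X αs βs Gs)) X) (Gs - Zs * Zsᵀ)
        ≤ opNorm Gs) {s : ℕ → Iterate n k} (hs : IsPGD M₁ η A X s)
    (h0 : err X Zs αs βs (s 0)
      ≤ 2 / 10 ^ 10 * Real.exp (-2 * M₁) * opNorm Zs ^ 4 / condNum Zs ^ 4) (t : ℕ) :
    let B := 2 * rate M₁ η (1 / 128) (condNum Zs) ^ t * err X Zs αs βs (s 0)
      + 192000 * K ^ 2 * condNum Zs ^ 2 * (psiSq n k M₁ M₂
        + Real.exp M₁ * frobNorm (Gs - Zs * Zsᵀ) ^ 2)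
    err X Zs αs βs (s t) ≤ B ∧
      frobNorm ((s t).Z * (s t).Zᵀ - Zs * Zsᵀ) ^ 2 ≤ 28 * B ∧
      frobNorm ((s t).Z * (s t).Zᵀ - Gs) ^ 2 ≤ 28 * B ∧
      frobNorm ((s t).theta X - theta X αs βs Gs) ^ 2 ≤ 28 * B := by
  intro B
  have hM0 : 0 ≤ M₁ := hM₂.trans hM
  have hn0 : (2 : ℝ) ≤ n := by exact_mod_cast hn
  have hκ : 1 ≤ condNum Zs := by
    rw [condNum, one_le_div hsv]
    exact singVal_antitone Zs (Nat.zero_le _)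
  have hK0 : 0 < K := by linarith
  have hp1 := sparsity_le_one (n := n) hM₂
  have hp0 : 0 < sparsity n M₂ := lt_max_of_lt_left (Real.exp_pos _)
  have hlog := log_le_mul_sparsity (M₂ := M₂) (show n ≠ 0 by omega)
  set ϖ := K * √(n * sparsity n M₂) with hϖdef
  have hϖ2 : ϖ ^ 2 = K ^ 2 * (n * sparsity n M₂) := by
    rw [hϖdef, mul_pow, Real.sq_sqrt (by positivity)]
  have hϖn : ϖ ^ 2 ≤ K ^ 2 * n := by
    rw [hϖ2]
    gcongr
    exact mul_le_of_le_one_right (by positivity) hp1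
  obtain ⟨hst, hD⟩ := isStrongSignal_of_signalFactor hK hM hη.le (by omega) (le_max_right _ _) hζ
    hϖn hsig
  have hN : IsNoiseBound k A (sigmoidMat (theta X αs βs Gs)) X ϖ := IsNoiseBound.of_zeta_le hk hζ
  have hreg : 1000 * condNum Zs ^ 2 * Real.exp M₁ * ϖ ≤ opNorm Gs ∨
      2 * err X Zs αs βs (s 0) ≤ 48 * Real.exp M₁ * ϖ ^ 2 * k := by
    rcases le_or_gt (Real.log n / n) (Real.exp (-M₂)) with hq | hq
    -- Here `p = e^{-M₂}`, so `e^{M₁}ϖ = K√n e^{M₁ - M₂/2}` is exactly the scale of the signal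
    -- condition.
    · left
      have e1 : √(n * sparsity n M₂) = √n * Real.exp (-M₂ / 2) := by
        rw [sparsity, max_eq_left hq, Real.sqrt_mul (by positivity), Real.exp_half]
      refine le_trans ?_ hD
      rw [hϖdef, e1, sub_eq_add_neg, Real.exp_add, neg_div]
      have : 0 ≤ K * condNum Zs ^ 2 * √n * (Real.exp M₁ * Real.exp (-(M₂ / 2))) := by positivity
      linarith
    -- Here `p = log n / n` and the signal condition does not control `ϖ`, but the initial error is
    -- already below the noise level.
    · right
      have hz : opNorm Zs ^ 2 ≤ n * M₁ / 3 :=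
        (pow_le_pow_left₀ (opNorm_nonneg _) (opNorm_le_frobNorm Zs) 2).trans
          (frobNorm_sq_le_of_inClass hM0 h hZ)
      refine (le_exp_mul_log_of_sparse hn0 hM0 hM hq hκ hz h0).trans ?_
      have e1 : Real.log n ≤ ϖ ^ 2 := by
        rw [hϖ2]
        exact hlog.trans (le_mul_of_one_le_left (by positivity) (one_le_pow₀ hK))
      have hk1 : (1 : ℝ) ≤ k := by exact_mod_cast hk
      have e2 : Real.exp M₁ * Real.log n ≤ Real.exp M₁ * ϖ ^ 2 := by gcongr
      have e3 : Real.exp M₁ * ϖ ^ 2 ≤ Real.exp M₁ * ϖ ^ 2 * k :=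
        le_mul_of_one_le_right (by positivity) hk1
      have e4 : 0 ≤ Real.exp M₁ * ϖ ^ 2 * k := by positivity
      linarith
  obtain ⟨h1, h2, h3, h4⟩ := error_le_of_isNoiseBound hk hM0 hη hη1 hX hXs h hZ hsv hA hN hst hs h0
    hreg t
  have hpsi : Real.exp M₁ ^ 2 * ϖ ^ 2 * k = K ^ 2 * psiSq n k M₁ M₂ := by
    rw [hϖ2, psiSq, two_mul, Real.exp_add, sparsity]
    ring
  rw [hpsi] at h1 h2 h3 h4
  set γ := frobNorm (Gs - Zs * Zsᵀ)
  have hK2 : 1 ≤ K ^ 2 := one_le_pow₀ hK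
  have e1 : 0 ≤ condNum Zs ^ 2 * (Real.exp M₁ * γ ^ 2) := by positivity
  have e2 := le_mul_of_one_le_left e1 hK2
  have hB : 2 * rate M₁ η (1 / 128) (condNum Zs) ^ t * err X Zs αs βs (s 0)
      + condNum Zs ^ 2 * (192000 * (K ^ 2 * psiSq n k M₁ M₂)
        + 1000 * (Real.exp M₁ * γ ^ 2)) ≤ B := by
    simp only [B]
    linarith
  have hB0 : 0 ≤ B := by
    have : 0 ≤ 13 * B := (sq_nonneg _).trans (h2.trans (by linarith))
    linarith
  exact ⟨h1.trans hB, by linarith, by linarith, by linarith⟩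

end Network

end LatentSpace

/-! ### The main theorem: choice of constants and assembly of both parts -/

theorem theorem4p4 :
    ∃ M₀ c cη C₁ ρ C c₀ C' : ℝ,
      0 < M₀ ∧ 0 < c ∧ 0 < cη ∧ 0 < C₁ ∧ 0 < ρ ∧ 0 < C ∧ 0 < c₀ ∧ 0 < C' ∧ cη * ρ < 1 ∧
      ∀ (n k : ℕ) (M₁ M₂ η : ℝ) (X : Matrix (Fin n) (Fin n) ℝ)
        (αs : Fin n → ℝ) (βs : ℝ) (Gs : Matrix (Fin n) (Fin n) ℝ) (Zs : Matrix (Fin n) (Fin k) ℝ),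
        1 ≤ k → 0 ≤ M₂ → M₂ ≤ M₁ → 0 < η → η ≤ cη →
        IsCovariate X → (X ≠ 0 → M₀ * k ≤ stableRank X) →
        InClass M₁ M₂ X αs βs Gs → IsTopEigenFactor Gs Zs → 0 < singVal Zs (k - 1) →
        -- deterministic bound
        (∀ A : Matrix (Fin n) (Fin n) ℝ, IsAdjacency A →
          ∀ ζ : ℝ, ζ = zeta k A (sigmoidMat (theta X αs βs Gs)) X →
          C₁ * condNum Zs ^ 2 * Real.exp M₁ * ζ * signalFactor k M₁ η ζ (Gs - Zs * Zsᵀ)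
            ≤ opNorm Gs →
          ∀ s : ℕ → Iterate n k, IsPGD M₁ η A X s →
            err X Zs αs βs (s 0) ≤ c * Real.exp (-2 * M₁) * opNorm Zs ^ 4 / condNum Zs ^ 4 →
            ∀ t : ℕ, err X Zs αs βs (s t) ≤
              2 * rate M₁ η ρ (condNum Zs) ^ t * err X Zs αs βs (s 0)
                + C * condNum Zs ^ 2 / ρ *
                  (Real.exp (2 * M₁) * ζ ^ 2 * k
                    + Real.exp M₁ * frobNorm (Gs - Zs * Zsᵀ) ^ 2)) ∧
        -- high probability bound
        (∀ {Ω : Type*} [MeasurableSpace Ω] (μ : Measure Ω) [IsProbabilityMeasure μ]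
          (A : Ω → Matrix (Fin n) (Fin n) ℝ), IsRandomNetwork μ (theta X αs βs Gs) A →
          1 - (n : ℝ) ^ (-c₀) ≤ μ.real {ω |
            C₁ * condNum Zs ^ 2 * √n * Real.exp (M₁ - M₂ / 2) *
                signalFactor k M₁ η (zeta k (A ω) (sigmoidMat (theta X αs βs Gs)) X)
                  (Gs - Zs * Zsᵀ)
              ≤ opNorm Gs →
            ∀ s : ℕ → Iterate n k, IsPGD M₁ η (A ω) X s →
              err X Zs αs βs (s 0) ≤ c * Real.exp (-2 * M₁) * opNorm Zs ^ 4 / condNum Zs ^ 4 →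
              (∀ t : ℕ, err X Zs αs βs (s t) ≤
                2 * rate M₁ η ρ (condNum Zs) ^ t * err X Zs αs βs (s 0)
                  + C * condNum Zs ^ 2 / ρ *
                    (psiSq n k M₁ M₂ + Real.exp M₁ * frobNorm (Gs - Zs * Zsᵀ) ^ 2)) ∧
              (∀ T : ℕ, iterCount n k M₁ M₂ η ρ (condNum Zs) < T →
                frobNorm ((s T).Z * (s T).Zᵀ - Zs * Zsᵀ) ^ 2 ≤
                  C' * condNum Zs ^ 2 *
                    (psiSq n k M₁ M₂ + Real.exp M₁ * frobNorm (Gs - Zs * Zsᵀ) ^ 2) ∧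
                frobNorm ((s T).Z * (s T).Zᵀ - Gs) ^ 2 ≤
                  C' * condNum Zs ^ 2 *
                    (psiSq n k M₁ M₂ + Real.exp M₁ * frobNorm (Gs - Zs * Zsᵀ) ^ 2) ∧
                frobNorm ((s T).theta X - theta X αs βs Gs) ^ 2 ≤
                  C' * condNum Zs ^ 2 *
                    (psiSq n k M₁ M₂ + Real.exp M₁ * frobNorm (Gs - Zs * Zsᵀ) ^ 2))}) := by
  have hK := le_noiseConst
  have hK2 : (1 : ℝ) ≤ noiseConst ^ 2 := one_le_pow₀ (by linarith)
  -- One set of constants serves both parts. `C / ρ` equals `192000 noiseConst²`, and `C'` is 28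
  -- times this plus 2, where the 2 covers the optimization error after the burn-in.
  refine ⟨128, 2 / 10 ^ 10, 1 / 1024, 10 ^ 4 * noiseConst, 1 / 128, 1500 * noiseConst ^ 2, 1,
    28 * (2 + 192000 * noiseConst ^ 2), by norm_num, by norm_num, by norm_num, by positivity,
    by norm_num, by positivity, by norm_num, by positivity, by norm_num, ?_⟩
  intro n k M₁ M₂ η X αs βs Gs Zs hk hM₂ hM hη hη1 hX hXs h hZ hsv
  have hM0 : 0 ≤ M₁ := hM₂.trans hM
  have hΘ := h.theta_isSymm hX
  refine ⟨fun A hA ζ hζ hsig s hs h0 t => ?_, fun {Ω} _ μ _ A hA => ?_⟩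
  · exact deterministic_error_le (by linarith) (by linarith) hk hM0 hη hη1 hX hXs h hZ hsv hA hζ
      hsig hs h0 t
  have hn0 := ne_zero_of_singVal_pos hsv
  -- For `n = 1` the claimed probability is zero. The noise bound needs `n ≥ 2` so that `log n` is
  -- bounded away from zero.
  rcases (show n = 1 ∨ 2 ≤ n by omega) with rfl | hn
  · simp
  rw [Real.rpow_neg_one]
  refine (hA.le_measureReal_zeta_le hΘ hX hk hn (sparsity_le_one hM₂) (log_le_mul_sparsity hn0)
    fun i j hij => h.sigmoid_theta_le hij).trans (measureReal_mono fun ω hω hsig s hs h0 => ?_)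
  have herr := network_error_le (by linarith) hn hk hM₂ hM hη hη1 hX hXs h hZ hsv
    (hA.adjacency ω).1 hω hsig hs h0
  refine ⟨fun t => (herr t).1.trans (le_of_eq (by ring)), fun T hT => ?_⟩
  have hT' := rate_pow_mul_err_le hk hM0 hη hη1 h hZ hsv h0 hT
  have hγ : 0 ≤ condNum Zs ^ 2 * (Real.exp M₁ * frobNorm (Gs - Zs * Zsᵀ) ^ 2) := by positivity
  obtain ⟨-, h1, h2, h3⟩ := herr T
  refine ⟨h1.trans ?_, h2.trans ?_, h3.trans ?_⟩ <;> linarith
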